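/- Let $k$ be a commutative ring and $S\subset\mathbf Z$ a non-empty subset (for instance a finite one). **Forms.** Let ${}_S\mathcal D^*(x)$ be the cochain complex of free $k$-modules with basis $1$ and the Heaviside functions $Y_s$ ($Y_s(x)=1$ for $x\le s$, $0$ otherwise) in degree $0$, the Dirac functions $\omega_s$ in degree $1$ ($s\in S$), and $(df)(x)=f(x+1)-f(x)$, i.e. $d1=0$, $dY_s=-\omega_s$. Evaluation at $x=+\infty$ sends $1,Y_s,\omega_s$ to $1,0,0$, and evaluation at $x=-\infty$ sends them to $1,1,0$. Put ${}_S\mathcal D^*(x_0,\dots,x_r)={}_S\mathcal D^*(x_0)\otimes\cdots\otimes{}_S\mathcal D^*(x_r)$ (graded tensor product), and let ${}_S\mathcal D^*(\Delta_r)$ be the equalizer of the two maps $\prod_i{}_S\mathcal D^*(x_0,\dots,\hat x_i,\dots,x_r)\rightrightarrows\prod_{i<j}{}_S\mathcal D^*(x_0,\dots,\hat x_i,\dots,\hat x_j,\dots,x_r)$ obtained by setting $x_j=+\infty$, resp. $x_i=+\infty$. It is a complex of simplicial $k$-modules ${}_S\mathcal D^*(\Delta_*)$: the face $\partial_i$ sets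 $x_i=-\infty$, and the degeneracies duplicate a variable by $1\mapsto 1\otimes 1$, $Y_s\mapsto Y_s\otimes Y_s$, $\omega_s\mapsto\omega_s\otimes Y_s+Y_s\otimes\omega_s$. **Tensor coproducts.** For a cosimplicial $k$-module $M^*$ let $\overline M^n=\bigcap_j\ker s^j$, with $d=\sum_i(-1)^id^i$. For a simplicial $k$-module $A_*$ let $\overline A_n=\bigcap_{i>0}\ker\partial_i$, with boundary $d'=\partial_0$. These are canonical direct factors of $M^n$ and $A_n$, with complements $\sum_{i>0}\operatorname{im}d^i$ and the submodule of degenerate elements. $M^*\,\Delta\,A_*$ is the module of sequences $(w_n)\in\prod_nM^n\otimes A_n$ such that $(u^*\otimes1)w_m=(1\otimes u_*)w_n$ in $M^n\otimes A_m$ for every nondecreasing $u:[m]\to[n]$, where $u^*:M^m\to M^n$ and $u_*:A_n\to A_m$, and whose images in $\overline M^n\otimes\overline A_n$ vanish for all but finitely many $n$. $\overline M^*\,\Delta\,\overline A_*$ is the kernel of $d\otimes1-1\otimes d'$ in $\bigoplus_n\overline M^n\otimes\overline A_n$. With $A={}_S\mathcal D^p(\Delta_*)$, $p\ge0$, and the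 differential $1\otimes d$ these give cochain complexes ${}_S\mathcal D^*(M)=M^*\,\Delta\,{}_S\mathcal D^*(\Delta_*)$ and $\overline M^*\,\Delta\,{}_S\overline{\mathcal D}{}^*(\Delta_*)$. **The morphism $\theta$.** A choice of fundamental forms is a sequence $\omega_{p+1}\in{}_S\mathcal D^p(\Delta_{p+1})$, $p\ge0$, vanishing on all faces except the $0$-face, such that $\partial_0\omega_{p+1}=\chi_p$, where $\chi_0=1$ and $\chi_{p+1}=d\omega_{p+1}$. Put $$\theta_p(m)=m\otimes\chi_p+dm\otimes\omega_{p+1}\qquad(m\in\overline M^p).$$ **Theorem.** 1. Fundamental forms exist. For every choice of them and every cosimplicial $k$-module $M^*$, $\theta$ is a quasi-isomorphism of cochain complexes $\overline M^*\to\overline M^*\,\Delta\,{}_S\overline{\mathcal D}{}^*(\Delta_*)$. 2. For every choice of fundamental forms and every $M^*$, taking images in the tensor products of the normalizations is an isomorphism of complexes $\nu_M:{}_S\mathcal D^*(M)\cong\overline M^*\,\Delta\,{}_S\overline{\mathcal D}{}^*(\Delta_*)$. There is a morphism of complexes $\Theta_M$, natural in $M$, from the complex of all cochains $(M^*,\sum_i(-1)^id^i)$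 to ${}_S\mathcal D^*(M)$ whose restriction to $\overline M^*$ is $\nu_M^{-1}\theta$; for $m\in M^p$, the elements $\Theta_M(m)$ and $m\otimes\chi_p+dm\otimes\omega_{p+1}$ have the same images in the tensor products of the normalizations. 3. For a simplicial set $X$ let $C^*(X)$ be the cosimplicial module $[n]\mapsto k^{X_n}$, as well as its (unnormalized) cochain complex, let ${}_S\mathcal D^*(X)=C^*(X)\,\Delta\,{}_S\mathcal D^*(\Delta_*)$, and let $\mathrm{Hom}(X_*,{}_S\mathcal D^*(\Delta_*))$ be the complex of simplicial maps from $X$ to the forms. In the commutative triangle, natural in $X$, $$\begin{array}{ccc}{}_S\mathcal D^*(X)&\longrightarrow&\mathrm{Hom}(X_*,{}_S\mathcal D^*(\Delta_*))\\&\nwarrow\quad\nearrow&\\&C^*(X)&\end{array}$$ with $\Theta_{C^*(X)}$ on the left and the canonical map $c\otimes\omega\mapsto(x\mapsto c(x)\omega)$ on top, all three arrows are quasi-isomorphisms. The arrow on the right sends a normalized cochain $c\in C^p(X)$ to a simplicial map that is, modulo degenerate forms, $x\mapsto c(x)\chi_p$ on $X_p$, $x\mapsto(dc)(x)\,\omega_{p+1}$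 on $X_{p+1}$, and $0$ on $X_n$ for $n\ne p,p+1$. 4. For $S\subset T\subset\mathbf Z$ the inclusion ${}_S\mathcal D^*(X)\to{}_T\mathcal D^*(X)$ is a quasi-isomorphism. -/

import Mathlib

open CategoryTheory Opposite TensorProduct

universe u

namespace QuasiComm

/-! ### Forms on cubes -/

/-- Basis of the module of forms in the variables `x_0, …, x_n`. In one variable the basis consists of
the constant function `1`, the Heaviside functions `Y_s` (`Y_s(x) = 1` for `x ≤ s` and `0`
otherwise) and the Dirac functions `ω_s` (in degree one), `s ∈ ℤ`. The pair `(g, A)` stands for the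
tensor product whose `i`-th factor is `1` if `g i = none`, is `Y_s` if `g i = some s` and `i ∉ A`,
and is `ω_s` if `g i = some s` and `i ∈ A`. Pairs with `g i = none` for some `i ∈ A` mean nothing;
they are excluded in `Cube.forms`. -/
abbrev CubeBasis (n : ℕ) := (Fin (n + 1) → Option ℤ) × Finset (Fin (n + 1))

/-- Formal linear combinations of the basis elements in the variables `x_0, …, x_n`. -/
abbrev Cube (k : Type u) [CommRing k] (n : ℕ) := CubeBasis n →₀ k

namespace Cube

variable (k : Type u) [CommRing k]

/-- The Koszul sign `(-1)` to the number of one-form factors before position `i`. -/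
def signBelow {n : ℕ} (A : Finset (Fin (n + 1))) (i : Fin (n + 1)) : k :=
  (-1) ^ (A.filter (· < i)).card

/-- The differential of the graded tensor product, determined by `d 1 = 0`, `d Y_s = -ω_s`,
`d ω_s = 0` on each factor. -/
noncomputable def d (n : ℕ) : Cube k n →ₗ[k] Cube k n :=
  Finsupp.linearCombination k fun b : CubeBasis n =>
    -∑ i with i ∉ b.2 ∧ b.1 i ≠ none, signBelow k b.2 i • Finsupp.single (b.1, insert i b.2) 1

/-- The operator of a nondecreasing map `u`: it puts `x_i = max {y_j | u j = i}`, where an empty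
maximum is `-∞`. On factors: `1 ↦ 1 ⊗ ⋯ ⊗ 1`, `Y_s ↦ Y_s ⊗ ⋯ ⊗ Y_s` and `ω_s` goes to the sum of
the tensors with one factor `ω_s` and all the others `Y_s`; for an empty fibre `Y_s ↦ 1`,
`ω_s ↦ 0`. The sum is over the sets `B` which `u` maps bijectively onto `A`. For a coface map this is
the evaluation `x_i = -∞`, and for a codegeneracy map the duplication of a variable. -/
noncomputable def pull {m n : ℕ} (u : Fin (m + 1) →o Fin (n + 1)) : Cube k n →ₗ[k] Cube k m :=
  Finsupp.linearCombination k fun b : CubeBasis n =>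
    ∑ B : Finset (Fin (m + 1)) with B.image u = b.2 ∧ B.card = b.2.card,
      Finsupp.single (b.1 ∘ u, B) 1

/-- The evaluation `x_i = +∞` (`1 ↦ 1`, `Y_s ↦ 0`, `ω_s ↦ 0`). Forms in the variables other than
`x_i` are identified with the forms in all variables that are constant in `x_i`. -/
noncomputable def top {n : ℕ} (i : Fin (n + 1)) : Cube k n →ₗ[k] Cube k n :=
  Finsupp.linearCombination k fun b : CubeBasis n =>
    if b.1 i = none then Finsupp.single b 1 else 0

variable {k}

theorem d_single {n : ℕ} (b : CubeBasis n) : d k n (Finsupp.single b 1) =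
    -∑ i with i ∉ b.2 ∧ b.1 i ≠ none, signBelow k b.2 i • Finsupp.single (b.1, insert i b.2) 1 := by
  simp [d]

theorem pull_single {m n : ℕ} (u : Fin (m + 1) →o Fin (n + 1)) (b : CubeBasis n) :
    pull k u (Finsupp.single b 1) =
    ∑ B : Finset (Fin (m + 1)) with B.image u = b.2 ∧ B.card = b.2.card,
      Finsupp.single (b.1 ∘ u, B) 1 := by
  simp [pull]

theorem top_single {n : ℕ} (i : Fin (n + 1)) (b : CubeBasis n) :
    top k i (Finsupp.single b 1) = if b.1 i = none then Finsupp.single b 1 else 0 := by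
  simp [top]

theorem top_top {n : ℕ} (i : Fin (n + 1)) (f : Cube k n) : top k i (top k i f) = top k i f := by
  suffices h : top k i ∘ₗ top k i = top k i from LinearMap.congr_fun h f
  ext1 b
  ext1
  simp only [LinearMap.comp_apply, Finsupp.lsingle_apply, top_single]
  split_ifs with h <;> simp [top_single, h]

theorem top_comm {n : ℕ} (i j : Fin (n + 1)) (f : Cube k n) :
    top k i (top k j f) = top k j (top k i f) := by
  suffices h : top k i ∘ₗ top k j = top k j ∘ₗ top k i from LinearMap.congr_fun h f
  ext1 b
  ext1
  simp only [LinearMap.comp_apply, Finsupp.lsingle_apply, top_single]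
  split_ifs with h h' h' <;> simp [top_single, h, h']

theorem top_d {n : ℕ} (i : Fin (n + 1)) (f : Cube k n) :
    top k i (d k n f) = d k n (top k i f) := by
  suffices h : top k i ∘ₗ d k n = d k n ∘ₗ top k i from LinearMap.congr_fun h f
  ext1 b
  ext1
  simp only [LinearMap.comp_apply, Finsupp.lsingle_apply, top_single, d_single, map_neg, map_sum,
    map_smul]
  split_ifs with h
  · rw [d_single]
  · simp

theorem top_pull_top {m n : ℕ} (u : Fin (m + 1) →o Fin (n + 1)) (j : Fin (m + 1))
    (f : Cube k n) : top k j (pull k u (top k (u j) f)) = top k j (pull k u f) := by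
  suffices h : top k j ∘ₗ pull k u ∘ₗ top k (u j) = top k j ∘ₗ pull k u from
    LinearMap.congr_fun h f
  ext1 b
  ext1
  simp only [LinearMap.comp_apply, Finsupp.lsingle_apply, top_single]
  split_ifs with h
  · rfl
  · simp [pull_single, top_single, h]

theorem pull_id {n : ℕ} (f : Cube k n) : pull k OrderHom.id f = f := by
  suffices h : pull k (OrderHom.id : Fin (n + 1) →o Fin (n + 1)) = LinearMap.id from
    LinearMap.congr_fun h f
  ext1 b
  ext1
  simp only [LinearMap.comp_apply, Finsupp.lsingle_apply, pull_single, LinearMap.id_apply]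
  rw [Finset.sum_eq_single b.2]
  · rfl
  · intro B hB h
    exact absurd (by simpa using (Finset.mem_filter.1 hB).2.1) h
  · intro h
    exact absurd (by simp) h

theorem pull_pull {l m n : ℕ} (v : Fin (l + 1) →o Fin (m + 1)) (u : Fin (m + 1) →o Fin (n + 1))
    (f : Cube k n) : pull k v (pull k u f) = pull k (u.comp v) f := by
  suffices h : pull k v ∘ₗ pull k u = pull k (u.comp v) from LinearMap.congr_fun h f
  ext1 b
  ext1
  simp only [LinearMap.comp_apply, Finsupp.lsingle_apply, pull_single, map_sum]
  rw [Finset.sum_sigma']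
  refine Finset.sum_bij' (fun x _ => x.2) (fun B _ => ⟨B.image v, B⟩) ?_ ?_ ?_ ?_ ?_
  · rintro ⟨B, C⟩ h
    simp only [Finset.mem_sigma, Finset.mem_filter, Finset.mem_univ, true_and] at h ⊢
    obtain ⟨⟨h1, h2⟩, h3, h4⟩ := h
    refine ⟨?_, h4.trans h2⟩
    rw [← h1, ← h3, Finset.image_image]
    rfl
  · intro C h
    simp only [Finset.mem_sigma, Finset.mem_filter, Finset.mem_univ, true_and] at h ⊢
    obtain ⟨h1, h2⟩ := h
    have e : (C.image v).image u = b.2 := by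
      rw [← h1, Finset.image_image]
      rfl
    have a1 : (C.image v).card ≤ C.card := Finset.card_image_le
    have a2 : ((C.image v).image u).card ≤ (C.image v).card := Finset.card_image_le
    rw [e] at a2
    exact ⟨⟨e, by omega⟩, by omega⟩
  · rintro ⟨B, C⟩ h
    simp only [Finset.mem_sigma, Finset.mem_filter, Finset.mem_univ, true_and] at h ⊢
    obtain ⟨⟨h1, h2⟩, h3, h4⟩ := h
    subst h3
    rfl
  · intro C h
    rfl
  · rintro ⟨B, C⟩ h
    rfl

theorem signBelow_insert {n : ℕ} (A : Finset (Fin (n + 1))) (i j : Fin (n + 1)) (hi : i ∉ A) :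
    signBelow k (insert i A) j = (if i < j then -1 else 1) * signBelow k A j := by
  unfold signBelow
  rw [Finset.filter_insert]
  split_ifs with h
  · rw [Finset.card_insert_of_notMem (by simp [hi]), pow_succ]
    ring
  · simp

theorem d_d {n : ℕ} (f : Cube k n) : d k n (d k n f) = 0 := by
  suffices h : d k n ∘ₗ d k n = 0 from LinearMap.congr_fun h f
  ext1 b
  ext1
  simp only [LinearMap.comp_apply, Finsupp.lsingle_apply, d_single, map_neg, map_sum, map_smul,
    LinearMap.zero_apply, Finset.smul_sum, smul_neg, Finset.sum_neg_distrib, neg_neg]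
  rw [Finset.sum_sigma']
  refine Finset.sum_involution (fun x _ => ⟨x.2, x.1⟩) ?_ ?_ ?_ ?_
  · rintro ⟨i, j⟩ h
    simp only [Finset.mem_sigma, Finset.mem_filter, Finset.mem_univ, true_and,
      Finset.mem_insert, not_or] at h ⊢
    obtain ⟨⟨h1, h2⟩, ⟨h3, h4⟩, h5⟩ := h
    rw [signBelow_insert _ _ _ h1, signBelow_insert _ _ _ h4, Finset.insert_comm j i]
    simp only [smul_smul, ← add_smul]
    rcases lt_or_gt_of_ne h3 with h | h
    · simp [h, h.not_gt, mul_comm]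
    · simp [h, h.not_gt, mul_comm]
  · rintro ⟨i, j⟩ h _ e
    simp only [Finset.mem_sigma, Finset.mem_filter, Finset.mem_univ, true_and,
      Finset.mem_insert, not_or] at h e
    simp only [Sigma.mk.injEq] at e
    exact h.2.1.1 e.1
  · rintro ⟨i, j⟩ h
    simp only [Finset.mem_sigma, Finset.mem_filter, Finset.mem_univ, true_and,
      Finset.mem_insert, not_or] at h ⊢
    tauto
  · rintro ⟨i, j⟩ h
    rfl

theorem signBelow_image {m n : ℕ} (u : Fin (m + 1) →o Fin (n + 1)) (B : Finset (Fin (m + 1)))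
    (hB : Set.InjOn u B) (j : Fin (m + 1)) (hj : u j ∉ B.image u) :
    signBelow k (B.image u) (u j) = signBelow k B j := by
  unfold signBelow
  congr 1
  rw [Finset.filter_image, Finset.card_image_of_injOn]
  · congr 1
    refine Finset.filter_congr fun a ha => ⟨fun h => ?_, fun h => ?_⟩
    · by_contra h'
      exact absurd (u.monotone (not_lt.1 h')) (not_le.2 h)
    · refine lt_of_le_of_ne (u.monotone h.le) fun e => hj ?_
      rw [← e]
      exact Finset.mem_image_of_mem u ha
  · exact hB.mono fun x hx => (Finset.mem_filter.1 hx).1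

theorem pull_d {m n : ℕ} (u : Fin (m + 1) →o Fin (n + 1)) (f : Cube k n) :
    pull k u (d k n f) = d k m (pull k u f) := by
  suffices h : pull k u ∘ₗ d k n = d k m ∘ₗ pull k u from LinearMap.congr_fun h f
  ext1 b
  ext1
  obtain ⟨g, A⟩ := b
  simp only [LinearMap.comp_apply, Finsupp.lsingle_apply, d_single, pull_single, map_neg, map_sum,
    map_smul, Finset.smul_sum, Finset.sum_neg_distrib, neg_inj]
  rw [Finset.sum_sigma', Finset.sum_sigma']
  have inj : ∀ (B : Finset (Fin (m + 1))), B.image u = A → B.card = A.card →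
      Set.InjOn u B := fun B h1 h2 =>
    Finset.card_image_iff.1 (by rw [h1, h2])
  rw [← Finset.sum_filter_add_sum_filter_not (Finset.sigma _ _)
    (fun x : (_ : Finset (Fin (m + 1))) × Fin (m + 1) => u x.2 ∈ A)]
  have hz : ∀ s : Finset ((_ : Finset (Fin (m + 1))) × Fin (m + 1)),
      s = (Finset.sigma (Finset.univ.filter fun B : Finset (Fin (m + 1)) =>
        B.image u = A ∧ B.card = A.card) fun B => Finset.univ.filter fun j =>
          j ∉ B ∧ (g ∘ u) j ≠ none).filter (fun x => u x.2 ∈ A) →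
      ∑ x ∈ s, signBelow k x.1 x.2 •
        (Finsupp.single (g ∘ u, insert x.2 x.1) 1 : Cube k m) = 0 := by
    rintro s rfl
    have ex : ∀ x : (_ : Finset (Fin (m + 1))) × Fin (m + 1), ∃ a : Fin (m + 1),
        x.1.image u = A → x.1.card = A.card → u x.2 ∈ A → a ∈ x.1 ∧ u a = u x.2 := by
      intro x
      by_cases h : x.1.image u = A ∧ u x.2 ∈ A
      · obtain ⟨a, h1, h2⟩ := Finset.mem_image.1 (h.1.symm ▸ h.2)
        exact ⟨a, fun _ _ _ => ⟨h1, h2⟩⟩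
      · exact ⟨0, fun h1 _ h2 => absurd ⟨h1, h2⟩ h⟩
    choose a ha using ex
    have key : ∀ (B : Finset (Fin (m + 1))) (j c : Fin (m + 1)), B.image u = A →
        B.card = A.card → j ∉ B → c ∈ B → u c = u j →
        (insert j (B.erase c)).image u = A ∧ (insert j (B.erase c)).card = A.card ∧
        signBelow k (insert j (B.erase c)) c = - signBelow k B j := by
      intro B j c h1 h2 hj hc hu
      have hjc : j ≠ c := fun h => hj (h ▸ hc)
      refine ⟨?_, ?_, ?_⟩
      · rw [Finset.image_insert, ← hu, ← Finset.image_insert, Finset.insert_erase hc, h1]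
      · rw [Finset.card_insert_of_notMem (by simp [hj]), Finset.card_erase_add_one hc, h2]
      · have hB : B = insert c (B.erase c) := (Finset.insert_erase hc).symm
        conv_rhs => rw [hB]
        rw [signBelow_insert _ _ _ (by simp [hj]), signBelow_insert _ _ _ (by simp)]
        have hs : signBelow k (B.erase c) c = signBelow k (B.erase c) j := by
          unfold signBelow
          congr 2
          refine Finset.filter_congr fun x hx => ?_
          have hx' := Finset.mem_erase.1 hx
          have hne : u x ≠ u c := fun h => hx'.1 (inj B h1 h2 hx'.2 hc h)
          constructor
          · intro h
            by_contra h'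
            exact hne (le_antisymm (u.monotone h.le) (hu ▸ u.monotone (not_lt.1 h')))
          · intro h
            by_contra h'
            exact hne (le_antisymm (hu ▸ u.monotone h.le) (u.monotone (not_lt.1 h')))
        rw [hs]
        rcases lt_or_gt_of_ne hjc with h | h
        · simp [h, h.not_gt]
        · simp [h, h.not_gt]
    refine Finset.sum_involution (fun x _ => ⟨insert x.2 (x.1.erase (a x)), a x⟩) ?_ ?_ ?_ ?_
    · rintro ⟨B, j⟩ h
      simp only [Finset.mem_sigma, Finset.mem_filter, Finset.mem_univ, true_and] at h
      obtain ⟨⟨⟨h1, h2⟩, h3, h4⟩, h5⟩ := h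
      obtain ⟨h6, h7⟩ := ha ⟨B, j⟩ h1 h2 h5
      rw [(key B j _ h1 h2 h3 h6 h7).2.2, Finset.insert_comm, Finset.insert_erase h6]
      simp
    · rintro ⟨B, j⟩ h _ e
      simp only [Finset.mem_sigma, Finset.mem_filter, Finset.mem_univ, true_and] at h
      obtain ⟨⟨⟨h1, h2⟩, h3, h4⟩, h5⟩ := h
      obtain ⟨h6, h7⟩ := ha ⟨B, j⟩ h1 h2 h5
      simp only [Sigma.mk.injEq, heq_eq_eq] at e
      exact h3 (e.2 ▸ h6)
    · rintro ⟨B, j⟩ h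
      simp only [Finset.mem_sigma, Finset.mem_filter, Finset.mem_univ, true_and] at h ⊢
      obtain ⟨⟨⟨h1, h2⟩, h3, h4⟩, h5⟩ := h
      obtain ⟨h6, h7⟩ := ha ⟨B, j⟩ h1 h2 h5
      obtain ⟨k1, k2, -⟩ := key B j _ h1 h2 h3 h6 h7
      have hjc : a ⟨B, j⟩ ≠ j := fun h => h3 (h ▸ h6)
      refine ⟨⟨⟨k1, k2⟩, by simp [hjc], ?_⟩, by rw [h7]; exact h5⟩
      simp only [Function.comp_apply] at h4 ⊢
      rw [h7]
      exact h4
    · rintro ⟨B, j⟩ h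
      simp only [Finset.mem_sigma, Finset.mem_filter, Finset.mem_univ, true_and] at h
      obtain ⟨⟨⟨h1, h2⟩, h3, h4⟩, h5⟩ := h
      obtain ⟨h6, h7⟩ := ha ⟨B, j⟩ h1 h2 h5
      obtain ⟨k1, k2, -⟩ := key B j _ h1 h2 h3 h6 h7
      have hjc : a ⟨B, j⟩ ≠ j := fun h => h3 (h ▸ h6)
      obtain ⟨h8, h9⟩ := ha ⟨insert j (B.erase (a ⟨B, j⟩)), a ⟨B, j⟩⟩ k1 k2
        (by simp only; rw [h7]; exact h5)
      have e : a ⟨insert j (B.erase (a ⟨B, j⟩)), a ⟨B, j⟩⟩ = j :=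
        inj _ k1 k2 h8 (by simp) (h9.trans h7)
      simp only [e]
      rw [Finset.erase_insert (by simp [h3]), Finset.insert_erase h6]
  rw [hz _ rfl, zero_add]
  have ex : ∀ x : (_ : Fin (n + 1)) × Finset (Fin (m + 1)), ∃ j : Fin (m + 1),
      x.2.image u = insert x.1 A → j ∈ x.2 ∧ u j = x.1 := by
    intro x
    by_cases h : x.2.image u = insert x.1 A
    · obtain ⟨a, h1, h2⟩ := Finset.mem_image.1 (h.symm ▸ Finset.mem_insert_self x.1 A)
      exact ⟨a, fun _ => ⟨h1, h2⟩⟩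
    · exact ⟨0, fun h1 => absurd h1 h⟩
  choose c hc using ex
  have key2 : ∀ (i : Fin (n + 1)) (B : Finset (Fin (m + 1))), i ∉ A →
      B.image u = insert i A → B.card = (insert i A).card →
      (B.erase (c ⟨i, B⟩)).image u = A ∧ (B.erase (c ⟨i, B⟩)).card = A.card := by
    intro i B hi h1 h2
    obtain ⟨h3, h4⟩ := hc ⟨i, B⟩ h1
    have hinj : Set.InjOn u B := Finset.card_image_iff.1 (by rw [h1, h2])
    constructor
    · ext x
      constructor
      · intro hx
        obtain ⟨y, hy, rfl⟩ := Finset.mem_image.1 hx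
        obtain ⟨hy1, hy2⟩ := Finset.mem_erase.1 hy
        have := h1 ▸ Finset.mem_image_of_mem u hy2
        rcases Finset.mem_insert.1 this with h | h
        · exact absurd (hinj hy2 h3 (h.trans h4.symm)) hy1
        · exact h
      · intro hx
        have : x ∈ B.image u := h1.symm ▸ Finset.mem_insert_of_mem hx
        obtain ⟨y, hy, rfl⟩ := Finset.mem_image.1 this
        refine Finset.mem_image_of_mem u (Finset.mem_erase.2 ⟨?_, hy⟩)
        rintro rfl
        simp only at h4
        exact hi (h4 ▸ hx)
    · rw [Finset.card_erase_of_mem h3, h2, Finset.card_insert_of_notMem hi]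
      rfl
  refine Finset.sum_bij' (fun x _ => ⟨x.2.erase (c x), c x⟩) (fun y _ => ⟨u y.2, insert y.2 y.1⟩)
    ?_ ?_ ?_ ?_ ?_
  · rintro ⟨i, B⟩ h
    simp only [Finset.mem_sigma, Finset.mem_filter, Finset.mem_univ, true_and] at h ⊢
    obtain ⟨⟨h1, h2⟩, h3, h4⟩ := h
    obtain ⟨h5, h6⟩ := hc ⟨i, B⟩ h3
    refine ⟨⟨key2 i B h1 h3 h4, by simp, ?_⟩, by rw [h6]; exact h1⟩
    simp only [Function.comp_apply]
    rw [h6]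
    exact h2
  · rintro ⟨B, j⟩ h
    simp only [Finset.mem_sigma, Finset.mem_filter, Finset.mem_univ, true_and] at h ⊢
    obtain ⟨⟨⟨h1, h2⟩, h3, h4⟩, h5⟩ := h
    refine ⟨⟨h5, h4⟩, by rw [Finset.image_insert, h1], ?_⟩
    rw [Finset.card_insert_of_notMem h3, Finset.card_insert_of_notMem h5, h2]
  · rintro ⟨i, B⟩ h
    simp only [Finset.mem_sigma, Finset.mem_filter, Finset.mem_univ, true_and] at h
    obtain ⟨⟨h1, h2⟩, h3, h4⟩ := h
    obtain ⟨h5, h6⟩ := hc ⟨i, B⟩ h3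
    simp only
    rw [Finset.insert_erase h5]
    exact Sigma.ext h6 HEq.rfl
  · rintro ⟨B, j⟩ h
    simp only [Finset.mem_sigma, Finset.mem_filter, Finset.mem_univ, true_and] at h
    obtain ⟨⟨⟨h1, h2⟩, h3, h4⟩, h5⟩ := h
    have k1 : (insert j B).image u = insert (u j) A := by rw [Finset.image_insert, h1]
    have k2 : (insert j B).card = (insert (u j) A).card := by
      rw [Finset.card_insert_of_notMem h3, Finset.card_insert_of_notMem h5, h2]
    have hinj : Set.InjOn u (insert j B : Finset _) := Finset.card_image_iff.1 (by rw [k1, k2])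
    obtain ⟨h6, h7⟩ := hc ⟨u j, insert j B⟩ k1
    have e : c ⟨u j, insert j B⟩ = j := hinj h6 (by simp) h7
    simp only [e]
    rw [Finset.erase_insert h3]
  · rintro ⟨i, B⟩ h
    simp only [Finset.mem_sigma, Finset.mem_filter, Finset.mem_univ, true_and] at h
    obtain ⟨⟨h1, h2⟩, h3, h4⟩ := h
    obtain ⟨h5, h6⟩ := hc ⟨i, B⟩ h3
    obtain ⟨k1, k2⟩ := key2 i B h1 h3 h4
    simp only
    rw [Finset.insert_erase h5]
    congr 1
    rw [← signBelow_image u (B.erase (c ⟨i, B⟩)) (inj _ k1 k2) (c ⟨i, B⟩) (by rw [k1, h6]; exact h1),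
      k1, h6]

variable (k) in
/-- The module of `p`-forms in `x_0, …, x_n` all of whose factors are `1`, `Y_s`, `ω_s` with
`s ∈ S`: the degree `p` part of the `(n+1)`-st graded tensor power of the one-variable forms. -/
def forms (S : Set ℤ) (p n : ℕ) : Submodule k (Cube k n) :=
  Finsupp.supported k k
    {b | b.2.card = p ∧ (∀ i ∈ b.2, b.1 i ≠ none) ∧ ∀ i s, b.1 i = some s → s ∈ S}

theorem forms_mono {S T : Set ℤ} (h : S ⊆ T) (p n : ℕ) : forms k S p n ≤ forms k T p n :=
  Finsupp.supported_mono fun (b : CubeBasis n) hb =>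
    (⟨hb.1, hb.2.1, fun i s e => h (hb.2.2 i s e)⟩ : b.2.card = p ∧ (∀ i ∈ b.2, b.1 i ≠ none) ∧
      ∀ i s, b.1 i = some s → s ∈ T)

theorem map_mem_of_single {n : ℕ} {S : Set ℤ} {p : ℕ} {V : Type*} [AddCommGroup V] [Module k V]
    (L : Cube k n →ₗ[k] V) (N : Submodule k V)
    (h : ∀ b : CubeBasis n, b.2.card = p → (∀ i ∈ b.2, b.1 i ≠ none) →
      (∀ i s, b.1 i = some s → s ∈ S) → L (Finsupp.single b 1) ∈ N)
    {f : Cube k n} (hf : f ∈ forms k S p n) : L f ∈ N := by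
  have h1 : forms k S p n ≤ N.comap L := by
    rw [forms, Finsupp.supported_eq_span_single, Submodule.span_le]
    rintro _ ⟨b, hb, rfl⟩
    exact h b hb.1 hb.2.1 hb.2.2
  exact h1 hf

theorem d_mem {n : ℕ} {S : Set ℤ} {p : ℕ} {f : Cube k n} (hf : f ∈ forms k S p n) :
    d k n f ∈ forms k S (p + 1) n := by
  refine map_mem_of_single (d k n) _ (fun b h1 h2 h3 => ?_) hf
  rw [d_single]
  refine Submodule.neg_mem _ (Submodule.sum_mem _ fun i hi => Submodule.smul_mem _ _ ?_)
  simp only [Finset.mem_filter, Finset.mem_univ, true_and] at hi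
  refine Finsupp.single_mem_supported k _ ⟨?_, ?_, h3⟩
  · rw [Finset.card_insert_of_notMem hi.1, h1]
  · intro j hj
    rcases Finset.mem_insert.1 hj with rfl | hj
    · exact hi.2
    · exact h2 j hj

theorem pull_mem {m n : ℕ} (u : Fin (m + 1) →o Fin (n + 1)) {S : Set ℤ} {p : ℕ} {f : Cube k n}
    (hf : f ∈ forms k S p n) : pull k u f ∈ forms k S p m := by
  refine map_mem_of_single (pull k u) _ (fun b h1 h2 h3 => ?_) hf
  rw [pull_single]
  refine Submodule.sum_mem _ fun B hB => ?_
  simp only [Finset.mem_filter, Finset.mem_univ, true_and] at hB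
  refine Finsupp.single_mem_supported k _ ⟨hB.2.trans h1, fun j hj => ?_, fun j => h3 (u j)⟩
  exact h2 _ (hB.1 ▸ Finset.mem_image_of_mem u hj)

theorem top_mem {n : ℕ} (i : Fin (n + 1)) {S : Set ℤ} {p : ℕ} {f : Cube k n}
    (hf : f ∈ forms k S p n) : top k i f ∈ forms k S p n := by
  refine map_mem_of_single (top k i) _ (fun b h1 h2 h3 => ?_) hf
  rw [top_single]
  split_ifs
  · exact Finsupp.single_mem_supported k _ ⟨h1, h2, h3⟩
  · exact Submodule.zero_mem _

variable (k) in
/-- The coefficient function of `dx_I` at `x`, when forms are read as functions on `ℤ^(n+1)`. -/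
noncomputable def value {n : ℕ} (I : Finset (Fin (n + 1))) (x : Fin (n + 1) → ℤ) :
    Cube k n →ₗ[k] k :=
  Finsupp.linearCombination k fun b : CubeBasis n =>
    if b.2 = I ∧ (∀ i, ∀ s ∈ b.1 i, if i ∈ I then x i = s else x i ≤ s) then 1 else 0

/-- Read on functions, `Cube.d` is the calculus of differences `(df)(x) = f(x + 1) - f(x)`. -/
theorem value_d {n : ℕ} {S : Set ℤ} {p : ℕ} {f : Cube k n} (hf : f ∈ forms k S p n)
    (I : Finset (Fin (n + 1))) (x : Fin (n + 1) → ℤ) :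
    value k I x (d k n f) = ∑ i ∈ I, signBelow k I i *
      (value k (I.erase i) (Function.update x i (x i + 1)) f - value k (I.erase i) x f) := by
  have hL := map_mem_of_single ((value k I x ∘ₗ d k n) - ∑ i ∈ I, signBelow k I i •
      (value k (I.erase i) (Function.update x i (x i + 1)) - value k (I.erase i) x)) ⊥ ?_ hf
  · simpa [sub_eq_zero] using hL
  rintro ⟨g, A⟩ h1 h2 h3
  simp only [Submodule.mem_bot, LinearMap.sub_apply, sub_eq_zero,
    LinearMap.comp_apply, d_single, map_neg, map_sum, map_smul, LinearMap.sum_apply,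
    LinearMap.smul_apply, smul_eq_mul]
  simp only [value, Finsupp.linearCombination_single, one_smul]
  by_cases hA : ∃ i, i ∉ A ∧ insert i A = I
  · obtain ⟨i, hi, rfl⟩ := hA
    have hu : ∀ j, j ∉ A → insert j A = insert i A → j = i := fun j hj h => by
      have := h ▸ Finset.mem_insert_self j A
      exact (Finset.mem_insert.1 this).resolve_right hj
    have hs : signBelow k (insert i A) i = signBelow k A i := by
      rw [signBelow_insert _ _ _ hi]
      simp
    rw [Finset.sum_filter, Finset.sum_eq_single i, Finset.sum_eq_single i]
    · rw [Finset.erase_insert hi, hs]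
      rcases hg : g i with _ | s
      · have hP : ∀ y : Fin (n + 1) → ℤ, (∀ j, j ≠ i → y j = x j) →
            ((∀ j, ∀ s ∈ g j, if j ∈ A then y j = s else y j ≤ s) ↔
              ∀ j, ∀ s ∈ g j, if j ∈ A then x j = s else x j ≤ s) := by
          intro y hy
          refine forall_congr' fun j => ?_
          by_cases hj : j = i
          · subst hj
            simp [hg]
          · rw [hy j hj]
        simp only [true_and, hP (Function.update x i (x i + 1))
          (fun j hj => Function.update_of_ne hj _ _)]
        simp
      · have hP : ∀ (y : Fin (n + 1) → ℤ) (C : Finset (Fin (n + 1))),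
            (∀ j, j ≠ i → y j = x j) → (∀ j, j ≠ i → (j ∈ C ↔ j ∈ A)) →
            ((∀ j, ∀ s ∈ g j, if j ∈ C then y j = s else y j ≤ s) ↔
              ((if i ∈ C then y i = s else y i ≤ s) ∧
              ∀ j, j ≠ i → ∀ s ∈ g j, if j ∈ A then x j = s else x j ≤ s)) := by
          intro y C hy hC
          constructor
          · intro h
            refine ⟨h i s hg, fun j hj t ht => ?_⟩
            have := h j t ht
            simpa only [hC j hj, hy j hj] using this
          · rintro ⟨ha, hb⟩ j t ht
            by_cases hj : j = i
            · subst hj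
              obtain rfl : s = t := by
                rw [hg] at ht
                exact Option.some.inj ht
              exact ha
            · simpa only [hC j hj, hy j hj] using hb j hj t ht
        rw [if_pos ⟨hi, by simp⟩]
        simp only [true_and]
        simp only [hP x (insert i A) (fun _ _ => rfl) (fun j hj => by simp [hj]),
          hP x A (fun _ _ => rfl) (fun _ _ => Iff.rfl),
          hP (Function.update x i (x i + 1)) A
            (fun j hj => Function.update_of_ne hj _ _) (fun _ _ => Iff.rfl),
          Finset.mem_insert_self, if_true, if_neg hi, Function.update_self]
        by_cases hQ : ∀ j, j ≠ i → ∀ s ∈ g j, if j ∈ A then x j = s else x j ≤ s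
        · simp only [eq_true hQ, and_true]
          rcases lt_trichotomy (x i) s with h | h | h
          · simp [h.le, h.ne, Int.add_one_le_iff.2 h]
          · simp [h]
          · simp [h.not_ge, h.ne', (h.trans (lt_add_one _)).not_ge]
        · simp only [eq_false hQ, and_false, if_false, sub_self, mul_zero, neg_zero]
    · intro j hj hne
      have : A ≠ (insert i A).erase j := by
        intro h
        have := h ▸ hj
        rcases Finset.mem_insert.1 hj with rfl | hj'
        · exact hne rfl
        · rw [h] at hj'
          simp at hj'
      simp [this]
    · simp
    · intro j _ hne
      split_ifs with h h'
      · exact absurd (hu j h.1 h'.1) hne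
      · simp
      · rfl
    · simp
  · push Not at hA
    rw [Finset.sum_eq_zero, Finset.sum_eq_zero, neg_zero]
    · intro i hi
      have : A ≠ I.erase i := by
        rintro rfl
        exact hA i (by simp) (Finset.insert_erase hi)
      simp [this]
    · intro i hi
      simp only [Finset.mem_filter, Finset.mem_univ, true_and] at hi
      simp [hA i hi.1]

end Cube

section Simplex

variable (k : Type u) [CommRing k]

/-- The `p`-forms on the `n`-simplex, `x_0 + ⋯ + x_n = +∞`: the equalizer of
`∏ i, D(x_0, …, x̂_i, …, x_n) ⇉ ∏ i < j, D(x_0, …, x̂_i, …, x̂_j, …, x_n)`. The condition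
`top i (f i) = f i` says that `f i` does not involve the variable `x_i`. -/
def simplexForms (S : Set ℤ) (p n : ℕ) : Submodule k (Fin (n + 1) → Cube k n) where
  carrier := {f | (∀ i, f i ∈ Cube.forms k S p n) ∧ (∀ i, Cube.top k i (f i) = f i) ∧
    ∀ i j, Cube.top k j (f i) = Cube.top k i (f j)}
  zero_mem' := by simp
  add_mem' := by
    rintro f g ⟨h1, h2, h3⟩ ⟨h1', h2', h3'⟩
    refine ⟨fun i => Submodule.add_mem _ (h1 i) (h1' i), fun i => ?_, fun i j => ?_⟩
    · rw [Pi.add_apply, map_add, h2, h2']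
    · rw [Pi.add_apply, Pi.add_apply, map_add, map_add, h3, h3']
  smul_mem' := by
    rintro a f ⟨h1, h2, h3⟩
    refine ⟨fun i => Submodule.smul_mem _ _ (h1 i), fun i => ?_, fun i j => ?_⟩
    · rw [Pi.smul_apply, map_smul, h2]
    · rw [Pi.smul_apply, Pi.smul_apply, map_smul, map_smul, h3]

variable {k} in
theorem simplexForms_ext {S : Set ℤ} {p n : ℕ} {f g : simplexForms k S p n}
    (h : ∀ i, f.1 i = g.1 i) : f = g := Subtype.ext (funext h)

/-- The differential, componentwise. -/
noncomputable def simplexD (S : Set ℤ) (p n : ℕ) :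
    simplexForms k S p n →ₗ[k] simplexForms k S (p + 1) n :=
  LinearMap.restrict (LinearMap.pi fun i => Cube.d k n ∘ₗ LinearMap.proj i) (by
    rintro f ⟨h1, h2, h3⟩
    refine ⟨fun i => Cube.d_mem (h1 i), fun i => ?_, fun i j => ?_⟩
    · simp only [LinearMap.pi_apply, LinearMap.comp_apply, LinearMap.proj_apply]
      rw [Cube.top_d, h2]
    · simp only [LinearMap.pi_apply, LinearMap.comp_apply, LinearMap.proj_apply]
      rw [Cube.top_d, Cube.top_d, h3])

variable {k} in
theorem simplexD_apply {S : Set ℤ} {p n : ℕ} (f : simplexForms k S p n) (i : Fin (n + 1)) :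
    (simplexD k S p n f).1 i = Cube.d k n (f.1 i) := rfl

/-- The simplicial operator of `u`, componentwise; on the component `y_j = +∞` one has `x_(u j) = +∞`. -/
noncomputable def simplexPull (S : Set ℤ) (p : ℕ) {m n : ℕ} (u : Fin (m + 1) →o Fin (n + 1)) :
    simplexForms k S p n →ₗ[k] simplexForms k S p m :=
  LinearMap.restrict
    (LinearMap.pi fun j => Cube.top k j ∘ₗ Cube.pull k u ∘ₗ LinearMap.proj (u j)) (by
    rintro f ⟨h1, h2, h3⟩
    refine ⟨fun i => Cube.top_mem _ (Cube.pull_mem _ (h1 _)), fun i => ?_, fun i j => ?_⟩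
    · simp only [LinearMap.pi_apply, LinearMap.comp_apply, LinearMap.proj_apply]
      rw [Cube.top_top]
    · simp only [LinearMap.pi_apply, LinearMap.comp_apply, LinearMap.proj_apply]
      calc Cube.top k j (Cube.top k i (Cube.pull k u (f (u i))))
          = Cube.top k i (Cube.top k j (Cube.pull k u (Cube.top k (u j) (f (u i))))) := by
            rw [Cube.top_pull_top, Cube.top_comm]
        _ = Cube.top k j (Cube.top k i (Cube.pull k u (Cube.top k (u i) (f (u j))))) := by
            rw [h3, Cube.top_comm]
        _ = Cube.top k i (Cube.top k j (Cube.pull k u (f (u j)))) := by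
            rw [Cube.top_pull_top, Cube.top_comm])

variable {k} in
theorem simplexPull_apply {S : Set ℤ} {p m n : ℕ} (u : Fin (m + 1) →o Fin (n + 1))
    (f : simplexForms k S p n) (j : Fin (m + 1)) :
    (simplexPull k S p u f).1 j = Cube.top k j (Cube.pull k u (f.1 (u j))) := rfl

/-- The simplicial module of `p`-forms with support in `S`. -/
noncomputable def simplicialForms (S : Set ℤ) (p : ℕ) : SimplicialObject (ModuleCat.{u} k) where
  obj Δ := ModuleCat.of k (simplexForms k S p Δ.unop.len)
  map u := ModuleCat.ofHom (simplexPull k S p u.unop.toOrderHom)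
  map_id Δ := by
    refine ModuleCat.hom_ext (LinearMap.ext fun f => ?_)
    refine simplexForms_ext fun i => ?_
    simp only [ModuleCat.hom_ofHom, ModuleCat.hom_id, LinearMap.id_apply]
    rw [simplexPull_apply]
    exact (congrArg _ (Cube.pull_id _)).trans (f.2.2.1 i)
  map_comp u v := by
    refine ModuleCat.hom_ext (LinearMap.ext fun f => ?_)
    refine simplexForms_ext fun i => ?_
    simp only [ModuleCat.hom_ofHom, ModuleCat.hom_comp, LinearMap.comp_apply]
    rw [simplexPull_apply, simplexPull_apply, simplexPull_apply, Cube.top_pull_top, Cube.pull_pull]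
    rfl

/-- The differential of forms, a morphism of simplicial modules. -/
noncomputable def formsD (S : Set ℤ) (p : ℕ) :
    simplicialForms k S p ⟶ simplicialForms k S (p + 1) where
  app Δ := ModuleCat.ofHom (simplexD k S p Δ.unop.len)
  naturality Δ Δ' u := by
    refine ModuleCat.hom_ext (LinearMap.ext fun f => ?_)
    refine simplexForms_ext fun i => ?_
    change Cube.d k _ (Cube.top k i (Cube.pull k _ (f.1 _))) =
      Cube.top k i (Cube.pull k _ (Cube.d k _ (f.1 _)))
    rw [Cube.pull_d, Cube.top_d]

theorem formsD_comp (S : Set ℤ) (p : ℕ) : formsD k S p ≫ formsD k S (p + 1) = 0 := by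
  refine NatTrans.ext (funext fun Δ => ModuleCat.hom_ext (LinearMap.ext fun f => ?_))
  exact simplexForms_ext fun i => Cube.d_d _

variable {k} in
theorem simplexForms_mono {S T : Set ℤ} (h : S ⊆ T) (p n : ℕ) :
    simplexForms k S p n ≤ simplexForms k T p n :=
  fun _ hf => ⟨fun i => Cube.forms_mono h p n (hf.1 i), hf.2⟩

/-- The inclusion of the forms with support in `S` into those with support in `T`. -/
noncomputable def formsIncl {S T : Set ℤ} (h : S ⊆ T) (p : ℕ) :
    simplicialForms k S p ⟶ simplicialForms k T p where
  app Δ := ModuleCat.ofHom (Submodule.inclusion (simplexForms_mono h p Δ.unop.len))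
  naturality _ _ _ := rfl

theorem formsIncl_comm {S T : Set ℤ} (h : S ⊆ T) (p : ℕ) :
    formsIncl k h p ≫ formsD k T p = formsD k S p ≫ formsIncl k h (p + 1) := rfl

end Simplex

section Coproduct

variable {k : Type u} [CommRing k]

/-- The submodule of degenerate elements. -/
def degenerate (A : SimplicialObject (ModuleCat.{u} k)) :
    (n : ℕ) → Submodule k (A.obj (op (SimplexCategory.mk n)))
  | 0 => ⊥
  | _ + 1 => ⨆ j, LinearMap.range (A.σ j).hom

/-- The normalized submodule: elements all of whose faces vanish, except perhaps the face of index 0. -/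
def normChains (A : SimplicialObject (ModuleCat.{u} k)) :
    (n : ℕ) → Submodule k (A.obj (op (SimplexCategory.mk n)))
  | 0 => ⊤
  | n + 1 => ⨅ i : Fin (n + 1), LinearMap.ker (A.δ i.succ).hom

/-- The boundary of the normalized chain complex, the face of index 0. -/
noncomputable def normBoundary (A : SimplicialObject (ModuleCat.{u} k)) (n : ℕ) :
    normChains A (n + 1) →ₗ[k] normChains A n :=
  LinearMap.restrict (A.δ 0).hom (by
    intro x hx
    rcases n with _ | n
    · exact Submodule.mem_top
    · simp only [normChains, Submodule.mem_iInf, LinearMap.mem_ker] at hx ⊢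
      intro i
      have h := A.δ_comp_δ (Fin.zero_le i.succ)
      have h' := LinearMap.congr_fun (congrArg ModuleCat.Hom.hom h) x
      simp only [ModuleCat.hom_comp, LinearMap.comp_apply] at h'
      rw [hx, map_zero] at h'
      exact h'.symm)

/-- The canonical complement of the normalized cochains in a cosimplicial module: the sum of the
images of the coface maps of positive index. -/
def cofaceImage (M : CosimplicialObject (ModuleCat.{u} k)) :
    (n : ℕ) → Submodule k (M.obj (SimplexCategory.mk n))
  | 0 => ⊥
  | n + 1 => ⨆ i : Fin (n + 1), LinearMap.range (M.δ i.succ).hom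

/-- The normalized cochains: the elements killed by all codegeneracies. -/
def normCochains (M : CosimplicialObject (ModuleCat.{u} k)) :
    (n : ℕ) → Submodule k (M.obj (SimplexCategory.mk n))
  | 0 => ⊤
  | n + 1 => ⨅ j : Fin (n + 1), LinearMap.ker (M.σ j).hom

/-- The alternating sum of the coface maps. -/
noncomputable def coboundary (M : CosimplicialObject (ModuleCat.{u} k)) (n : ℕ) :
    M.obj (SimplexCategory.mk n) →ₗ[k] M.obj (SimplexCategory.mk (n + 1)) :=
  (AlgebraicTopology.AlternatingCofaceMapComplex.objD M n).hom

theorem coboundary_apply (M : CosimplicialObject (ModuleCat.{u} k)) (n : ℕ)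
    (x : M.obj (SimplexCategory.mk n)) :
    coboundary M n x = ∑ i : Fin (n + 2), (-1 : ℤ) ^ (i : ℕ) • (M.δ i).hom x := by
  simp [coboundary]

theorem coboundary_coboundary (M : CosimplicialObject (ModuleCat.{u} k)) (n : ℕ)
    (x : M.obj (SimplexCategory.mk n)) : coboundary M (n + 1) (coboundary M n x) = 0 :=
  LinearMap.congr_fun (congrArg ModuleCat.Hom.hom
    (AlgebraicTopology.AlternatingCofaceMapComplex.d_squared M n)) x

theorem coboundary_mem (M : CosimplicialObject (ModuleCat.{u} k)) (n : ℕ) :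
    ∀ x ∈ normCochains M n, coboundary M n x ∈ normCochains M (n + 1) := by
  intro x hx
  simp only [normCochains, Submodule.mem_iInf, LinearMap.mem_ker]
  intro j
  have hap : ∀ {a b c : ModuleCat.{u} k} {f : a ⟶ b} {g : b ⟶ c} {h : a ⟶ c}, f ≫ g = h →
      ∀ y : a, g.hom (f.hom y) = h.hom y := by
    rintro a b c f g _ rfl y
    rfl
  rw [coboundary_apply, map_sum, Fintype.sum_eq_add j.castSucc j.succ]
  · rw [map_zsmul, map_zsmul, hap M.δ_comp_σ_self, hap M.δ_comp_σ_succ]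
    simp [pow_succ]
  · simp [Fin.ext_iff]
  · rintro i ⟨h1, h2⟩
    rcases n with _ | n
    · exfalso
      revert h1 h2
      fin_cases j
      fin_cases i <;> simp
    · simp only [normCochains, Submodule.mem_iInf, LinearMap.mem_ker] at hx
      rw [map_zsmul]
      rcases lt_or_gt_of_ne h1 with h | h
      · have hj : j ≠ 0 := by
          rintro rfl
          simp at h
        obtain ⟨j, rfl⟩ := Fin.exists_succ_eq.2 hj
        have hi : i ≠ Fin.last _ := (h.trans_le (Fin.le_last _)).ne
        obtain ⟨i, rfl⟩ := Fin.exists_castSucc_eq.2 hi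
        have hle : i ≤ j.castSucc := by
          simp only [Fin.lt_def, Fin.le_def, Fin.val_castSucc, Fin.val_succ] at h ⊢
          omega
        rw [hap (M.δ_comp_σ_of_le hle), ModuleCat.hom_comp, LinearMap.comp_apply, hx, map_zero,
          smul_zero]
      · have h' : j.succ < i := by
          simp only [Fin.lt_def, Fin.val_castSucc, Fin.val_succ, ne_eq, Fin.ext_iff] at h h2 ⊢
          omega
        have hi : i ≠ 0 := by
          rintro rfl
          simp at h'
        obtain ⟨i, rfl⟩ := Fin.exists_succ_eq.2 hi
        have hj : j ≠ Fin.last _ := by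
          rintro rfl
          simp only [Fin.lt_def, Fin.val_succ, Fin.val_last] at h'
          omega
        obtain ⟨j, rfl⟩ := Fin.exists_castSucc_eq.2 hj
        have hlt : j.castSucc < i := by
          simp only [Fin.lt_def, Fin.val_castSucc, Fin.val_succ] at h' ⊢
          omega
        rw [hap (M.δ_comp_σ_of_gt hlt), ModuleCat.hom_comp, LinearMap.comp_apply, hx, map_zero,
          smul_zero]

/-- The differential of the normalized cochain complex. -/
noncomputable def normD (M : CosimplicialObject (ModuleCat.{u} k)) (n : ℕ) :
    normCochains M n →ₗ[k] normCochains M (n + 1) :=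
  LinearMap.restrict (coboundary M n) (coboundary_mem M n)

theorem normD_normD (M : CosimplicialObject (ModuleCat.{u} k)) (n : ℕ) (x : normCochains M n) :
    normD M (n + 1) (normD M n x) = 0 :=
  Subtype.ext (coboundary_coboundary M n x)

/-- The normalized cochain complex of a cosimplicial module. -/
noncomputable def normCochainComplex (M : CosimplicialObject (ModuleCat.{u} k)) :
    CochainComplex (ModuleCat.{u} k) ℕ :=
  CochainComplex.of (fun n => ModuleCat.of k (normCochains M n))
    (fun n => ModuleCat.ofHom (normD M n))
    (fun n => ModuleCat.hom_ext (LinearMap.ext (normD_normD M n)))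

theorem alternatingCoface_d (M : CosimplicialObject (ModuleCat.{u} k)) (n : ℕ) :
    ((AlgebraicTopology.alternatingCofaceMapComplex (ModuleCat.{u} k)).obj M).d n (n + 1) =
      ModuleCat.ofHom (coboundary M n) := by
  change CochainComplex.of.d (fun n => M.obj (SimplexCategory.mk n))
    (AlgebraicTopology.AlternatingCofaceMapComplex.objD M) n (n + 1) = _
  rw [CochainComplex.of_d]
  rfl

/-- Its inclusion into the complex of all cochains. -/
noncomputable def normInclusion (M : CosimplicialObject (ModuleCat.{u} k)) :
    normCochainComplex M ⟶
      (AlgebraicTopology.alternatingCofaceMapComplex (ModuleCat.{u} k)).obj M :=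
  CochainComplex.ofHom (fun n => ModuleCat.ofHom (normCochains M n).subtype) (fun n => by
    rw [alternatingCoface_d]
    simp only [normCochainComplex, CochainComplex.of_d]
    rfl)

/-! ### The tensor coproduct -/

variable (M M' : CosimplicialObject (ModuleCat.{u} k)) (A A' : SimplicialObject (ModuleCat.{u} k))

/-- The projection of `M^n ⊗ A_n` onto the tensor product of the normalizations, the latter being
written as quotients by their canonical complements. -/
noncomputable def toNormQuotient (n : ℕ) :
    M.obj (SimplexCategory.mk n) ⊗[k] A.obj (op (SimplexCategory.mk n)) →ₗ[k]
      (M.obj (SimplexCategory.mk n) ⧸ cofaceImage M n) ⊗[k]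
        (A.obj (op (SimplexCategory.mk n)) ⧸ degenerate A n) :=
  TensorProduct.map (Submodule.mkQ _) (Submodule.mkQ _)

/-- The tensor coproduct of a cosimplicial and a simplicial module: the sequences in
`∏ n, M^n ⊗ A_n` whose images in the tensor products of the normalizations are zero for almost all
`n`, and which are compatible with all nondecreasing maps. -/
def tensorCoproduct :
    Submodule k ((n : ℕ) → M.obj (SimplexCategory.mk n) ⊗[k] A.obj (op (SimplexCategory.mk n))) where
  carrier := {w | (∀ (m n : ℕ) (u : SimplexCategory.mk m ⟶ SimplexCategory.mk n),
      LinearMap.rTensor _ (M.map u).hom (w m) = LinearMap.lTensor _ (A.map u.op).hom (w n)) ∧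
    ∃ N, ∀ n ≥ N, toNormQuotient M A n (w n) = 0}
  zero_mem' := by simp
  add_mem' := by
    rintro w w' ⟨h1, N, h2⟩ ⟨h1', N', h2'⟩
    refine ⟨fun m n u => ?_, max N N', fun n hn => ?_⟩
    · rw [Pi.add_apply, Pi.add_apply, map_add, map_add, h1, h1']
    · rw [Pi.add_apply, map_add, h2 n ((le_max_left _ _).trans hn),
        h2' n ((le_max_right _ _).trans hn), add_zero]
  smul_mem' := by
    rintro a w ⟨h1, N, h2⟩
    refine ⟨fun m n u => ?_, N, fun n hn => ?_⟩
    · rw [Pi.smul_apply, Pi.smul_apply, map_smul, map_smul, h1]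
    · rw [Pi.smul_apply, map_smul, h2 n hn, smul_zero]

variable {M M' A A'}

theorem map_cofaceImage (f : M ⟶ M') (n : ℕ) :
    cofaceImage M n ≤ (cofaceImage M' n).comap (f.app (SimplexCategory.mk n)).hom := by
  rcases n with _ | n
  · exact bot_le
  · refine iSup_le fun i => ?_
    rintro _ ⟨x, rfl⟩
    refine Submodule.mem_iSup_of_mem i ⟨(f.app _).hom x, ?_⟩
    exact (LinearMap.congr_fun (congrArg ModuleCat.Hom.hom
      (f.naturality (SimplexCategory.δ i.succ))) x).symm

theorem map_degenerate (g : A ⟶ A') (n : ℕ) :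
    degenerate A n ≤ (degenerate A' n).comap (g.app (op (SimplexCategory.mk n))).hom := by
  rcases n with _ | n
  · exact bot_le
  · refine iSup_le fun i => ?_
    rintro _ ⟨x, rfl⟩
    refine Submodule.mem_iSup_of_mem i ⟨(g.app _).hom x, ?_⟩
    exact (LinearMap.congr_fun (congrArg ModuleCat.Hom.hom
      (g.naturality (SimplexCategory.σ i).op)) x).symm

/-- Functoriality of the tensor coproduct. -/
noncomputable def tensorCoproductMap (f : M ⟶ M') (g : A ⟶ A') :
    tensorCoproduct M A →ₗ[k] tensorCoproduct M' A' :=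
  LinearMap.restrict (LinearMap.pi fun n =>
    TensorProduct.map (f.app (SimplexCategory.mk n)).hom (g.app (op (SimplexCategory.mk n))).hom ∘ₗ
      LinearMap.proj n) (by
    rintro w ⟨h1, N, h2⟩
    refine ⟨fun m n u => ?_, N, fun n hn => ?_⟩
    · have e1 : LinearMap.rTensor _ (M'.map u).hom ∘ₗ
          TensorProduct.map (f.app (SimplexCategory.mk m)).hom
            (g.app (op (SimplexCategory.mk m))).hom =
          TensorProduct.map (f.app (SimplexCategory.mk n)).hom
            (g.app (op (SimplexCategory.mk m))).hom ∘ₗ LinearMap.rTensor _ (M.map u).hom := by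
        rw [LinearMap.rTensor_comp_map, LinearMap.map_comp_rTensor, ← ModuleCat.hom_comp,
          ← ModuleCat.hom_comp, f.naturality]
      have e2 : LinearMap.lTensor _ (A'.map u.op).hom ∘ₗ
          TensorProduct.map (f.app (SimplexCategory.mk n)).hom
            (g.app (op (SimplexCategory.mk n))).hom =
          TensorProduct.map (f.app (SimplexCategory.mk n)).hom
            (g.app (op (SimplexCategory.mk m))).hom ∘ₗ LinearMap.lTensor _ (A.map u.op).hom := by
        rw [LinearMap.lTensor_comp_map, LinearMap.map_comp_lTensor, ← ModuleCat.hom_comp,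
          ← ModuleCat.hom_comp, g.naturality]
      exact (LinearMap.congr_fun e1 (w m)).trans
        ((congrArg _ (h1 m n u)).trans (LinearMap.congr_fun e2 (w n)).symm)
    · have e : toNormQuotient M' A' n ∘ₗ TensorProduct.map (f.app (SimplexCategory.mk n)).hom
            (g.app (op (SimplexCategory.mk n))).hom =
          TensorProduct.map (Submodule.mapQ _ _ _ (map_cofaceImage f n))
            (Submodule.mapQ _ _ _ (map_degenerate g n)) ∘ₗ toNormQuotient M A n := by
        rw [toNormQuotient, toNormQuotient, ← TensorProduct.map_comp, ← TensorProduct.map_comp]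
        rfl
      have e' := LinearMap.congr_fun e (w n)
      simp only [LinearMap.comp_apply] at e'
      rw [h2 n hn, map_zero] at e'
      exact e')

theorem tensorCoproductMap_apply (f : M ⟶ M') (g : A ⟶ A') (w : tensorCoproduct M A) (n : ℕ) :
    (tensorCoproductMap f g w).1 n = TensorProduct.map (f.app (SimplexCategory.mk n)).hom
      (g.app (op (SimplexCategory.mk n))).hom (w.1 n) := rfl

theorem tensorCoproductMap_id (w : tensorCoproduct M A) :
    tensorCoproductMap (𝟙 M) (𝟙 A) w = w := by
  refine Subtype.ext (funext fun n => ?_)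
  rw [tensorCoproductMap_apply]
  exact LinearMap.congr_fun TensorProduct.map_id (w.1 n)

theorem tensorCoproductMap_comp {M'' : CosimplicialObject (ModuleCat.{u} k)}
    {A'' : SimplicialObject (ModuleCat.{u} k)} (f : M ⟶ M') (g : A ⟶ A') (f' : M' ⟶ M'')
    (g' : A' ⟶ A'') (w : tensorCoproduct M A) :
    tensorCoproductMap f' g' (tensorCoproductMap f g w) =
      tensorCoproductMap (f ≫ f') (g ≫ g') w := by
  refine Subtype.ext (funext fun n => ?_)
  rw [tensorCoproductMap_apply, tensorCoproductMap_apply, tensorCoproductMap_apply]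
  exact (LinearMap.congr_fun (TensorProduct.map_comp _ _ _ _) (w.1 n)).symm

theorem tensorCoproductMap_zero_right (f : M ⟶ M') (w : tensorCoproduct M A) :
    tensorCoproductMap f (0 : A ⟶ A') w = 0 := by
  refine Subtype.ext (funext fun n => ?_)
  rw [tensorCoproductMap_apply]
  exact LinearMap.congr_fun (TensorProduct.map_zero_right _) (w.1 n)

variable (k) in
/-- The complex whose term of degree `p` is the tensor coproduct of `M` with the `p`-forms. -/
noncomputable def tensorComplex (S : Set ℤ) (M : CosimplicialObject (ModuleCat.{u} k)) :
    CochainComplex (ModuleCat.{u} k) ℕ :=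
  CochainComplex.of (fun p => ModuleCat.of k (tensorCoproduct M (simplicialForms k S p)))
    (fun p => ModuleCat.ofHom (tensorCoproductMap (𝟙 M) (formsD k S p)))
    (fun p => ModuleCat.hom_ext (LinearMap.ext fun w => by
      change tensorCoproductMap (𝟙 M) (formsD k S (p + 1))
        (tensorCoproductMap (𝟙 M) (formsD k S p) w) = 0
      rw [tensorCoproductMap_comp, formsD_comp, tensorCoproductMap_zero_right]))

/-- The morphism induced by a morphism of cosimplicial modules and an inclusion of supports. -/
noncomputable def tensorComplexMap {S T : Set ℤ} (h : S ⊆ T)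
    {M M' : CosimplicialObject (ModuleCat.{u} k)} (f : M ⟶ M') :
    tensorComplex k S M ⟶ tensorComplex k T M' :=
  CochainComplex.ofHom (fun p => ModuleCat.ofHom (tensorCoproductMap f (formsIncl k h p)))
    (fun p => by
      simp only [tensorComplex, CochainComplex.of_d]
      refine ModuleCat.hom_ext (LinearMap.ext fun w => ?_)
      change tensorCoproductMap (𝟙 M') (formsD k T p)
        (tensorCoproductMap f (formsIncl k h p) w) =
        tensorCoproductMap f (formsIncl k h (p + 1)) (tensorCoproductMap (𝟙 M) (formsD k S p) w)
      rw [tensorCoproductMap_comp, tensorCoproductMap_comp, Category.comp_id, Category.id_comp,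
        formsIncl_comm])

variable (k) in
/-- The same complex as a functor of `M`. -/
noncomputable def tensorComplexFunctor (S : Set ℤ) :
    CosimplicialObject (ModuleCat.{u} k) ⥤ CochainComplex (ModuleCat.{u} k) ℕ where
  obj M := tensorComplex k S M
  map f := tensorComplexMap (subset_refl S) f
  map_id M := by
    refine HomologicalComplex.hom_ext _ _ fun p => ModuleCat.hom_ext (LinearMap.ext fun w => ?_)
    exact tensorCoproductMap_id w
  map_comp f g := by
    refine HomologicalComplex.hom_ext _ _ fun p => ModuleCat.hom_ext (LinearMap.ext fun w => ?_)
    exact (tensorCoproductMap_comp f (formsIncl k (subset_refl S) p) g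
      (formsIncl k (subset_refl S) p) w).symm

/-! ### The normalized tensor coproduct -/

/-- The tensor coproduct of the normalized complexes: the kernel of `d ⊗ 1 - 1 ⊗ d` in the direct sum
of the tensor products of the normalizations. -/
def normTensorCoproduct (M : CosimplicialObject (ModuleCat.{u} k))
    (A : SimplicialObject (ModuleCat.{u} k)) :
    Submodule k ((n : ℕ) → normCochains M n ⊗[k] normChains A n) where
  carrier := {x | (∀ n, LinearMap.rTensor _ (normD M n) (x n) =
      LinearMap.lTensor _ (normBoundary A n) (x (n + 1))) ∧ ∃ N, ∀ n ≥ N, x n = 0}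
  zero_mem' := by simp
  add_mem' := by
    rintro w w' ⟨h1, N, h2⟩ ⟨h1', N', h2'⟩
    refine ⟨fun n => ?_, max N N', fun n hn => ?_⟩
    · rw [Pi.add_apply, Pi.add_apply, map_add, map_add, h1, h1']
    · rw [Pi.add_apply, h2 n ((le_max_left _ _).trans hn),
        h2' n ((le_max_right _ _).trans hn), add_zero]
  smul_mem' := by
    rintro a w ⟨h1, N, h2⟩
    refine ⟨fun n => ?_, N, fun n hn => ?_⟩
    · rw [Pi.smul_apply, Pi.smul_apply, map_smul, map_smul, h1]
    · rw [Pi.smul_apply, h2 n hn, smul_zero]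

theorem map_normChains {A A' : SimplicialObject (ModuleCat.{u} k)} (g : A ⟶ A') (n : ℕ) :
    ∀ x ∈ normChains A n, (g.app (op (SimplexCategory.mk n))).hom x ∈ normChains A' n := by
  intro x hx
  rcases n with _ | n
  · exact Submodule.mem_top
  · simp only [normChains, Submodule.mem_iInf, LinearMap.mem_ker] at hx ⊢
    intro i
    have e := LinearMap.congr_fun (congrArg ModuleCat.Hom.hom
      (g.naturality (SimplexCategory.δ i.succ).op)) x
    refine Eq.trans e.symm ?_
    change (g.app _).hom ((A.δ i.succ).hom x) = 0
    rw [hx, map_zero]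

/-- Functoriality of the normalized chains. -/
noncomputable def normChainsMap {A A' : SimplicialObject (ModuleCat.{u} k)} (g : A ⟶ A') (n : ℕ) :
    normChains A n →ₗ[k] normChains A' n :=
  LinearMap.restrict (g.app (op (SimplexCategory.mk n))).hom (map_normChains g n)

theorem normBoundary_map {A A' : SimplicialObject (ModuleCat.{u} k)} (g : A ⟶ A') (n : ℕ) :
    normBoundary A' n ∘ₗ normChainsMap g (n + 1) = normChainsMap g n ∘ₗ normBoundary A n := by
  refine LinearMap.ext fun x => Subtype.ext ?_
  exact (LinearMap.congr_fun (congrArg ModuleCat.Hom.hom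
      (g.naturality (SimplexCategory.δ (n := n) 0).op)) x.1).symm

/-- Functoriality of the normalized tensor coproduct in the simplicial module. -/
noncomputable def normTensorCoproductMap (M : CosimplicialObject (ModuleCat.{u} k))
    {A A' : SimplicialObject (ModuleCat.{u} k)} (g : A ⟶ A') :
    normTensorCoproduct M A →ₗ[k] normTensorCoproduct M A' :=
  LinearMap.restrict (LinearMap.pi fun n =>
    LinearMap.lTensor _ (normChainsMap g n) ∘ₗ LinearMap.proj n) (by
    rintro x ⟨h1, N, h2⟩
    refine ⟨fun n => ?_, N, fun n hn => ?_⟩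
    · simp only [LinearMap.pi_apply, LinearMap.comp_apply, LinearMap.proj_apply]
      rw [← LinearMap.lTensor_comp_apply, normBoundary_map, LinearMap.lTensor_comp_apply, ← h1,
        ← LinearMap.comp_apply, ← LinearMap.comp_apply, LinearMap.rTensor_comp_lTensor,
        LinearMap.lTensor_comp_rTensor]
    · simp only [LinearMap.pi_apply, LinearMap.comp_apply, LinearMap.proj_apply]
      rw [h2 n hn, map_zero])

variable (k) in
/-- The complex whose term of degree `p` is the normalized tensor coproduct of `M` with the `p`-forms. -/
noncomputable def normTensorComplex (S : Set ℤ) (M : CosimplicialObject (ModuleCat.{u} k)) :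
    CochainComplex (ModuleCat.{u} k) ℕ :=
  CochainComplex.of (fun p => ModuleCat.of k (normTensorCoproduct M (simplicialForms k S p)))
    (fun p => ModuleCat.ofHom (normTensorCoproductMap M (formsD k S p)))
    (fun p => ModuleCat.hom_ext (LinearMap.ext fun x => Subtype.ext (funext fun n => by
      change LinearMap.lTensor _ (normChainsMap (formsD k S (p + 1)) n)
        (LinearMap.lTensor _ (normChainsMap (formsD k S p) n) (x.1 n)) = 0
      have e : normChainsMap (formsD k S (p + 1)) n ∘ₗ normChainsMap (formsD k S p) n = 0 :=
        LinearMap.ext fun y => Subtype.ext (LinearMap.congr_fun (congrArg ModuleCat.Hom.hom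
          (NatTrans.congr_app (formsD_comp k S p) (op (SimplexCategory.mk n)))) y.1)
      rw [← LinearMap.lTensor_comp_apply, e, LinearMap.lTensor_zero, LinearMap.zero_apply])))

end Coproduct

section Theta

variable (k : Type u) [CommRing k]

/-- The constant function 1 on the point. -/
noncomputable def oneForm (S : Set ℤ) :
    (simplicialForms k S 0).obj (op (SimplexCategory.mk 0)) :=
  (⟨fun _ => Finsupp.single (fun _ => none, ∅) 1, by
    refine ⟨fun i => Finsupp.single_mem_supported k _ ⟨rfl, by simp, by simp⟩, fun i => ?_,
      fun i j => ?_⟩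
    · simp [Cube.top_single]
    · simp [Cube.top_single]⟩ : simplexForms k S 0 0)

variable {k} in
/-- The differential of forms on the `n`-simplex. -/
noncomputable def dForm {S : Set ℤ} {p n : ℕ} :
    (simplicialForms k S p).obj (op (SimplexCategory.mk n)) →ₗ[k]
      (simplicialForms k S (p + 1)).obj (op (SimplexCategory.mk n)) :=
  ((formsD k S p).app (op (SimplexCategory.mk n))).hom

/-- A choice of forms `ω_(p+1)`, written `omega p`, of degree `p` on the `(p+1)`-simplex, that vanish
on all faces but the face of index 0, where `omega p` restricts to `χ_p`; here `χ_0 = 1` and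
`χ_(p+1) = d (omega p)`. -/
structure FundamentalForms (S : Set ℤ) where
  omega : (p : ℕ) → (simplicialForms k S p).obj (op (SimplexCategory.mk (p + 1)))
  face_succ : ∀ (p : ℕ) (i : Fin (p + 1)),
    ((simplicialForms k S p).δ i.succ).hom (omega p) = 0
  face_zero_zero : ((simplicialForms k S 0).δ 0).hom (omega 0) = oneForm k S
  face_zero_succ : ∀ p : ℕ,
    ((simplicialForms k S (p + 1)).δ 0).hom (omega (p + 1)) = dForm (omega p)

namespace FundamentalForms

variable {k} {S : Set ℤ} (F : FundamentalForms k S)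

/-- The form `χ_p` on the `p`-simplex. -/
noncomputable def chi : (p : ℕ) → (simplicialForms k S p).obj (op (SimplexCategory.mk p))
  | 0 => oneForm k S
  | p + 1 => dForm (F.omega p)

theorem face_zero (p : ℕ) : ((simplicialForms k S p).δ 0).hom (F.omega p) = F.chi p := by
  cases p
  · exact F.face_zero_zero
  · exact F.face_zero_succ _

theorem d_chi (p : ℕ) : dForm (F.chi p) = 0 := by
  refine simplexForms_ext fun i => ?_
  rcases p with _ | p
  · change Cube.d k 0 (Finsupp.single (fun _ => none, ∅) 1) = 0
    simp [Cube.d_single]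
  · exact Cube.d_d _

theorem face_d {p n : ℕ} (i : Fin (n + 2))
    (f : (simplicialForms k S p).obj (op (SimplexCategory.mk (n + 1)))) :
    ((simplicialForms k S (p + 1)).δ i).hom (dForm f) =
      dForm (((simplicialForms k S p).δ i).hom f) :=
  (LinearMap.congr_fun (congrArg ModuleCat.Hom.hom
      ((formsD k S p).naturality (SimplexCategory.δ i).op)) f).symm

theorem face_chi (p : ℕ) (i : Fin (p + 2)) :
    ((simplicialForms k S (p + 1)).δ i).hom (F.chi (p + 1)) = 0 := by
  refine (face_d i (F.omega p)).trans ?_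
  refine Fin.cases ?_ (fun i => ?_) i
  · rw [F.face_zero]
    exact F.d_chi p
  · rw [F.face_succ, map_zero]

/-- `omega p` as a normalized chain. -/
noncomputable def omegaNorm (p : ℕ) : normChains (simplicialForms k S p) (p + 1) :=
  ⟨F.omega p, (Submodule.mem_iInf _).2 fun i => LinearMap.mem_ker.2 (F.face_succ p i)⟩

/-- `χ_p` as a normalized chain. -/
noncomputable def chiNorm : (p : ℕ) → normChains (simplicialForms k S p) p
  | 0 => ⟨F.chi 0, Submodule.mem_top⟩
  | p + 1 => ⟨F.chi (p + 1),
      (Submodule.mem_iInf _).2 fun i => LinearMap.mem_ker.2 (F.face_chi p i.succ)⟩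

theorem chiNorm_val (p : ℕ) : (F.chiNorm p).1 = F.chi p := by
  cases p <;> rfl

variable (M : CosimplicialObject (ModuleCat.{u} k))

/-- `θ_p(m) = m ⊗ χ_p + dm ⊗ ω_(p+1)`. -/
noncomputable def thetaFun (p : ℕ) :
    normCochains M p →ₗ[k] (n : ℕ) → normCochains M n ⊗[k] normChains (simplicialForms k S p) n :=
  LinearMap.single k _ p ∘ₗ (TensorProduct.mk k _ _).flip (F.chiNorm p) +
    LinearMap.single k _ (p + 1) ∘ₗ (TensorProduct.mk k _ _).flip (F.omegaNorm p) ∘ₗ normD M p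

theorem thetaFun_apply (p : ℕ) (m : normCochains M p) :
    F.thetaFun M p m = Pi.single p (m ⊗ₜ[k] F.chiNorm p) +
      Pi.single (p + 1) (normD M p m ⊗ₜ[k] F.omegaNorm p) := rfl

theorem thetaFun_mem (p : ℕ) (m : normCochains M p) :
    F.thetaFun M p m ∈ normTensorCoproduct M (simplicialForms k S p) := by
  rw [thetaFun_apply]
  refine ⟨fun n => ?_, p + 2, fun n hn => ?_⟩
  · simp only [Pi.add_apply, map_add]
    by_cases h1 : n = p
    · subst h1
      rw [Pi.single_eq_same, Pi.single_eq_of_ne (by omega), Pi.single_eq_of_ne (by omega),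
        Pi.single_eq_same, map_zero, map_zero, add_zero, zero_add, LinearMap.rTensor_tmul,
        LinearMap.lTensor_tmul]
      congr 1
      exact Subtype.ext ((F.chiNorm_val n).trans (F.face_zero n).symm)
    · rw [Pi.single_eq_of_ne h1, Pi.single_eq_of_ne (by omega : n + 1 ≠ p + 1), map_zero, zero_add,
        map_zero, add_zero]
      by_cases h2 : n = p + 1
      · subst h2
        rw [Pi.single_eq_same, Pi.single_eq_of_ne (by omega), LinearMap.rTensor_tmul,
          normD_normD, TensorProduct.zero_tmul, map_zero]
      · rw [Pi.single_eq_of_ne h2, map_zero]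
        by_cases h3 : p = n + 1
        · subst h3
          rw [Pi.single_eq_same, LinearMap.lTensor_tmul]
          have : normBoundary (simplicialForms k S (n + 1)) n (F.chiNorm (n + 1)) = 0 :=
            Subtype.ext (F.face_chi n 0)
          rw [this, TensorProduct.tmul_zero]
        · rw [Pi.single_eq_of_ne (Ne.symm h3), map_zero]
  · rw [Pi.add_apply, Pi.single_eq_of_ne (by omega), Pi.single_eq_of_ne (by omega), add_zero]

/-- The morphism `θ` from the normalized cochain complex of `M` to the normalized tensor coproduct with
the forms. -/
noncomputable def theta : normCochainComplex M ⟶ normTensorComplex k S M :=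
  CochainComplex.ofHom
    (fun p => ModuleCat.ofHom ((F.thetaFun M p).codRestrict _ (F.thetaFun_mem M p))) (fun p => by
      simp only [normCochainComplex, normTensorComplex, CochainComplex.of_d]
      refine ModuleCat.hom_ext (LinearMap.ext fun m => Subtype.ext (funext fun n => ?_))
      change LinearMap.lTensor _ (normChainsMap (formsD k S p) n) (F.thetaFun M p m n) =
        F.thetaFun M (p + 1) (normD M p m) n
      rw [thetaFun_apply, thetaFun_apply, normD_normD, TensorProduct.zero_tmul, Pi.single_zero,
        add_zero, Pi.add_apply, map_add]
      have e1 : normChainsMap (formsD k S p) p (F.chiNorm p) = 0 :=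
        Subtype.ext ((congrArg dForm (F.chiNorm_val p)).trans (F.d_chi p))
      have e2 : normChainsMap (formsD k S p) (p + 1) (F.omegaNorm p) = F.chiNorm (p + 1) := rfl
      by_cases h1 : n = p
      · subst h1
        rw [Pi.single_eq_same, Pi.single_eq_of_ne (by omega), Pi.single_eq_of_ne (by omega),
          LinearMap.lTensor_tmul, e1, TensorProduct.tmul_zero, map_zero, add_zero]
      · rw [Pi.single_eq_of_ne h1, map_zero, zero_add]
        by_cases h2 : n = p + 1
        · subst h2
          rw [Pi.single_eq_same, Pi.single_eq_same, LinearMap.lTensor_tmul, e2]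
        · rw [Pi.single_eq_of_ne h2, Pi.single_eq_of_ne h2, map_zero])

end FundamentalForms

end Theta

section Spaces

variable (k : Type u) [CommRing k]

/-- The cosimplicial module `X ↦ ([n] ↦ functions on X_n)` of a simplicial set. -/
def cochains : SSet.{u}ᵒᵖ ⥤ CosimplicialObject (ModuleCat.{u} k) where
  obj X :=
    { obj := fun Δ => ModuleCat.of k (X.unop.obj (op Δ) → k)
      map := fun u => ModuleCat.ofHom (LinearMap.funLeft k k (X.unop.map u.op)) 
      map_id := fun Δ => by
        refine ModuleCat.hom_ext (LinearMap.ext fun c => funext fun x => ?_)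
        simp [LinearMap.funLeft_apply]
      map_comp := fun u v => by
        refine ModuleCat.hom_ext (LinearMap.ext fun c => funext fun x => ?_)
        simp [LinearMap.funLeft_apply] }
  map f :=
    { app := fun Δ => ModuleCat.ofHom (LinearMap.funLeft k k (f.unop.app (op Δ)))
      naturality := fun Δ Δ' u => by
        refine ModuleCat.hom_ext (LinearMap.ext fun c => funext fun x => ?_)
        simp [LinearMap.funLeft_apply] }
  map_id X := rfl
  map_comp f g := rfl

variable {k}

/-- The module of simplicial maps from a simplicial set to a simplicial module. -/
def simplicialMaps (X : SSet.{u}) (A : SimplicialObject (ModuleCat.{u} k)) :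
    Submodule k ((n : ℕ) → X.obj (op (SimplexCategory.mk n)) → A.obj (op (SimplexCategory.mk n))) where
  carrier := {φ | ∀ (m n : ℕ) (u : SimplexCategory.mk m ⟶ SimplexCategory.mk n)
    (x : X.obj (op (SimplexCategory.mk n))), φ m (X.map u.op x) = (A.map u.op).hom (φ n x)}
  zero_mem' := by
    intro m n u x
    simp
  add_mem' := by
    intro φ ψ h h' m n u x
    simp only [Pi.add_apply, map_add]
    rw [h, h']
  smul_mem' := by
    intro a φ h m n u x
    simp only [Pi.smul_apply, map_smul]
    rw [h]

/-- Functoriality of the module of simplicial maps. -/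
noncomputable def simplicialMapsMap {X Y : SSet.{u}} (f : X ⟶ Y)
    {A A' : SimplicialObject (ModuleCat.{u} k)} (g : A ⟶ A') :
    simplicialMaps Y A →ₗ[k] simplicialMaps X A' where
  toFun φ := ⟨fun n x => (g.app (op (SimplexCategory.mk n))).hom (φ.1 n (f.app _ x)), by
    intro m n u x
    have e := LinearMap.congr_fun (congrArg ModuleCat.Hom.hom (g.naturality u.op))
      (φ.1 n (f.app _ x))
    refine Eq.trans ?_ e
    change _ = (g.app _).hom ((A.map u.op).hom (φ.1 n (f.app _ x)))
    rw [← φ.2 m n u]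
    have e' : f.app (op (SimplexCategory.mk m)) (X.map u.op x) =
        Y.map u.op (f.app (op (SimplexCategory.mk n)) x) :=
      ConcreteCategory.congr_hom (f.naturality u.op) x
    exact congrArg (fun y => (g.app (op (SimplexCategory.mk m))).hom (φ.1 m y)) e'⟩
  map_add' φ ψ := by
    refine Subtype.ext (funext fun n => funext fun x => ?_)
    exact map_add (g.app (op (SimplexCategory.mk n))).hom _ _
  map_smul' a φ := by
    refine Subtype.ext (funext fun n => funext fun x => ?_)
    exact map_smul (g.app (op (SimplexCategory.mk n))).hom _ _

variable (k) in
/-- The complex of simplicial maps from `X` to the forms. -/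
noncomputable def mapComplex (S : Set ℤ) (X : SSet.{u}) : CochainComplex (ModuleCat.{u} k) ℕ :=
  CochainComplex.of (fun p => ModuleCat.of k (simplicialMaps X (simplicialForms k S p)))
    (fun p => ModuleCat.ofHom (simplicialMapsMap (𝟙 X) (formsD k S p)))
    (fun p => ModuleCat.hom_ext (LinearMap.ext fun φ => Subtype.ext (funext fun n =>
      funext fun x => LinearMap.congr_fun (congrArg ModuleCat.Hom.hom
          (NatTrans.congr_app (formsD_comp k S p) (op (SimplexCategory.mk n)))) (φ.1 n x))))

variable (k) in
/-- The same complex as a contravariant functor of `X`. -/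
noncomputable def mapComplexFunctor (S : Set ℤ) :
    SSet.{u}ᵒᵖ ⥤ CochainComplex (ModuleCat.{u} k) ℕ where
  obj X := mapComplex k S X.unop
  map f := CochainComplex.ofHom
    (fun p => ModuleCat.ofHom (simplicialMapsMap f.unop (𝟙 (simplicialForms k S p)))) (fun p => by
      simp only [mapComplex, CochainComplex.of_d]
      rfl)
  map_id X := rfl
  map_comp f g := rfl

/-- `c ⊗ v ↦ c(x) v`. -/
noncomputable def evalTensor (X : SSet.{u}) (n : ℕ) (x : X.obj (op (SimplexCategory.mk n)))
    (V : Type u) [AddCommGroup V] [Module k V] :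
    ((cochains k).obj (op X)).obj (SimplexCategory.mk n) ⊗[k] V →ₗ[k] V :=
  TensorProduct.lift ((LinearMap.lsmul k V) ∘ₗ
    (LinearMap.proj x : (X.obj (op (SimplexCategory.mk n)) → k) →ₗ[k] k))

/-- The canonical map from the tensor coproduct to simplicial maps, `c ⊗ a ↦ (x ↦ c(x) a)`. -/
noncomputable def coproductToMaps (X : SSet.{u}) (A : SimplicialObject (ModuleCat.{u} k)) :
    tensorCoproduct ((cochains k).obj (op X)) A →ₗ[k] simplicialMaps X A where
  toFun w := ⟨fun n x => evalTensor X n x (A.obj (op (SimplexCategory.mk n))) (w.1 n), by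
    intro m n u x
    have e1 : evalTensor X m (X.map u.op x) (A.obj (op (SimplexCategory.mk m))) =
        evalTensor X n x (A.obj (op (SimplexCategory.mk m))) ∘ₗ
          LinearMap.rTensor _ (((cochains k).obj (op X)).map u).hom :=
      TensorProduct.ext' fun c a => rfl
    have e2 : evalTensor X n x (A.obj (op (SimplexCategory.mk m))) ∘ₗ
          LinearMap.lTensor _ (A.map u.op).hom =
        (A.map u.op).hom ∘ₗ evalTensor X n x (A.obj (op (SimplexCategory.mk n))) :=
      TensorProduct.ext' fun c a => ((A.map u.op).hom.map_smul _ a).symm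
    exact (LinearMap.congr_fun e1 (w.1 m)).trans
      ((congrArg _ (w.2.1 m n u)).trans (LinearMap.congr_fun e2 (w.1 n)))⟩
  map_add' w w' := by
    refine Subtype.ext (funext fun n => funext fun x => ?_)
    exact map_add (evalTensor X n x _) _ _
  map_smul' a w := by
    refine Subtype.ext (funext fun n => funext fun x => ?_)
    exact map_smul (evalTensor X n x _) _ _

theorem coproductToMaps_natural {X Y : SSet.{u}} (f : X ⟶ Y)
    {A A' : SimplicialObject (ModuleCat.{u} k)} (g : A ⟶ A')
    (w : tensorCoproduct ((cochains k).obj (op Y)) A) :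
    coproductToMaps X A' (tensorCoproductMap ((cochains k).map f.op) g w) =
      simplicialMapsMap f g (coproductToMaps Y A w) := by
  refine Subtype.ext (funext fun n => funext fun x => ?_)
  have e : evalTensor X n x (A'.obj (op (SimplexCategory.mk n))) ∘ₗ
      TensorProduct.map (((cochains k).map f.op).app (SimplexCategory.mk n)).hom
        (g.app (op (SimplexCategory.mk n))).hom =
      (g.app (op (SimplexCategory.mk n))).hom ∘ₗ
        evalTensor Y n (f.app _ x) (A.obj (op (SimplexCategory.mk n))) :=
    TensorProduct.ext' fun c a => ((g.app (op (SimplexCategory.mk n))).hom.map_smul _ a).symm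
  exact LinearMap.congr_fun e (w.1 n)

variable (k) in
/-- The canonical natural morphism from the tensor coproduct to the complex of simplicial maps. -/
noncomputable def coproductComparison (S : Set ℤ) :
    cochains k ⋙ tensorComplexFunctor k S ⟶ mapComplexFunctor k S where
  app X := CochainComplex.ofHom
    (fun p => ModuleCat.ofHom (coproductToMaps X.unop (simplicialForms k S p))) (fun p => by
      change _ ≫ (mapComplex k S X.unop).d p (p + 1) =
        (tensorComplex k S ((cochains k).obj X)).d p (p + 1) ≫ _
      simp only [mapComplex, tensorComplex, CochainComplex.of_d]
      refine ModuleCat.hom_ext (LinearMap.ext fun w => ?_)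
      exact (coproductToMaps_natural (𝟙 X.unop) (formsD k S p) w).symm)
  naturality X Y f := by
    refine HomologicalComplex.hom_ext _ _ fun p => ModuleCat.hom_ext (LinearMap.ext fun w => ?_)
    exact coproductToMaps_natural f.unop (𝟙 _) w

variable {S : Set ℤ} {p : ℕ}

/-- The component in `M^n ⊗ D^p(Δ_n)` of an element of the tensor coproduct. -/
def tensorCoeff {M : CosimplicialObject (ModuleCat.{u} k)} (w : (tensorComplex k S M).X p) (n : ℕ) :
    M.obj (SimplexCategory.mk n) ⊗[k] (simplicialForms k S p).obj (op (SimplexCategory.mk n)) :=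
  Subtype.val (p := (· ∈ tensorCoproduct M (simplicialForms k S p))) w n

/-- The component in `M^n ⊗ D^p(Δ_n)` of an element of the normalized tensor coproduct. -/
noncomputable def normTensorCoeff {M : CosimplicialObject (ModuleCat.{u} k)}
    (w : (normTensorComplex k S M).X p) (n : ℕ) :
    M.obj (SimplexCategory.mk n) ⊗[k] (simplicialForms k S p).obj (op (SimplexCategory.mk n)) :=
  TensorProduct.map (normCochains M n).subtype (normChains (simplicialForms k S p) n).subtype
    (Subtype.val (p := (· ∈ normTensorCoproduct M (simplicialForms k S p))) w n)

/-- The value at `x` of a simplicial map to the forms. -/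
def mapValue {X : SSet.{u}} (φ : (mapComplex k S X).X p) (n : ℕ)
    (x : X.obj (op (SimplexCategory.mk n))) :
    (simplicialForms k S p).obj (op (SimplexCategory.mk n)) :=
  Subtype.val (p := (· ∈ simplicialMaps X (simplicialForms k S p))) φ n x

/-- The sequence with entries `m ⊗ χ_p` in degree `p`, `dm ⊗ ω_(p+1)` in degree `p + 1`, and zero
elsewhere. -/
noncomputable def FundamentalForms.leadingTensor (F : FundamentalForms k S)
    (M : CosimplicialObject (ModuleCat.{u} k)) (p : ℕ) (m : M.obj (SimplexCategory.mk p)) :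
    (n : ℕ) → M.obj (SimplexCategory.mk n) ⊗[k]
      (simplicialForms k S p).obj (op (SimplexCategory.mk n)) :=
  Pi.single p (m ⊗ₜ[k] F.chi p) + Pi.single (p + 1) (coboundary M p m ⊗ₜ[k] F.omega p)

/-- The family `x ↦ c(x) χ_p` in degree `p`, `x ↦ (dc)(x) ω_(p+1)` in degree `p + 1`, and zero
elsewhere. -/
noncomputable def FundamentalForms.leadingForm (F : FundamentalForms k S) (X : SSet.{u}) (p : ℕ)
    (c : X.obj (op (SimplexCategory.mk p)) → k) :
    (n : ℕ) → X.obj (op (SimplexCategory.mk n)) →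
      (simplicialForms k S p).obj (op (SimplexCategory.mk n)) :=
  Pi.single p (fun x => c x • F.chi p) +
    Pi.single (p + 1) (fun x =>
      (coboundary ((cochains k).obj (op X)) p c : X.obj (op (SimplexCategory.mk (p + 1))) → k) x •
        F.omega p)

end Spaces

end QuasiComm

open QuasiComm

namespace QuasiComm

/-! ### Projections onto normalized cochains and normalized chains -/

section Projections

variable {k : Type u} [CommRing k]

/-! Two independent arguments carry the proof.

The first is a Dold–Kan principle for families on a diagonal. Let `W` be covariant in `[n]` and
contravariant in `[m]`, and let `w n` in `W n n` be compatible with all nondecreasing maps. On such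
a family the cosimplicial operator `d^(j+1) s^j` acts as the simplicial operator `σ_j ∂_(j+1)`, so
the two normalizing projections agree (`cosProj_eq_simpProj`), and the part of `w (n+1)` that they
kill is an explicit function of `w n`. Hence compatible families correspond to families `y`
normalized in both variables whose coboundary is `∂_0` of the next term
(`eq_zero_of_cosProj_eq_zero`, `liftFamily_compatible`). For `M^n ⊗ A_m` this gives the isomorphism
`ν`. For `A_m^(X_n)`, whose compatible families are the simplicial maps, it describes these maps in
the same way, but without a finiteness condition.

The second concerns the bigraded module of normalized forms of degree `p` on the `n`-simplex. It is
zero for `n < p`. For fixed `n > 0` the differential `d` has a contraction `h`. For fixed `p` the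
boundary `∂_0` has a contraction `s`, which comes from multiplication by `Y_t` in a new variable.
For `n = 0` only `k` in degree 0 remains. Iterating `h` and `∂_0` defines an integral on the
`p`-forms of the `p`-simplex; it satisfies the formula of Stokes `∫ dω = ∫ ∂_0 ω`, and therefore `∫
χ_p = 1`. Integration of the component of index `p` is then a morphism from the complex of families
to the coefficients, and it is left inverse to `θ`. A cocycle `x` differs from `m ⊗ χ_p`, with `m =
∫ x_p`, by a cocycle of integral zero, which is a coboundary by a staircase argument with `h` and
`s` (`exists_primitive`).

Contractions survive every additive functor. The argument is therefore made once, for coefficients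
in a sequence of additive functors (`quasiIso_of_leading`), and applied to `V ↦ N^n ⊗ V` and to
normalized cochains with values in `V`; no flatness of `M` and no finiteness of `X` is needed.
Finally `Θ` is the projection onto normalized cochains, followed by `θ` and `ν⁻¹`. The
two-out-of-three property gives the comparison with simplicial maps and the independence of `S`,
since fundamental forms for `S` are also fundamental forms for any larger `T`. -/

theorem hom_apply_of_comp_eq {a b c : ModuleCat.{u} k} {f : a ⟶ b} {g : b ⟶ c} {h : a ⟶ c}
    (e : f ≫ g = h) (y : a) : g.hom (f.hom y) = h.hom y := by
  subst e
  rfl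

theorem hom_apply_of_comp_eq_comp {a b b' c : ModuleCat.{u} k} {f : a ⟶ b} {g : b ⟶ c}
    {f' : a ⟶ b'} {g' : b' ⟶ c} (e : f ≫ g = f' ≫ g') (y : a) :
    g.hom (f.hom y) = g'.hom (f'.hom y) :=
  hom_apply_of_comp_eq e y

section Cosimplicial

variable (M : CosimplicialObject (ModuleCat.{u} k))

variable {M} in
theorem coface_coface {n a b : ℕ} (hab : a ≤ b) (hb : b < n + 2)
    (x : M.obj (SimplexCategory.mk n)) :
    (M.δ ⟨b + 1, by omega⟩).hom ((M.δ ⟨a, by omega⟩).hom x) =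
      (M.δ (n := n + 1) ⟨a, by omega⟩).hom ((M.δ ⟨b, hb⟩).hom x) :=
  hom_apply_of_comp_eq_comp (M.δ_comp_δ (i := ⟨a, by omega⟩) (j := ⟨b, hb⟩) hab) x

variable {M} in
theorem codegeneracy_coface_of_gt {n a b : ℕ} (hab : b < a) (ha : a < n + 2)
    (x : M.obj (SimplexCategory.mk (n + 1))) :
    (M.σ ⟨b, by omega⟩).hom ((M.δ ⟨a + 1, by omega⟩).hom x) =
      (M.δ (n := n) ⟨a, ha⟩).hom ((M.σ ⟨b, by omega⟩).hom x) :=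
  hom_apply_of_comp_eq_comp
    (M.δ_comp_σ_of_gt (i := ⟨a, ha⟩) (j := ⟨b, by omega⟩) hab) x

variable {M} in
theorem codegeneracy_coface_succ {n a : ℕ} (ha : a < n + 1) (x : M.obj (SimplexCategory.mk n)) :
    (M.σ ⟨a, ha⟩).hom ((M.δ ⟨a + 1, by omega⟩).hom x) = x :=
  hom_apply_of_comp_eq (M.δ_comp_σ_succ (i := ⟨a, ha⟩)) x

variable {M} in
theorem codegeneracy_codegeneracy {n a b : ℕ} (hab : a ≤ b) (hb : b < n + 1)
    (x : M.obj (SimplexCategory.mk (n + 2))) :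
    (M.σ ⟨b, hb⟩).hom ((M.σ ⟨a, by omega⟩).hom x) =
      (M.σ (n := n) ⟨a, by omega⟩).hom ((M.σ ⟨b + 1, by omega⟩).hom x) :=
  hom_apply_of_comp_eq_comp
    (M.σ_comp_σ (i := ⟨a, by omega⟩) (j := ⟨b, hb⟩) hab) x

/-- The product `p_{t-1} ⋯ p_0` of the operators `p_j = 1 - d^{j+1} s^j`. -/
noncomputable def cosPartial (n : ℕ) :
    ℕ → M.obj (SimplexCategory.mk (n + 1)) →ₗ[k] M.obj (SimplexCategory.mk (n + 1))
  | 0 => LinearMap.id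
  | t + 1 => if h : t < n + 1 then
      cosPartial n t - (M.δ ⟨t + 1, by omega⟩).hom ∘ₗ (M.σ ⟨t, h⟩).hom ∘ₗ cosPartial n t
    else cosPartial n t

/-- The projection onto the normalized cochains along the positive cofaces. -/
noncomputable def cosProj :
    (n : ℕ) → M.obj (SimplexCategory.mk n) →ₗ[k] M.obj (SimplexCategory.mk n)
  | 0 => LinearMap.id
  | n + 1 => cosPartial M n (n + 1)

variable {M}

theorem cosPartial_succ {n t : ℕ} (h : t < n + 1) (x : M.obj (SimplexCategory.mk (n + 1))) :
    cosPartial M n (t + 1) x = cosPartial M n t x -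
      (M.δ ⟨t + 1, by omega⟩).hom ((M.σ ⟨t, h⟩).hom (cosPartial M n t x)) := by
  simp [cosPartial, h]

/-- The factor `1 - d^(t+1) s^t` is killed by `s^t`. It preserves what the earlier factors achieved:
for `j < t` the operator `s^j` moves past `d^(t+1)` and past `s^t` and then meets the previous
stage. -/
theorem codegeneracy_cosPartial {n : ℕ} (x : M.obj (SimplexCategory.mk (n + 1))) {t : ℕ}
    (ht : t ≤ n + 1) (j : ℕ) (hj : j < t) :
    (M.σ ⟨j, by omega⟩).hom (cosPartial M n t x) = 0 := by
  induction t generalizing j with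
  | zero => omega
  | succ t ih =>
    rw [cosPartial_succ (by omega), map_sub]
    rcases (Nat.lt_succ_iff.1 hj).lt_or_eq with h | rfl
    · rw [ih (by omega) j h]
      obtain ⟨n, rfl⟩ : ∃ m, n = m + 1 := ⟨n - 1, by omega⟩
      rw [codegeneracy_coface_of_gt h (by omega)]
      obtain ⟨t, rfl⟩ : ∃ m, t = m + 1 := ⟨t - 1, by omega⟩
      rw [← codegeneracy_codegeneracy (Nat.lt_succ_iff.1 h) (by omega), ih (by omega) j h]
      simp
    · rw [codegeneracy_coface_succ, sub_self]

theorem mem_normCochains_succ {n : ℕ} {x : M.obj (SimplexCategory.mk (n + 1))} :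
    x ∈ normCochains M (n + 1) ↔ ∀ (j : ℕ) (hj : j < n + 1), (M.σ ⟨j, hj⟩).hom x = 0 := by
  simp only [normCochains, Submodule.mem_iInf, LinearMap.mem_ker]
  exact ⟨fun h j hj => h ⟨j, hj⟩, fun h j => h j.1 j.2⟩

theorem cosProj_mem (n : ℕ) (x : M.obj (SimplexCategory.mk n)) :
    cosProj M n x ∈ normCochains M n := by
  rcases n with _ | n
  · exact Submodule.mem_top
  · exact mem_normCochains_succ.2 fun j hj => codegeneracy_cosPartial x le_rfl j hj

theorem cosPartial_of_mem {n : ℕ} {x : M.obj (SimplexCategory.mk (n + 1))}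
    (hx : x ∈ normCochains M (n + 1)) {t : ℕ} (ht : t ≤ n + 1) : cosPartial M n t x = x := by
  induction t with
  | zero => rfl
  | succ t ih =>
    rw [cosPartial_succ (by omega), ih (by omega), mem_normCochains_succ.1 hx t (by omega), map_zero,
      sub_zero]

theorem cosProj_of_mem {n : ℕ} {x : M.obj (SimplexCategory.mk n)} (hx : x ∈ normCochains M n) :
    cosProj M n x = x := by
  rcases n with _ | n
  · rfl
  · exact cosPartial_of_mem hx le_rfl

theorem coface_mem_cofaceImage {n i : ℕ} (hi : i < n + 1) (x : M.obj (SimplexCategory.mk n)) :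
    (M.δ ⟨i + 1, by omega⟩).hom x ∈ cofaceImage M (n + 1) :=
  Submodule.mem_iSup_of_mem (⟨i, hi⟩ : Fin (n + 1)) ⟨x, rfl⟩

theorem sub_cosProj_mem (n : ℕ) (x : M.obj (SimplexCategory.mk n)) :
    x - cosProj M n x ∈ cofaceImage M n := by
  rcases n with _ | n
  · simp [cosProj]
  · have h : ∀ t ≤ n + 1, x - cosPartial M n t x ∈ cofaceImage M (n + 1) := by
      intro t ht
      induction t with
      | zero => simp [cosPartial]
      | succ t ih =>
        rw [cosPartial_succ (by omega), sub_sub_eq_add_sub, add_sub_right_comm]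
        exact Submodule.add_mem _ (ih (by omega)) (coface_mem_cofaceImage (by omega) _)
    exact h _ le_rfl

/-- The factors of index `j < t` involve `d^(j+1)` with `j + 1 < i` or `j + 1 = t < i`, which can be
interchanged with `d^i`; the image of `d^i` is thus preserved until the factor that kills it is
reached. -/
theorem cosPartial_coface_of_lt {n i : ℕ} (hi : i < n + 2) (y : M.obj (SimplexCategory.mk n)) {t : ℕ}
    (ht : t < i) : ∃ z, cosPartial M n t ((M.δ ⟨i, hi⟩).hom y) = (M.δ ⟨i, hi⟩).hom z := by
  induction t with
  | zero => exact ⟨y, rfl⟩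
  | succ t ih =>
    obtain ⟨z, hz⟩ := ih (by omega)
    obtain ⟨i, rfl⟩ : ∃ m, i = m + 1 := ⟨i - 1, by omega⟩
    obtain ⟨n, rfl⟩ : ∃ m, n = m + 1 := ⟨n - 1, by omega⟩
    refine ⟨z - (M.δ ⟨t + 1, by omega⟩).hom ((M.σ ⟨t, by omega⟩).hom z), ?_⟩
    rw [cosPartial_succ (by omega), hz, codegeneracy_coface_of_gt (by omega) (by omega), map_sub,
      coface_coface (a := t + 1) (b := i) (by omega) (by omega)]

theorem cosPartial_coface {n i : ℕ} (hi : i < n + 1) (y : M.obj (SimplexCategory.mk n)) {t : ℕ}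
    (ht : i < t) (htn : t ≤ n + 1) :
    cosPartial M n t ((M.δ ⟨i + 1, by omega⟩).hom y) = 0 := by
  induction t with
  | zero => omega
  | succ t ih =>
    rw [cosPartial_succ (by omega)]
    rcases (Nat.lt_succ_iff.1 ht).lt_or_eq with h | rfl
    · rw [ih h (by omega)]
      simp
    -- The earlier factors leave an element `d^(i+1) z`, and `1 - d^(i+1) s^i` vanishes on it
    -- because `s^i d^(i+1) = 1`.
    · obtain ⟨z, hz⟩ := cosPartial_coface_of_lt (by omega : i + 1 < n + 2) y (Nat.lt_succ_self i)
      rw [hz, codegeneracy_coface_succ, sub_self]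

theorem cosProj_coface {n i : ℕ} (hi : i < n + 1) (y : M.obj (SimplexCategory.mk n)) :
    cosProj M (n + 1) ((M.δ ⟨i + 1, by omega⟩).hom y) = 0 :=
  cosPartial_coface hi y hi le_rfl

theorem cosProj_of_mem_cofaceImage {n : ℕ} {x : M.obj (SimplexCategory.mk n)}
    (hx : x ∈ cofaceImage M n) : cosProj M n x = 0 := by
  rcases n with _ | n
  · rw [show x = 0 from hx, map_zero]
  · have h : cofaceImage M (n + 1) ≤ LinearMap.ker (cosProj M (n + 1)) := by
      refine iSup_le fun i => ?_
      rintro _ ⟨y, rfl⟩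
      exact cosProj_coface i.2 y
    exact h hx

/-- All other terms of the alternating sum are positive cofaces, which the projection kills. This is
where compatibility with the coface of index 0 turns into a statement about the coboundary. -/
theorem cosProj_coface_zero (n : ℕ) (x : M.obj (SimplexCategory.mk n)) :
    cosProj M (n + 1) ((M.δ 0).hom x) = cosProj M (n + 1) (coboundary M n x) := by
  rw [coboundary_apply, Fin.sum_univ_succ, map_add, map_sum, Finset.sum_eq_zero]
  · simp
  · intro i _
    rw [map_zsmul]
    exact (congrArg _ (cosProj_coface i.2 x)).trans (smul_zero _)

theorem cosPartial_naturality {M M' : CosimplicialObject (ModuleCat.{u} k)} (f : M ⟶ M') {n t : ℕ}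
    (ht : t ≤ n + 1) (x : M.obj (SimplexCategory.mk (n + 1))) :
    cosPartial M' n t ((f.app _).hom x) = (f.app _).hom (cosPartial M n t x) := by
  induction t with
  | zero => rfl
  | succ t ih =>
    rw [cosPartial_succ (by omega), cosPartial_succ (by omega), ih (by omega), map_sub]
    congr 1
    refine (congrArg (M'.δ _).hom (hom_apply_of_comp_eq_comp
      (f.naturality (SimplexCategory.σ ⟨t, by omega⟩)) (cosPartial M n t x)).symm).trans ?_
    exact (hom_apply_of_comp_eq_comp (f.naturality (SimplexCategory.δ ⟨t + 1, by omega⟩)) _).symm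

theorem cosProj_naturality {M M' : CosimplicialObject (ModuleCat.{u} k)} (f : M ⟶ M') (n : ℕ)
    (x : M.obj (SimplexCategory.mk n)) :
    cosProj M' n ((f.app _).hom x) = (f.app _).hom (cosProj M n x) := by
  rcases n with _ | n
  · rfl
  · exact cosPartial_naturality f le_rfl x

theorem coboundary_naturality {M M' : CosimplicialObject (ModuleCat.{u} k)} (f : M ⟶ M') (n : ℕ)
    (x : M.obj (SimplexCategory.mk n)) :
    coboundary M' n ((f.app _).hom x) = (f.app _).hom (coboundary M n x) := by
  rw [coboundary_apply, coboundary_apply, map_sum]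
  refine Finset.sum_congr rfl fun i _ => ?_
  rw [map_zsmul]
  exact congrArg _ (hom_apply_of_comp_eq_comp (f.naturality (SimplexCategory.δ i)) x).symm

/-- The complement of the normalized cochains contributes nothing: `p d d^(i+1) = p d^0 d^(i+1) = p
d^(i+2) d^0 = 0`, where `p` is the projection. On normalized cochains the coboundary is already
normalized. -/
theorem cosProj_coboundary (n : ℕ) (x : M.obj (SimplexCategory.mk n)) :
    cosProj M (n + 1) (coboundary M n x) = coboundary M n (cosProj M n x) := by
  have h : ∀ y ∈ cofaceImage M n, cosProj M (n + 1) (coboundary M n y) = 0 := by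
    rcases n with _ | n
    · intro y hy
      rw [show y = 0 from hy, map_zero, map_zero]
    · have h' : cofaceImage M (n + 1) ≤
          LinearMap.ker (cosProj M (n + 2) ∘ₗ coboundary M (n + 1)) := by
        refine iSup_le fun i => ?_
        rintro _ ⟨y, rfl⟩
        refine (cosProj_coface_zero _ _).symm.trans ?_
        refine (congrArg (cosProj M (n + 2)) (coface_coface (n := n) (a := 0) (b := i + 1)
          (by omega) (by omega) y).symm).trans ?_
        exact cosProj_coface (by omega) _
      exact fun y hy => h' hy
  have h2 := h _ (sub_cosProj_mem n x)
  rw [map_sub, map_sub, sub_eq_zero] at h2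
  rw [h2]
  exact cosProj_of_mem (coboundary_mem M n _ (cosProj_mem n x))

end Cosimplicial

section Simplicial

variable (A : SimplicialObject (ModuleCat.{u} k))

variable {A} in
theorem face_face {n a b : ℕ} (hab : a ≤ b) (hb : b < n + 2)
    (x : A.obj (op (SimplexCategory.mk (n + 2)))) :
    (A.δ (n := n) ⟨a, by omega⟩).hom ((A.δ ⟨b + 1, by omega⟩).hom x) =
      (A.δ ⟨b, hb⟩).hom ((A.δ ⟨a, by omega⟩).hom x) :=
  hom_apply_of_comp_eq_comp (A.δ_comp_δ (i := ⟨a, by omega⟩) (j := ⟨b, hb⟩) hab) x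

variable {A} in
theorem face_degeneracy_of_gt {n a b : ℕ} (hab : b < a) (ha : a < n + 2)
    (x : A.obj (op (SimplexCategory.mk (n + 1)))) :
    (A.δ (n := n + 1) ⟨a + 1, by omega⟩).hom ((A.σ ⟨b, by omega⟩).hom x) =
      (A.σ ⟨b, by omega⟩).hom ((A.δ ⟨a, ha⟩).hom x) :=
  hom_apply_of_comp_eq_comp
    (A.δ_comp_σ_of_gt (i := ⟨a, ha⟩) (j := ⟨b, by omega⟩) hab) x

variable {A} in
theorem face_degeneracy_self {n a : ℕ} (ha : a < n + 1)
    (x : A.obj (op (SimplexCategory.mk n))) :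
    (A.δ ⟨a, by omega⟩).hom ((A.σ ⟨a, ha⟩).hom x) = x :=
  hom_apply_of_comp_eq (A.δ_comp_σ_self (i := ⟨a, ha⟩)) x

variable {A} in
theorem face_degeneracy_succ {n a : ℕ} (ha : a < n + 1)
    (x : A.obj (op (SimplexCategory.mk n))) :
    (A.δ ⟨a + 1, by omega⟩).hom ((A.σ ⟨a, ha⟩).hom x) = x :=
  hom_apply_of_comp_eq (A.δ_comp_σ_succ (i := ⟨a, ha⟩)) x

variable {A} in
theorem degeneracy_degeneracy {n a b : ℕ} (hab : a ≤ b) (hb : b < n + 1)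
    (x : A.obj (op (SimplexCategory.mk n))) :
    (A.σ ⟨a, by omega⟩).hom ((A.σ ⟨b, hb⟩).hom x) =
      (A.σ (n := n + 1) ⟨b + 1, by omega⟩).hom ((A.σ ⟨a, by omega⟩).hom x) :=
  hom_apply_of_comp_eq_comp
    (A.σ_comp_σ (i := ⟨a, by omega⟩) (j := ⟨b, hb⟩) hab) x

/-- The product `r_0 ⋯ r_{t-1}` of the operators `r_j = 1 - σ_j ∂_{j+1}`. -/
noncomputable def simpPartial (n : ℕ) : ℕ →
    A.obj (op (SimplexCategory.mk (n + 1))) →ₗ[k] A.obj (op (SimplexCategory.mk (n + 1)))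
  | 0 => LinearMap.id
  | t + 1 => if h : t < n + 1 then
      simpPartial n t - simpPartial n t ∘ₗ (A.σ ⟨t, h⟩).hom ∘ₗ (A.δ ⟨t + 1, by omega⟩).hom
    else simpPartial n t

/-- The projection onto the normalized chains along the degenerate elements. -/
noncomputable def simpProj : (n : ℕ) →
    A.obj (op (SimplexCategory.mk n)) →ₗ[k] A.obj (op (SimplexCategory.mk n))
  | 0 => LinearMap.id
  | n + 1 => simpPartial A n (n + 1)

variable {A}

theorem simpPartial_succ {n t : ℕ} (h : t < n + 1) (x : A.obj (op (SimplexCategory.mk (n + 1)))) :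
    simpPartial A n (t + 1) x = simpPartial A n t
      (x - (A.σ ⟨t, h⟩).hom ((A.δ ⟨t + 1, by omega⟩).hom x)) := by
  simp [simpPartial, h]

/-- For `j + 1 < i` one has `∂_i σ_j ∂_(j+1) = σ_j ∂_(j+1) ∂_i`, so the factors of small index
preserve the vanishing of `∂_i`. -/
theorem face_simpPartial_of_lt {n i : ℕ} (hi : i < n + 2) {t : ℕ} (ht : t < i)
    (x : A.obj (op (SimplexCategory.mk (n + 1)))) (hx : (A.δ ⟨i, hi⟩).hom x = 0) :
    (A.δ ⟨i, hi⟩).hom (simpPartial A n t x) = 0 := by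
  induction t generalizing x with
  | zero => exact hx
  | succ t ih =>
    rw [simpPartial_succ (by omega)]
    refine ih (by omega) _ ?_
    obtain ⟨i, rfl⟩ : ∃ m, i = m + 1 := ⟨i - 1, by omega⟩
    obtain ⟨n, rfl⟩ : ∃ m, n = m + 1 := ⟨n - 1, by omega⟩
    rw [map_sub, hx, face_degeneracy_of_gt (by omega) (by omega), ← face_face (by omega), hx]
    simp

theorem face_simpPartial {n i : ℕ} (hi : i < n + 1) {t : ℕ} (ht : i < t) (htn : t ≤ n + 1)
    (x : A.obj (op (SimplexCategory.mk (n + 1)))) :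
    (A.δ ⟨i + 1, by omega⟩).hom (simpPartial A n t x) = 0 := by
  induction t generalizing x with
  | zero => omega
  | succ t ih =>
    rw [simpPartial_succ (by omega)]
    rcases (Nat.lt_succ_iff.1 ht).lt_or_eq with h | rfl
    · exact ih h (by omega) _
    · refine face_simpPartial_of_lt (by omega) (by omega) _ ?_
      rw [map_sub, face_degeneracy_succ, sub_self]

theorem mem_normChains_succ {n : ℕ} {x : A.obj (op (SimplexCategory.mk (n + 1)))} :
    x ∈ normChains A (n + 1) ↔
      ∀ (j : ℕ) (_ : j < n + 1), (A.δ ⟨j + 1, by omega⟩).hom x = 0 := by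
  simp only [normChains, Submodule.mem_iInf, LinearMap.mem_ker]
  exact ⟨fun h j hj => h ⟨j, hj⟩, fun h j => h j.1 j.2⟩

theorem simpProj_mem (n : ℕ) (x : A.obj (op (SimplexCategory.mk n))) :
    simpProj A n x ∈ normChains A n := by
  rcases n with _ | n
  · exact Submodule.mem_top
  · exact mem_normChains_succ.2 fun j hj => face_simpPartial hj hj le_rfl x

theorem simpProj_of_mem {n : ℕ} {x : A.obj (op (SimplexCategory.mk n))} (hx : x ∈ normChains A n) :
    simpProj A n x = x := by
  rcases n with _ | n
  · rfl
  · have h : ∀ t ≤ n + 1, simpPartial A n t x = x := by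
      intro t ht
      induction t with
      | zero => rfl
      | succ t ih =>
        rw [simpPartial_succ (by omega), mem_normChains_succ.1 hx t (by omega), map_zero, sub_zero,
          ih (by omega)]
    exact h _ le_rfl

theorem degeneracy_mem_degenerate {n j : ℕ} (hj : j < n + 1) (x : A.obj (op (SimplexCategory.mk n))) :
    (A.σ ⟨j, hj⟩).hom x ∈ degenerate A (n + 1) :=
  Submodule.mem_iSup_of_mem (⟨j, hj⟩ : Fin (n + 1)) ⟨x, rfl⟩

theorem sub_simpPartial_mem {n t : ℕ} (ht : t ≤ n + 1)
    (x : A.obj (op (SimplexCategory.mk (n + 1)))) :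
    x - simpPartial A n t x ∈ degenerate A (n + 1) := by
  induction t generalizing x with
  | zero => simp [simpPartial]
  | succ t ih =>
    rw [simpPartial_succ (by omega)]
    have := Submodule.add_mem _ (ih (by omega)
      (x - (A.σ ⟨t, by omega⟩).hom ((A.δ ⟨t + 1, by omega⟩).hom x)))
      (degeneracy_mem_degenerate (by omega : t < n + 1) ((A.δ ⟨t + 1, by omega⟩).hom x))
    convert this using 1
    abel

theorem sub_simpProj_mem (n : ℕ) (x : A.obj (op (SimplexCategory.mk n))) :
    x - simpProj A n x ∈ degenerate A n := by
  rcases n with _ | n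
  · simp [simpProj]
  · exact sub_simpPartial_mem le_rfl x

/-- With `r_t = 1 - σ_t ∂_(t+1)` one has `r_t σ_t = 0`, and `r_t σ_j = σ_j r_(t-1)` for `j < t`.
Each factor applied before `r_j` therefore leaves a degeneracy of index `j`. -/
theorem simpPartial_degeneracy {n j : ℕ} (hj : j < n + 1) {t : ℕ} (ht : j < t) (htn : t ≤ n + 1)
    (x : A.obj (op (SimplexCategory.mk n))) :
    simpPartial A n t ((A.σ ⟨j, hj⟩).hom x) = 0 := by
  induction t generalizing x with
  | zero => omega
  | succ t ih =>
    rw [simpPartial_succ (by omega)]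
    rcases (Nat.lt_succ_iff.1 ht).lt_or_eq with h | rfl
    · obtain ⟨n, rfl⟩ : ∃ m, n = m + 1 := ⟨n - 1, by omega⟩
      obtain ⟨t, rfl⟩ : ∃ m, t = m + 1 := ⟨t - 1, by omega⟩
      rw [face_degeneracy_of_gt (by omega) (by omega), ← degeneracy_degeneracy (by omega) (by omega),
        ← map_sub]
      exact ih h (by omega) _
    · rw [face_degeneracy_succ, sub_self, map_zero]

theorem simpProj_degeneracy {n j : ℕ} (hj : j < n + 1) (x : A.obj (op (SimplexCategory.mk n))) :
    simpProj A (n + 1) ((A.σ ⟨j, hj⟩).hom x) = 0 :=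
  simpPartial_degeneracy hj hj le_rfl x

theorem simpProj_of_mem_degenerate {n : ℕ} {x : A.obj (op (SimplexCategory.mk n))}
    (hx : x ∈ degenerate A n) : simpProj A n x = 0 := by
  rcases n with _ | n
  · rw [show x = 0 from hx, map_zero]
  · have h : degenerate A (n + 1) ≤ LinearMap.ker (simpProj A (n + 1)) := by
      refine iSup_le fun i => ?_
      rintro _ ⟨y, rfl⟩
      exact simpProj_degeneracy i.2 y
    exact h hx

theorem simpPartial_naturality {A A' : SimplicialObject (ModuleCat.{u} k)} (f : A ⟶ A') {n t : ℕ}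
    (ht : t ≤ n + 1) (x : A.obj (op (SimplexCategory.mk (n + 1)))) :
    simpPartial A' n t ((f.app _).hom x) = (f.app _).hom (simpPartial A n t x) := by
  induction t generalizing x with
  | zero => rfl
  | succ t ih =>
    rw [simpPartial_succ (by omega), simpPartial_succ (by omega), ← ih (by omega)]
    refine congrArg (simpPartial A' n t) ?_
    rw [map_sub]
    congr 1
    refine (congrArg (A'.σ _).hom (hom_apply_of_comp_eq_comp
      (f.naturality (SimplexCategory.δ ⟨t + 1, by omega⟩).op) x).symm).trans ?_
    exact (hom_apply_of_comp_eq_comp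
      (f.naturality (SimplexCategory.σ ⟨t, by omega⟩).op) _).symm

/-- Besides morphisms of simplicial modules this covers the cosimplicial operators of a bifunctor,
tensoring with a fixed element, and evaluation at a simplex. -/
theorem simpProj_naturality {A A' : SimplicialObject (ModuleCat.{u} k)} (f : A ⟶ A') (n : ℕ)
    (x : A.obj (op (SimplexCategory.mk n))) :
    simpProj A' n ((f.app _).hom x) = (f.app _).hom (simpProj A n x) := by
  rcases n with _ | n
  · rfl
  · exact simpPartial_naturality f le_rfl x

end Simplicial

end Projections

/-! ### Compatible families on the diagonal and their normalization -/

section Bisimplicial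

variable {k : Type u} [CommRing k]
variable (W : SimplexCategory ⥤ SimplicialObject (ModuleCat.{u} k))

/-- The entry of a bifunctor at `([n], [m])`. -/
abbrev biObj (n m : ℕ) : ModuleCat.{u} k := (W.obj (SimplexCategory.mk n)).obj (op (SimplexCategory.mk m))

/-- The cosimplicial module obtained by fixing the simplicial variable. -/
abbrev biRow (m : ℕ) : CosimplicialObject (ModuleCat.{u} k) :=
  (Functor.flip W).obj (op (SimplexCategory.mk m))

/-- The covariant action. -/
def actL {m n : ℕ} (u : SimplexCategory.mk m ⟶ SimplexCategory.mk n) (l : ℕ) :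
    biObj W m l →ₗ[k] biObj W n l :=
  ((W.map u).app (op (SimplexCategory.mk l))).hom

/-- The contravariant action. -/
def actR (n : ℕ) {l m : ℕ} (u : SimplexCategory.mk l ⟶ SimplexCategory.mk m) :
    biObj W n m →ₗ[k] biObj W n l :=
  ((W.obj (SimplexCategory.mk n)).map u.op).hom

variable {W}

theorem actL_actL {l m n : ℕ} (u : SimplexCategory.mk l ⟶ SimplexCategory.mk m)
    (v : SimplexCategory.mk m ⟶ SimplexCategory.mk n) (j : ℕ) (x : biObj W l j) :
    actL W v j (actL W u j x) = actL W (u ≫ v) j x :=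
  hom_apply_of_comp_eq (((Functor.flip W).obj (op (SimplexCategory.mk j))).map_comp u v).symm x

theorem actR_actR (n : ℕ) {l m j : ℕ} (u : SimplexCategory.mk l ⟶ SimplexCategory.mk m)
    (v : SimplexCategory.mk m ⟶ SimplexCategory.mk j) (x : biObj W n j) :
    actR W n u (actR W n v x) = actR W n (u ≫ v) x :=
  hom_apply_of_comp_eq ((W.obj (SimplexCategory.mk n)).map_comp v.op u.op).symm x

theorem actL_id (n l : ℕ) (x : biObj W n l) : actL W (𝟙 (SimplexCategory.mk n)) l x = x :=
  LinearMap.congr_fun (congrArg ModuleCat.Hom.hom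
    (((Functor.flip W).obj (op (SimplexCategory.mk l))).map_id (SimplexCategory.mk n))) x

theorem actR_id (n l : ℕ) (x : biObj W n l) : actR W n (𝟙 (SimplexCategory.mk l)) x = x :=
  LinearMap.congr_fun (congrArg ModuleCat.Hom.hom
    ((W.obj (SimplexCategory.mk n)).map_id (op (SimplexCategory.mk l)))) x

theorem actL_actR {m n l j : ℕ} (u : SimplexCategory.mk m ⟶ SimplexCategory.mk n)
    (v : SimplexCategory.mk l ⟶ SimplexCategory.mk j) (x : biObj W m j) :
    actL W u l (actR W m v x) = actR W n v (actL W u j x) :=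
  hom_apply_of_comp_eq_comp ((W.map u).naturality v.op) x

theorem actL_simpPartial {m n l t : ℕ} (ht : t ≤ l + 1)
    (u : SimplexCategory.mk m ⟶ SimplexCategory.mk n) (x : biObj W m (l + 1)) :
    actL W u (l + 1) (simpPartial (W.obj (SimplexCategory.mk m)) l t x) =
      simpPartial (W.obj (SimplexCategory.mk n)) l t (actL W u (l + 1) x) :=
  (simpPartial_naturality (W.map u) ht x).symm

theorem actL_simpProj {m n l : ℕ} (u : SimplexCategory.mk m ⟶ SimplexCategory.mk n)
    (x : biObj W m l) :
    actL W u l (simpProj (W.obj (SimplexCategory.mk m)) l x) =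
      simpProj (W.obj (SimplexCategory.mk n)) l (actL W u l x) :=
  (simpProj_naturality (W.map u) l x).symm

theorem actR_cosProj {n l m : ℕ} (u : SimplexCategory.mk l ⟶ SimplexCategory.mk m)
    (x : biObj W n m) :
    actR W n u (cosProj (biRow W m) n x) = cosProj (biRow W l) n (actR W n u x) :=
  (cosProj_naturality ((Functor.flip W).map u.op) n x).symm

theorem cosPartial_simpPartial {n l t s : ℕ} (ht : t ≤ n + 1) (hs : s ≤ l + 1)
    (x : biObj W (n + 1) (l + 1)) :
    cosPartial (biRow W (l + 1)) n t (simpPartial (W.obj (SimplexCategory.mk (n + 1))) l s x) =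
      simpPartial (W.obj (SimplexCategory.mk (n + 1))) l s (cosPartial (biRow W (l + 1)) n t x) := by
  induction t with
  | zero => rfl
  | succ t ih =>
    rw [cosPartial_succ (by omega), cosPartial_succ (by omega), ih (by omega), map_sub]
    congr 1
    exact (congrArg _ (actL_simpPartial (W := W) hs (SimplexCategory.σ ⟨t, by omega⟩) _)).trans
      (actL_simpPartial (W := W) hs (SimplexCategory.δ ⟨t + 1, by omega⟩) _)

theorem cosProj_simpProj (n l : ℕ) (x : biObj W n l) :
    cosProj (biRow W l) n (simpProj (W.obj (SimplexCategory.mk n)) l x) =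
      simpProj (W.obj (SimplexCategory.mk n)) l (cosProj (biRow W l) n x) := by
  rcases n with _ | n
  · rfl
  rcases l with _ | l
  · rfl
  exact cosPartial_simpPartial le_rfl le_rfl x

/-- Families on the diagonal compatible with all nondecreasing maps. -/
def Compatible (w : ∀ n, biObj W n n) : Prop :=
  ∀ (m n : ℕ) (u : SimplexCategory.mk m ⟶ SimplexCategory.mk n), actL W u m (w m) = actR W n u (w n)

/-- A non-injective map factors through a codegeneracy and a non-surjective one through a coface,
both with a smaller remaining map; a bijective one is the identity. The bound `N` allows the use
inside the recursive construction of a family, when only the lower levels are known to be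
compatible. -/
theorem compatible_of_generators (w : ∀ n, biObj W n n) (N : ℕ)
    (hσ : ∀ n < N, ∀ i : Fin (n + 1), actL W (SimplexCategory.σ i) (n + 1) (w (n + 1)) =
      actR W n (SimplexCategory.σ i) (w n))
    (hδ : ∀ n < N, ∀ i : Fin (n + 2), actL W (SimplexCategory.δ i) n (w n) =
      actR W (n + 1) (SimplexCategory.δ i) (w (n + 1)))
    (m n : ℕ) (hm : m ≤ N) (hn : n ≤ N) (u : SimplexCategory.mk m ⟶ SimplexCategory.mk n) :
    actL W u m (w m) = actR W n u (w n) := by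
  induction h : m + n using Nat.strong_induction_on generalizing m n with
  | _ s ih =>
    by_cases hi : Function.Injective u.toOrderHom
    · by_cases hs : Function.Surjective u.toOrderHom
      · have hmn : m = n := by
          have := Fintype.card_of_bijective ⟨hi, hs⟩
          simpa using this
        subst hmn
        have : Mono u := SimplexCategory.mono_iff_injective.2 hi
        rw [SimplexCategory.eq_id_of_mono u, actL_id, actR_id]
      · obtain _ | n := n
        · exfalso
          refine hs fun y => ⟨0, ?_⟩
          exact Subsingleton.elim (α := Fin 1) _ _
        · obtain ⟨i, v, rfl⟩ := SimplexCategory.eq_comp_δ_of_not_surjective u hs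
          rw [← actL_actL, ← actR_actR, ← hδ n (by omega) i, ← actL_actR,
            ih (m + n) (by omega) m n hm (by omega) v rfl]
    · obtain _ | m := m
      · exfalso
        refine hi fun x y _ => ?_
        exact Subsingleton.elim (α := Fin 1) _ _
      · obtain ⟨i, v, rfl⟩ := SimplexCategory.eq_σ_comp_of_not_injective u hi
        rw [← actL_actL, ← actR_actR, hσ m (by omega) i, actL_actR,
          ih (m + n) (by omega) m n (by omega) hn v rfl]

/-- Compatibility turns `d^(t+1) s^t` into `σ_t ∂_(t+1)`. The new factor stands on the left of the
cosimplicial product and on the right of the simplicial one; this matches because operators in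
different variables commute. -/
theorem cosPartial_eq_simpPartial {w : ∀ n, biObj W n n} (hw : Compatible w) {n t : ℕ}
    (ht : t ≤ n + 1) : cosPartial (biRow W (n + 1)) n t (w (n + 1)) =
      simpPartial (W.obj (SimplexCategory.mk (n + 1))) n t (w (n + 1)) := by
  induction t with
  | zero => rfl
  | succ t ih =>
    rw [cosPartial_succ (by omega), simpPartial_succ (by omega), ih (by omega), map_sub]
    congr 1
    refine (actL_actL (W := W) (SimplexCategory.σ ⟨t, by omega⟩)
      (SimplexCategory.δ ⟨t + 1, by omega⟩) _ _).trans ?_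
    rw [actL_simpPartial (by omega)]
    refine congrArg _ ?_
    rw [hw]
    exact (actR_actR _ _ _ _).symm

theorem cosProj_eq_simpProj {w : ∀ n, biObj W n n} (hw : Compatible w) (n : ℕ) :
    cosProj (biRow W n) n (w n) = simpProj (W.obj (SimplexCategory.mk n)) n (w n) := by
  rcases n with _ | n
  · rfl
  · exact cosPartial_eq_simpPartial hw le_rfl

/-- If `w n = 0`, then `s^j w (n+1) = σ_j w n = 0`; hence `w (n+1)` is normalized and equals its own
projection. -/
theorem eq_zero_of_cosProj_eq_zero {w : ∀ n, biObj W n n} (hw : Compatible w)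
    (h : ∀ n, cosProj (biRow W n) n (w n) = 0) (n : ℕ) : w n = 0 := by
  induction n with
  | zero => exact h 0
  | succ n ih =>
    rw [← h (n + 1)]
    refine (cosProj_of_mem ((mem_normCochains_succ (M := biRow W (n + 1))).2 fun j hj => ?_)).symm
    refine (hw (n + 1) n (SimplexCategory.σ ⟨j, hj⟩)).trans ?_
    rw [ih, map_zero]

/-- The contribution of lower degree in the reconstruction of a compatible family from its
normalization. -/
noncomputable def liftStep (n : ℕ) (v : biObj W n n) : biObj W (n + 1) (n + 1) :=
  ∑ j : Fin (n + 1), actL W (SimplexCategory.δ j.succ) (n + 1)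
    (simpPartial (W.obj (SimplexCategory.mk n)) n j (actR W n (SimplexCategory.σ j) v))

theorem sum_sub_succ {V : Type*} [AddCommGroup V] (a : ℕ → V) (n : ℕ) :
    ∑ j : Fin n, (a j - a (j + 1)) = a 0 - a n := by
  rw [Fin.sum_univ_eq_sum_range (fun j => a j - a (j + 1)) n, Finset.sum_range_sub']

/-- The formula of `liftStep` comes from telescoping `1 - r_0 ⋯ r_n`, with `r_j = 1 - σ_j ∂_(j+1)`,
on `w (n+1)` and replacing `∂_(j+1) w (n+1)` by `d^(j+1) w n`. Applying a codegeneracy makes the sum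
telescope back to `σ_i v`; the end term is the projection of a degenerate element, hence zero. -/
theorem actL_codegeneracy_liftStep {n : ℕ} (v : biObj W n n)
    (hv : ∀ u : SimplexCategory.mk n ⟶ SimplexCategory.mk n, actL W u n v = actR W n u v)
    (i : Fin (n + 1)) :
    actL W (SimplexCategory.σ i) (n + 1) (liftStep n v) = actR W n (SimplexCategory.σ i) v := by
  have h : ∀ j : Fin (n + 1), actL W (SimplexCategory.σ i) (n + 1)
      (actL W (SimplexCategory.δ j.succ) (n + 1)
        (simpPartial (W.obj (SimplexCategory.mk n)) n j (actR W n (SimplexCategory.σ j) v))) =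
      simpPartial (W.obj (SimplexCategory.mk n)) n j (actR W n (SimplexCategory.σ i) v) -
      simpPartial (W.obj (SimplexCategory.mk n)) n (j + 1) (actR W n (SimplexCategory.σ i) v) := by
    intro j
    rw [simpPartial_succ j.2, map_sub, sub_sub_cancel, actL_actL, actL_simpPartial j.2.le, actL_actR,
      hv, ← actR_actR]
    rfl
  rw [liftStep, map_sum, Finset.sum_congr rfl fun j _ => h j,
    sum_sub_succ (fun j => simpPartial (W.obj (SimplexCategory.mk n)) n j
      (actR W n (SimplexCategory.σ i) v)),
    show simpPartial (W.obj (SimplexCategory.mk n)) n (n + 1) (actR W n (SimplexCategory.σ i) v) = 0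
      from simpPartial_degeneracy i.2 i.2 le_rfl v, sub_zero]
  rfl

/-- This transports a product of simplicial operators, enclosed between two others, to the
cosimplicial variable. The map `g` stays arbitrary in the induction because each factor `σ_t
∂_(t+1)` lengthens it by a codegeneracy and a coface. -/
theorem actR_simpPartial_actR {n : ℕ} (v : biObj W n n)
    (hv : ∀ u : SimplexCategory.mk n ⟶ SimplexCategory.mk n, actL W u n v = actR W n u v)
    (f : SimplexCategory.mk n ⟶ SimplexCategory.mk (n + 1))
    (g : SimplexCategory.mk (n + 1) ⟶ SimplexCategory.mk n) {t : ℕ} (ht : t ≤ n + 1) :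
    actR W n f (simpPartial (W.obj (SimplexCategory.mk n)) n t (actR W n g v)) =
      actL W g n (cosPartial (biRow W n) n t (actL W f n v)) := by
  induction t generalizing g with
  | zero => exact (actR_actR _ _ _ _).trans ((hv _).symm.trans (actL_actL _ _ _ _).symm)
  | succ t ih =>
    rw [cosPartial_succ (by omega), simpPartial_succ (by omega), map_sub, map_sub, map_sub,
      ih g (by omega)]
    congr 1
    refine Eq.trans (congrArg (fun z => actR W n f
      (simpPartial (W.obj (SimplexCategory.mk n)) n t z)) ?_)
      ((ih (SimplexCategory.σ ⟨t, by omega⟩ ≫ SimplexCategory.δ ⟨t + 1, by omega⟩ ≫ g)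
        (by omega)).trans ?_)
    · rw [← actR_actR, ← actR_actR]
      rfl
    · rw [← actL_actL, ← actL_actL]
      rfl

/-- After the transport the sum telescopes in the cosimplicial variable, and the end term vanishes
because the projection kills positive cofaces. -/
theorem actR_coface_liftStep {n : ℕ} (v : biObj W n n)
    (hv : ∀ u : SimplexCategory.mk n ⟶ SimplexCategory.mk n, actL W u n v = actR W n u v)
    (i : Fin (n + 1)) :
    actR W (n + 1) (SimplexCategory.δ i.succ) (liftStep n v) =
      actL W (SimplexCategory.δ i.succ) n v := by
  have h : ∀ j : Fin (n + 1), actR W (n + 1) (SimplexCategory.δ i.succ)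
      (actL W (SimplexCategory.δ j.succ) (n + 1)
        (simpPartial (W.obj (SimplexCategory.mk n)) n j (actR W n (SimplexCategory.σ j) v))) =
      cosPartial (biRow W n) n j (actL W (SimplexCategory.δ i.succ) n v) -
      cosPartial (biRow W n) n (j + 1) (actL W (SimplexCategory.δ i.succ) n v) := by
    intro j
    rw [cosPartial_succ j.2, sub_sub_cancel, ← actL_actR, actR_simpPartial_actR v hv _ _ j.2.le]
    rfl
  rw [liftStep, map_sum, Finset.sum_congr rfl fun j _ => h j,
    sum_sub_succ (fun j => cosPartial (biRow W n) n j (actL W (SimplexCategory.δ i.succ) n v)),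
    show cosPartial (biRow W n) n (n + 1) (actL W (SimplexCategory.δ i.succ) n v) = 0
      from cosProj_coface (M := biRow W n) i.2 v, sub_zero]
  rfl

theorem cosProj_liftStep (n : ℕ) (v : biObj W n n) :
    cosProj (biRow W (n + 1)) (n + 1) (liftStep n v) = 0 := by
  rw [liftStep, map_sum]
  exact Finset.sum_eq_zero fun j _ => cosProj_coface j.2 _

theorem simpProj_liftStep (n : ℕ) (v : biObj W n n) :
    simpProj (W.obj (SimplexCategory.mk (n + 1))) (n + 1) (liftStep n v) = 0 := by
  rw [liftStep, map_sum]
  refine Finset.sum_eq_zero fun j _ => ?_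
  rw [← actL_simpProj, simpProj_of_mem_degenerate, map_zero]
  have h1 := degeneracy_mem_degenerate (A := W.obj (SimplexCategory.mk n)) j.2 v
  have h2 : simpPartial (W.obj (SimplexCategory.mk n)) n j (actR W n (SimplexCategory.σ j) v) =
    actR W n (SimplexCategory.σ j) v - (actR W n (SimplexCategory.σ j) v -
      simpPartial (W.obj (SimplexCategory.mk n)) n j (actR W n (SimplexCategory.σ j) v)) := by abel
  rw [h2]
  exact Submodule.sub_mem _ h1 (sub_simpPartial_mem j.2.le _)

variable (W) in
/-- Families on the diagonal that are normalized in both variables and compatible with the boundaries. -/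
structure BiNormalized (y : ∀ n, biObj W n n) : Prop where
  left : ∀ n, y n ∈ normCochains (biRow W n) n
  right : ∀ n, y n ∈ normChains (W.obj (SimplexCategory.mk n)) n
  boundary : ∀ n, coboundary (biRow W n) n (y n) = actR W (n + 1) (SimplexCategory.δ 0) (y (n + 1))

theorem Compatible.biNormalized {w : ∀ n, biObj W n n} (hw : Compatible w) :
    BiNormalized W (fun n => cosProj (biRow W n) n (w n)) where
  left n := cosProj_mem n _
  right n := by
    rw [cosProj_eq_simpProj hw]
    exact simpProj_mem n _
  boundary n := by
    rw [actR_cosProj, ← hw n (n + 1)]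
    exact (cosProj_coboundary n _).symm.trans (cosProj_coface_zero n (M := biRow W n) _).symm

/-- The reconstruction of a compatible family from its normalization. -/
noncomputable def liftFamily (y : ∀ n, biObj W n n) : ∀ n, biObj W n n
  | 0 => y 0
  | n + 1 => y (n + 1) + liftStep n (liftFamily y n)

theorem cosProj_liftFamily {y : ∀ n, biObj W n n} (hy : BiNormalized W y) (n : ℕ) :
    cosProj (biRow W n) n (liftFamily y n) = y n := by
  rcases n with _ | n
  · rfl
  · rw [liftFamily, map_add, cosProj_liftStep, add_zero, cosProj_of_mem (hy.left _)]

theorem simpProj_liftFamily {y : ∀ n, biObj W n n} (hy : BiNormalized W y) (n : ℕ) :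
    simpProj (W.obj (SimplexCategory.mk n)) n (liftFamily y n) = y n := by
  rcases n with _ | n
  · rfl
  · rw [liftFamily, map_add, simpProj_liftStep, add_zero, simpProj_of_mem (hy.right _)]

/-- Codegeneracies and positive cofaces are taken care of by `liftStep`. The coface of index 0 is
the only place where the boundary condition on `y` is used: the defect there is normalized in both
variables, and its double projection is zero. -/
theorem liftFamily_generators {y : ∀ n, biObj W n n} (hy : BiNormalized W y) (n : ℕ) :
    (∀ i : Fin (n + 1), actL W (SimplexCategory.σ i) (n + 1) (liftFamily y (n + 1)) =
      actR W n (SimplexCategory.σ i) (liftFamily y n)) ∧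
    ∀ i : Fin (n + 2), actL W (SimplexCategory.δ i) n (liftFamily y n) =
      actR W (n + 1) (SimplexCategory.δ i) (liftFamily y (n + 1)) := by
  induction n using Nat.strong_induction_on with
  | _ n ih =>
    have hv := compatible_of_generators (liftFamily y) n (fun l hl => (ih l hl).1)
      (fun l hl => (ih l hl).2)
    have hσ : ∀ i : Fin (n + 1), actL W (SimplexCategory.σ i) (n + 1) (liftFamily y (n + 1)) =
        actR W n (SimplexCategory.σ i) (liftFamily y n) := by
      intro i
      rw [liftFamily, map_add, actL_codegeneracy_liftStep _ (hv n n le_rfl le_rfl)]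
      rw [show actL W (SimplexCategory.σ i) (n + 1) (y (n + 1)) = 0
        from mem_normCochains_succ.1 (hy.left (n + 1)) i i.2, zero_add]
    have hδ : ∀ i : Fin (n + 1), actL W (SimplexCategory.δ i.succ) n (liftFamily y n) =
        actR W (n + 1) (SimplexCategory.δ i.succ) (liftFamily y (n + 1)) := by
      intro i
      rw [liftFamily, map_add, actR_coface_liftStep _ (hv n n le_rfl le_rfl)]
      rw [show actR W (n + 1) (SimplexCategory.δ i.succ) (y (n + 1)) = 0
        from mem_normChains_succ.1 (hy.right (n + 1)) i i.2, zero_add]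
    refine ⟨hσ, fun i => Fin.cases ?_ hδ i⟩
    rw [eq_comm, ← sub_eq_zero]
    set z := actR W (n + 1) (SimplexCategory.δ 0) (liftFamily y (n + 1)) -
      actL W (SimplexCategory.δ 0) n (liftFamily y n) with hz
    -- For `j = 0` the codegeneracy cancels the coface on both sides; for `j > 0` it moves past the
    -- coface, and the compatibility of `liftFamily y n` with endomorphisms of `[n]` applies.
    have h1 : z ∈ normCochains (biRow W n) (n + 1) := by
      refine mem_normCochains_succ.2 fun j hj => ?_
      change actL W (SimplexCategory.σ ⟨j, hj⟩) n z = 0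
      rw [hz, map_sub, actL_actR, hσ, actR_actR]
      rcases j with _ | j
      · rw [actL_actL]
        have e : SimplexCategory.δ (0 : Fin (n + 2)) ≫ SimplexCategory.σ ⟨0, hj⟩ = 𝟙 _ :=
          SimplexCategory.δ_comp_σ_self (i := (⟨0, hj⟩ : Fin (n + 1)))
        rw [e, actL_id, actR_id, sub_self]
      · obtain ⟨n, rfl⟩ : ∃ l, n = l + 1 := ⟨n - 1, by omega⟩
        rw [actL_actL]
        have e : SimplexCategory.δ (0 : Fin (n + 3)) ≫ SimplexCategory.σ ⟨j + 1, hj⟩ =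
            SimplexCategory.σ ⟨j, by omega⟩ ≫ SimplexCategory.δ 0 :=
          SimplexCategory.δ_comp_σ_of_le (i := (0 : Fin (n + 2))) (j := ⟨j, by omega⟩)
            (Nat.zero_le _)
        rw [e, hv (n + 1) (n + 1) le_rfl le_rfl, sub_self]
    have h2 : z ∈ normChains (W.obj (SimplexCategory.mk (n + 1))) n := by
      rcases n with _ | n
      · exact Submodule.mem_top
      · refine mem_normChains_succ.2 fun j hj => ?_
        change actR W (n + 2) (SimplexCategory.δ ⟨j + 1, by omega⟩) z = 0
        have e : SimplexCategory.δ ⟨j + 1, by omega⟩ ≫ SimplexCategory.δ (0 : Fin (n + 3)) =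
            SimplexCategory.δ (0 : Fin (n + 2)) ≫ SimplexCategory.δ ⟨j + 2, by omega⟩ :=
          (SimplexCategory.δ_comp_δ (i := (0 : Fin (n + 2))) (j := ⟨j + 1, by omega⟩)
            (Nat.zero_le _)).symm
        have h3 := hδ ⟨j + 1, by omega⟩
        simp only [Fin.succ_mk] at h3
        rw [hz, map_sub, actR_actR, e, ← actR_actR, ← h3, ← actL_actR, ← actL_actR,
          ← hv n (n + 1) (by omega) le_rfl, ← hv n (n + 1) (by omega) le_rfl, actL_actL, actL_actL,
          ← e, sub_self]
    have h3 : cosProj (biRow W n) (n + 1) z = z := cosProj_of_mem h1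
    have h4 : simpProj (W.obj (SimplexCategory.mk (n + 1))) n z = z := simpProj_of_mem h2
    have h5 : cosProj (biRow W n) (n + 1) (actL W (SimplexCategory.δ 0) n (y n)) =
        coboundary (biRow W n) n (y n) :=
      (cosProj_coface_zero n (M := biRow W n) (y n)).trans
        (cosProj_of_mem (coboundary_mem _ n _ (hy.left n)))
    -- The boundary condition replaces `∂_0` of the new term by `d^0` of `y n`. What remains is the
    -- image of `y n - liftFamily y n`, which the simplicial projection kills.
    have h7 : z = cosProj (biRow W n) (n + 1)
        (actL W (SimplexCategory.δ 0) n (y n) - actL W (SimplexCategory.δ 0) n (liftFamily y n)) := by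
      conv_lhs => rw [← h3, hz]
      rw [map_sub, ← actR_cosProj, cosProj_liftFamily hy, ← hy.boundary, ← h5, ← map_sub]
    have h6 : simpProj (W.obj (SimplexCategory.mk (n + 1))) n
        (actL W (SimplexCategory.δ 0) n (y n) - actL W (SimplexCategory.δ 0) n (liftFamily y n)) = 0 := by
      rw [← map_sub, ← actL_simpProj, map_sub, simpProj_liftFamily hy, simpProj_of_mem (hy.right n),
        sub_self, map_zero]
    rw [← h4, h7, ← cosProj_simpProj, h6, map_zero]

theorem liftFamily_compatible {y : ∀ n, biObj W n n} (hy : BiNormalized W y) :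
    Compatible (liftFamily y) := fun m n u =>
  compatible_of_generators (liftFamily y) (max m n) (fun l _ => (liftFamily_generators hy l).1)
    (fun l _ => (liftFamily_generators hy l).2) m n (le_max_left _ _) (le_max_right _ _) u

end Bisimplicial

/-! ### The tensor coproduct and its normalization -/

section TensorNormalization

variable {k : Type u} [CommRing k]

variable (k) in
/-- The functor `U ↦ V ⊗ U`. -/
noncomputable def tensorFunctor (V : Type u) [AddCommGroup V] [Module k V] :
    ModuleCat.{u} k ⥤ ModuleCat.{u} k where
  obj U := ModuleCat.of k (V ⊗[k] U)
  map f := ModuleCat.ofHom (LinearMap.lTensor V f.hom)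
  map_id U := ModuleCat.hom_ext (LinearMap.lTensor_id V U)
  map_comp f g := ModuleCat.hom_ext (LinearMap.lTensor_comp V g.hom f.hom)

/-- The natural transformation of tensor functors given by a linear map. -/
noncomputable def tensorFunctorMap {V V' : Type u} [AddCommGroup V] [Module k V] [AddCommGroup V']
    [Module k V'] (f : V →ₗ[k] V') : tensorFunctor k V ⟶ tensorFunctor k V' where
  app U := ModuleCat.ofHom (LinearMap.rTensor U f)
  naturality _ _ _ := ModuleCat.hom_ext (TensorProduct.ext' fun _ _ => rfl)

section

variable (M : CosimplicialObject (ModuleCat.{u} k)) (A : SimplicialObject (ModuleCat.{u} k))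

/-- The bifunctor `([n], [m]) ↦ M^n ⊗ A_m`. -/
noncomputable def tensorBi : SimplexCategory ⥤ SimplicialObject (ModuleCat.{u} k) where
  obj Δ := A ⋙ tensorFunctor k (M.obj Δ)
  map u := Functor.whiskerLeft A (tensorFunctorMap (M.map u).hom)
  map_id Δ := by
    refine NatTrans.ext (funext fun Δ' => ModuleCat.hom_ext (TensorProduct.ext' fun x y => ?_))
    change (M.map (𝟙 Δ)).hom x ⊗ₜ y = x ⊗ₜ y
    rw [M.map_id]
    rfl
  map_comp u v := by
    refine NatTrans.ext (funext fun Δ' => ModuleCat.hom_ext (TensorProduct.ext' fun x y => ?_))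
    change (M.map (u ≫ v)).hom x ⊗ₜ y = (M.map v).hom ((M.map u).hom x) ⊗ₜ y
    rw [M.map_comp]
    rfl

/-- The morphism `m ↦ m ⊗ a`. -/
noncomputable def tmulRight (n : ℕ) (a : A.obj (op (SimplexCategory.mk n))) :
    M ⟶ biRow (tensorBi M A) n where
  app Δ := ModuleCat.ofHom ((TensorProduct.mk k _ _).flip a)

/-- The morphism `a ↦ m ⊗ a`. -/
noncomputable def tmulLeft (n : ℕ) (m : M.obj (SimplexCategory.mk n)) :
    A ⟶ (tensorBi M A).obj (SimplexCategory.mk n) where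
  app Δ := ModuleCat.ofHom (TensorProduct.mk k _ _ m)

/-- For fixed `a` the map `x ↦ x ⊗ a` is a morphism of cosimplicial modules, so naturality of the
projection gives the formula on pure tensors. -/
theorem cosProj_tensorBi (n m : ℕ) : cosProj (biRow (tensorBi M A) m) n =
    LinearMap.rTensor (A.obj (op (SimplexCategory.mk m))) (cosProj M n) :=
  TensorProduct.ext' fun x a => cosProj_naturality (tmulRight M A m a) n x

theorem coboundary_tensorBi (n m : ℕ) : coboundary (biRow (tensorBi M A) m) n =
    LinearMap.rTensor (A.obj (op (SimplexCategory.mk m))) (coboundary M n) :=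
  TensorProduct.ext' fun x a => coboundary_naturality (tmulRight M A m a) n x

theorem simpProj_tensorBi (n m : ℕ) : simpProj ((tensorBi M A).obj (SimplexCategory.mk n)) m =
    LinearMap.lTensor (M.obj (SimplexCategory.mk n)) (simpProj A m) :=
  TensorProduct.ext' fun x a => simpProj_naturality (tmulLeft M A n x) m a

/-- The projection onto the normalized cochains. -/
noncomputable def toNormCochains (n : ℕ) : M.obj (SimplexCategory.mk n) →ₗ[k] normCochains M n :=
  (cosProj M n).codRestrict _ (cosProj_mem n)

/-- The projection onto the normalized chains. -/
noncomputable def toNormChains (n : ℕ) : A.obj (op (SimplexCategory.mk n)) →ₗ[k] normChains A n :=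
  (simpProj A n).codRestrict _ (simpProj_mem n)

/-- The inclusion of the tensor product of the normalizations. -/
noncomputable def normTensorIncl (n m : ℕ) : normCochains M n ⊗[k] normChains A m →ₗ[k]
    M.obj (SimplexCategory.mk n) ⊗[k] A.obj (op (SimplexCategory.mk m)) :=
  TensorProduct.map (normCochains M n).subtype (normChains A m).subtype

/-- The projection onto the tensor product of the normalizations. -/
noncomputable def normTensorProj (n m : ℕ) :
    M.obj (SimplexCategory.mk n) ⊗[k] A.obj (op (SimplexCategory.mk m)) →ₗ[k]
    normCochains M n ⊗[k] normChains A m :=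
  TensorProduct.map (toNormCochains M n) (toNormChains A m)

variable {M A}

theorem toNormCochains_coe {n : ℕ} (x : normCochains M n) : toNormCochains M n x.1 = x :=
  Subtype.ext (cosProj_of_mem x.2)

theorem toNormChains_coe {n : ℕ} (x : normChains A n) : toNormChains A n x.1 = x :=
  Subtype.ext (simpProj_of_mem x.2)

/-- The normalizations are direct factors. Their tensor product therefore embeds into the full one
without any flatness, and identities can be checked after the inclusion. -/
theorem normTensorProj_incl (n m : ℕ) (x : normCochains M n ⊗[k] normChains A m) :
    normTensorProj M A n m (normTensorIncl M A n m x) = x := by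
  have h : normTensorProj M A n m ∘ₗ normTensorIncl M A n m = LinearMap.id :=
    TensorProduct.ext' fun x y => by
      change toNormCochains M n x.1 ⊗ₜ toNormChains A m y.1 = _
      rw [toNormCochains_coe, toNormChains_coe]
      rfl
  exact LinearMap.congr_fun h x

theorem normTensorIncl_injective (n m : ℕ) : Function.Injective (normTensorIncl M A n m) :=
  Function.LeftInverse.injective (normTensorProj_incl n m)

theorem normTensorIncl_proj (n m : ℕ)
    (x : M.obj (SimplexCategory.mk n) ⊗[k] A.obj (op (SimplexCategory.mk m))) :
    normTensorIncl M A n m (normTensorProj M A n m x) =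
      TensorProduct.map (cosProj M n) (simpProj A m) x := by
  have h : normTensorIncl M A n m ∘ₗ normTensorProj M A n m =
      TensorProduct.map (cosProj M n) (simpProj A m) := TensorProduct.ext' fun x y => rfl
  exact LinearMap.congr_fun h x

theorem normTensorIncl_normD (n m : ℕ) (x : normCochains M n ⊗[k] normChains A m) :
    normTensorIncl M A (n + 1) m (LinearMap.rTensor _ (normD M n) x) =
      LinearMap.rTensor _ (coboundary M n) (normTensorIncl M A n m x) := by
  have h : normTensorIncl M A (n + 1) m ∘ₗ LinearMap.rTensor _ (normD M n) =
      LinearMap.rTensor _ (coboundary M n) ∘ₗ normTensorIncl M A n m :=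
    TensorProduct.ext' fun x y => rfl
  exact LinearMap.congr_fun h x

theorem normTensorIncl_normBoundary (n m : ℕ) (x : normCochains M n ⊗[k] normChains A (m + 1)) :
    normTensorIncl M A n m (LinearMap.lTensor _ (normBoundary A m) x) =
      LinearMap.lTensor _ (A.δ 0).hom (normTensorIncl M A n (m + 1) x) := by
  have h : normTensorIncl M A n m ∘ₗ LinearMap.lTensor _ (normBoundary A m) =
      LinearMap.lTensor _ (A.δ 0).hom ∘ₗ normTensorIncl M A n (m + 1) :=
    TensorProduct.ext' fun x y => rfl
  exact LinearMap.congr_fun h x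

theorem toNormQuotient_proj (n : ℕ)
    (x : M.obj (SimplexCategory.mk n) ⊗[k] A.obj (op (SimplexCategory.mk n))) :
    toNormQuotient M A n (TensorProduct.map (cosProj M n) (simpProj A n) x) =
      toNormQuotient M A n x := by
  have e1 : ∀ x, (cofaceImage M n).mkQ (cosProj M n x) = (cofaceImage M n).mkQ x := fun x => by
    rw [eq_comm, ← sub_eq_zero, ← map_sub]
    exact (Submodule.Quotient.mk_eq_zero _).2 (sub_cosProj_mem n x)
  have e2 : ∀ x, (degenerate A n).mkQ (simpProj A n x) = (degenerate A n).mkQ x := fun x => by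
    rw [eq_comm, ← sub_eq_zero, ← map_sub]
    exact (Submodule.Quotient.mk_eq_zero _).2 (sub_simpProj_mem n x)
  have h : toNormQuotient M A n ∘ₗ TensorProduct.map (cosProj M n) (simpProj A n) =
      toNormQuotient M A n :=
    TensorProduct.ext' fun x y => congrArg₂ (fun a b => a ⊗ₜ b) (e1 x) (e2 y)
  exact LinearMap.congr_fun h x

theorem normTensorProj_of_toNormQuotient {n : ℕ}
    {x : M.obj (SimplexCategory.mk n) ⊗[k] A.obj (op (SimplexCategory.mk n))}
    (hx : toNormQuotient M A n x = 0) : normTensorProj M A n n x = 0 := by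
  have h1 : cofaceImage M n ≤ LinearMap.ker (toNormCochains M n) := fun x hx =>
    Subtype.ext (cosProj_of_mem_cofaceImage hx)
  have h2 : degenerate A n ≤ LinearMap.ker (toNormChains A n) := fun x hx =>
    Subtype.ext (simpProj_of_mem_degenerate hx)
  have h : TensorProduct.map ((cofaceImage M n).liftQ _ h1) ((degenerate A n).liftQ _ h2) ∘ₗ
      toNormQuotient M A n = normTensorProj M A n n := TensorProduct.ext' fun x y => rfl
  rw [← h, LinearMap.comp_apply, hx, map_zero]

theorem compatible_of_mem {w : (n : ℕ) →
      M.obj (SimplexCategory.mk n) ⊗[k] A.obj (op (SimplexCategory.mk n))}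
    (hw : w ∈ tensorCoproduct M A) : Compatible (W := tensorBi M A) w := fun m n u => hw.1 m n u

/-- On a compatible family the two one-sided projections agree, and they are idempotent, so
projecting in one variable already projects in both. -/
theorem proj_eq_cosProj {w : (n : ℕ) →
      M.obj (SimplexCategory.mk n) ⊗[k] A.obj (op (SimplexCategory.mk n))}
    (hw : Compatible (W := tensorBi M A) w) (n : ℕ) :
    TensorProduct.map (cosProj M n) (simpProj A n) (w n) =
      cosProj (biRow (tensorBi M A) n) n (w n) := by
  have h1 := cosProj_eq_simpProj hw n
  have h2 : cosProj (biRow (tensorBi M A) n) n (cosProj (biRow (tensorBi M A) n) n (w n)) =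
      cosProj (biRow (tensorBi M A) n) n (w n) := cosProj_of_mem (cosProj_mem n _)
  conv_rhs => rw [← h2, h1]
  rw [simpProj_tensorBi, cosProj_tensorBi]
  exact (LinearMap.congr_fun (LinearMap.rTensor_comp_lTensor _ _ _) (w n)).symm

variable (M A) in
/-- The passage to the tensor products of the normalizations. -/
noncomputable def normalize : tensorCoproduct M A →ₗ[k] normTensorCoproduct M A :=
  LinearMap.restrict (LinearMap.pi fun n => normTensorProj M A n n ∘ₗ LinearMap.proj n) (by
    intro w hw
    have hc := compatible_of_mem hw
    refine ⟨fun n => normTensorIncl_injective _ _ ?_, ?_⟩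
    · simp only [LinearMap.pi_apply, LinearMap.comp_apply, LinearMap.proj_apply]
      rw [normTensorIncl_normD, normTensorIncl_normBoundary, normTensorIncl_proj,
        normTensorIncl_proj, proj_eq_cosProj hc, proj_eq_cosProj hc]
      have h := hc.biNormalized.boundary n
      rw [coboundary_tensorBi] at h
      exact h
    · obtain ⟨N, hN⟩ := hw.2
      exact ⟨N, fun n hn => normTensorProj_of_toNormQuotient (hN n hn)⟩)

theorem normTensorIncl_normalize (w : tensorCoproduct M A) (n : ℕ) :
    normTensorIncl M A n n ((normalize M A w).1 n) =
      TensorProduct.map (cosProj M n) (simpProj A n) (w.1 n) :=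
  normTensorIncl_proj n n _

theorem normalize_injective : Function.Injective (normalize M A) := by
  refine (injective_iff_map_eq_zero _).2 fun w hw => Subtype.ext (funext fun n => ?_)
  refine eq_zero_of_cosProj_eq_zero (compatible_of_mem w.2) (fun n => ?_) n
  rw [← proj_eq_cosProj (compatible_of_mem w.2), ← normTensorIncl_normalize, hw]
  exact map_zero _

theorem rTensor_codegeneracy_incl (n m : ℕ) (j : ℕ) (hj : j < n + 1)
    (x : normCochains M (n + 1) ⊗[k] normChains A m) :
    LinearMap.rTensor _ (M.σ ⟨j, hj⟩).hom (normTensorIncl M A (n + 1) m x) = 0 := by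
  have h : LinearMap.rTensor _ (M.σ ⟨j, hj⟩).hom ∘ₗ normTensorIncl M A (n + 1) m = 0 :=
    TensorProduct.ext' fun x y => by
      change (M.σ ⟨j, hj⟩).hom x.1 ⊗ₜ y.1 = _
      rw [mem_normCochains_succ.1 x.2 j hj, TensorProduct.zero_tmul]
      rfl
  exact LinearMap.congr_fun h x

theorem lTensor_face_incl (n m : ℕ) (j : ℕ) (hj : j < m + 1)
    (x : normCochains M n ⊗[k] normChains A (m + 1)) :
    LinearMap.lTensor _ (A.δ ⟨j + 1, by omega⟩).hom (normTensorIncl M A n (m + 1) x) = 0 := by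
  have h : LinearMap.lTensor _ (A.δ ⟨j + 1, by omega⟩).hom ∘ₗ normTensorIncl M A n (m + 1) = 0 :=
    TensorProduct.ext' fun x y => by
      change x.1 ⊗ₜ (A.δ ⟨j + 1, _⟩).hom y.1 = _
      rw [mem_normChains_succ.1 y.2 j hj, TensorProduct.tmul_zero]
      rfl
  exact LinearMap.congr_fun h x

theorem biNormalized_incl (y : normTensorCoproduct M A) :
    BiNormalized (tensorBi M A) (fun n => normTensorIncl M A n n (y.1 n)) where
  left n := by
    rcases n with _ | n
    · exact Submodule.mem_top
    · exact mem_normCochains_succ.2 fun j hj => rTensor_codegeneracy_incl _ _ j hj _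
  right n := by
    rcases n with _ | n
    · exact Submodule.mem_top
    · exact mem_normChains_succ.2 fun j hj => lTensor_face_incl _ _ j hj _
  boundary n := by
    rw [coboundary_tensorBi]
    refine (normTensorIncl_normD n n (y.1 n)).symm.trans ?_
    rw [y.2.1]
    exact normTensorIncl_normBoundary _ _ _

theorem normalize_surjective : Function.Surjective (normalize M A) := by
  intro y
  have hy := biNormalized_incl y
  have hc := liftFamily_compatible hy
  let w : (n : ℕ) → M.obj (SimplexCategory.mk n) ⊗[k] A.obj (op (SimplexCategory.mk n)) :=
    liftFamily (W := tensorBi M A) (fun n => normTensorIncl M A n n (y.1 n))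
  have h : ∀ n, normTensorIncl M A n n (normTensorProj M A n n (w n)) =
      normTensorIncl M A n n (y.1 n) := fun n => by
    rw [normTensorIncl_proj]
    exact (proj_eq_cosProj hc n).trans (cosProj_liftFamily hy n)
  refine ⟨⟨w, fun m n u => hc m n u, ?_⟩,
    Subtype.ext (funext fun n => normTensorIncl_injective _ _ (h n))⟩
  -- The lifted family need not vanish in high degrees; the finiteness condition concerns only its
  -- normalization, which is `y`.
  obtain ⟨N, hN⟩ := y.2.2
  refine ⟨N, fun n hn => ?_⟩
  rw [← toNormQuotient_proj, ← normTensorIncl_proj, h, hN n hn, map_zero, map_zero]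

variable (M A) in
/-- Passing to the tensor products of the normalizations is bijective. -/
noncomputable def normalizeEquiv : tensorCoproduct M A ≃ₗ[k] normTensorCoproduct M A :=
  LinearEquiv.ofBijective (normalize M A) ⟨normalize_injective, normalize_surjective⟩

theorem map_proj_naturality {M' : CosimplicialObject (ModuleCat.{u} k)}
    {A' : SimplicialObject (ModuleCat.{u} k)} (f : M ⟶ M') (g : A ⟶ A') (n : ℕ)
    (x : M.obj (SimplexCategory.mk n) ⊗[k] A.obj (op (SimplexCategory.mk n))) :
    TensorProduct.map (cosProj M' n) (simpProj A' n)
      (TensorProduct.map (f.app (SimplexCategory.mk n)).hom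
        (g.app (op (SimplexCategory.mk n))).hom x) =
    TensorProduct.map (f.app (SimplexCategory.mk n)).hom (g.app (op (SimplexCategory.mk n))).hom
      (TensorProduct.map (cosProj M n) (simpProj A n) x) := by
  have h : TensorProduct.map (cosProj M' n) (simpProj A' n) ∘ₗ
      TensorProduct.map (f.app (SimplexCategory.mk n)).hom
        (g.app (op (SimplexCategory.mk n))).hom =
      TensorProduct.map (f.app (SimplexCategory.mk n)).hom
        (g.app (op (SimplexCategory.mk n))).hom ∘ₗ
      TensorProduct.map (cosProj M n) (simpProj A n) :=
    TensorProduct.ext' fun x y =>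
      congrArg₂ (fun a b => a ⊗ₜ b) (cosProj_naturality f n x) (simpProj_naturality g n y)
  exact LinearMap.congr_fun h x

theorem normTensorIncl_map {A' : SimplicialObject (ModuleCat.{u} k)} (g : A ⟶ A') (n m : ℕ)
    (x : normCochains M n ⊗[k] normChains A m) :
    normTensorIncl M A' n m (LinearMap.lTensor _ (normChainsMap g m) x) =
      LinearMap.lTensor _ (g.app (op (SimplexCategory.mk m))).hom (normTensorIncl M A n m x) := by
  have h : normTensorIncl M A' n m ∘ₗ LinearMap.lTensor _ (normChainsMap g m) =
      LinearMap.lTensor _ (g.app (op (SimplexCategory.mk m))).hom ∘ₗ normTensorIncl M A n m :=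
    TensorProduct.ext' fun x y => rfl
  exact LinearMap.congr_fun h x

theorem normalize_map {A' : SimplicialObject (ModuleCat.{u} k)} (g : A ⟶ A')
    (w : tensorCoproduct M A) :
    normalize M A' (tensorCoproductMap (𝟙 M) g w) = normTensorCoproductMap M g (normalize M A w) := by
  refine Subtype.ext (funext fun n => normTensorIncl_injective _ _ ?_)
  refine (normTensorIncl_normalize _ n).trans ((map_proj_naturality (𝟙 M) g n (w.1 n)).trans ?_)
  rw [← normTensorIncl_normalize]
  exact (normTensorIncl_map g n n _).symm

end

variable (k) in
/-- Passing to the tensor products of the normalizations, as an isomorphism of complexes. -/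
noncomputable def normalizeIso (S : Set ℤ) (M : CosimplicialObject (ModuleCat.{u} k)) :
    tensorComplex k S M ≅ normTensorComplex k S M :=
  HomologicalComplex.Hom.isoOfComponents
    (fun p => (normalizeEquiv M (simplicialForms k S p)).toModuleIso) (by
      rintro i j (rfl : i + 1 = j)
      simp only [tensorComplex, normTensorComplex, CochainComplex.of_d]
      refine ModuleCat.hom_ext (LinearMap.ext fun w => ?_)
      exact (normalize_map (formsD k S i) w).symm)

end TensorNormalization

/-! ### Quasi-isomorphisms tested on elements -/

section QuasiIsoCriterion

variable {k : Type u} [CommRing k]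

theorem shortComplex_quasiIso_of_elements {S₁ S₂ : ShortComplex (ModuleCat.{u} k)} (φ : S₁ ⟶ S₂)
    (inj : ∀ (x : S₁.X₂) (y : S₂.X₁), S₁.g.hom x = 0 → φ.τ₂.hom x = S₂.f.hom y →
      ∃ z, x = S₁.f.hom z)
    (surj : ∀ x : S₂.X₂, S₂.g.hom x = 0 →
      ∃ z, S₁.g.hom z = 0 ∧ ∃ y, φ.τ₂.hom z = x + S₂.f.hom y) :
    ShortComplex.QuasiIso φ := by
  let γ := ShortComplex.leftHomologyMapData φ S₁.moduleCatLeftHomologyData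
    S₂.moduleCatLeftHomologyData
  rw [γ.quasiIso_iff]
  have hi : ∀ x, (γ.φK.hom x).1 = φ.τ₂.hom x.1 := fun x =>
    hom_apply_of_comp_eq_comp γ.commi x
  have hπ : ∀ x, γ.φH.hom (Submodule.Quotient.mk x) = Submodule.Quotient.mk (γ.φK.hom x) := fun x =>
    hom_apply_of_comp_eq_comp γ.commπ x
  rw [ConcreteCategory.isIso_iff_bijective]
  constructor
  · refine (injective_iff_map_eq_zero γ.φH.hom).2 fun a ha => ?_
    obtain ⟨x, rfl⟩ := Submodule.Quotient.mk_surjective _ a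
    rw [hπ] at ha
    obtain ⟨y, hy⟩ := (Submodule.Quotient.mk_eq_zero _).1 ha
    obtain ⟨z, hz⟩ := inj x.1 y x.2 ((hi x).symm.trans (congrArg Subtype.val hy).symm)
    exact (Submodule.Quotient.mk_eq_zero _).2 ⟨z, Subtype.ext hz.symm⟩
  · intro a
    obtain ⟨x, rfl⟩ := Submodule.Quotient.mk_surjective _ a
    obtain ⟨z, hz, y, hy⟩ := surj x.1 x.2
    refine ⟨Submodule.Quotient.mk ⟨z, hz⟩, ?_⟩
    refine (hπ _).trans ((Submodule.Quotient.eq _).2 ⟨y, Subtype.ext ?_⟩)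
    refine Eq.trans ?_ (congrArg (· - x.1) (hi ⟨z, hz⟩)).symm
    rw [hy]
    exact (add_sub_cancel_left _ _).symm

theorem quasiIso_of_elements {K L : CochainComplex (ModuleCat.{u} k) ℕ} (f : K ⟶ L)
    (inj_zero : ∀ x : K.X 0, (K.d 0 1).hom x = 0 → (f.f 0).hom x = 0 → x = 0)
    (inj_succ : ∀ (p : ℕ) (x : K.X (p + 1)) (y : L.X p), (K.d (p + 1) (p + 2)).hom x = 0 →
      (f.f (p + 1)).hom x = (L.d p (p + 1)).hom y → ∃ z, x = (K.d p (p + 1)).hom z)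
    (surj_zero : ∀ x : L.X 0, (L.d 0 1).hom x = 0 →
      ∃ z, (K.d 0 1).hom z = 0 ∧ (f.f 0).hom z = x)
    (surj_succ : ∀ (p : ℕ) (x : L.X (p + 1)), (L.d (p + 1) (p + 2)).hom x = 0 →
      ∃ z, (K.d (p + 1) (p + 2)).hom z = 0 ∧
        ∃ y, (f.f (p + 1)).hom z = x + (L.d p (p + 1)).hom y) :
    QuasiIso f := by
  refine ⟨fun p => ?_⟩
  rcases p with _ | p
  · rw [quasiIsoAt_iff' f 0 0 1 (by simp) (by simp)]
    -- In degree 0 the predecessor index is again 0, with zero differential; equalities up to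
    -- coboundaries become equalities.
    have h : L.d 0 0 = 0 := L.shape _ _ (by simp)
    refine shortComplex_quasiIso_of_elements _ (fun x y h1 h2 => ⟨0, ?_⟩) (fun x hx => ?_)
    · rw [map_zero]
      refine inj_zero x h1 (h2.trans ?_)
      change (L.d 0 0).hom y = 0
      rw [h]
      rfl
    · obtain ⟨z, h1, h2⟩ := surj_zero x hx
      exact ⟨z, h1, 0, by rw [map_zero, add_zero]; exact h2⟩
  · rw [quasiIsoAt_iff' f p (p + 1) (p + 2) (by simp) (by simp)]
    exact shortComplex_quasiIso_of_elements _ (inj_succ p) (surj_succ p)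

end QuasiIsoCriterion

/-! ### Normalized cochains inside the complex of all cochains -/

section NormalizedCochains

variable {k : Type u} [CommRing k] (M : CosimplicialObject (ModuleCat.{u} k))

/-- A cosimplicial module is a simplicial object of the opposite category, where `PInfty` is
homotopic to the identity and kills degeneracies, that is, takes values in the kernel of the
codegeneracies. On a cocycle only one of the two homotopy terms survives, a coboundary. -/
theorem exists_normalized_cocycle {n : ℕ} (x : M.obj (SimplexCategory.mk (n + 1)))
    (hx : coboundary M (n + 1) x = 0) :
    ∃ y, x + coboundary M n y ∈ normCochains M (n + 1) := by
  let X := (cosimplicialSimplicialEquiv (ModuleCat.{u} k)).functor.obj (op M)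
  let h := AlgebraicTopology.DoldKan.homotopyPInftyToId X
  have hd : ∀ l, (((AlgebraicTopology.alternatingFaceMapComplex _).obj X).d (l + 1) l).unop.hom =
      coboundary M l := fun l => by
    rw [coboundary, AlgebraicTopology.AlternatingCofaceMapComplex.d_eq_unop_d,
      AlgebraicTopology.alternatingFaceMapComplex_obj_d]
    rfl
  have hc := h.comm (n + 1)
  rw [Homotopy.dNext_succ_chainComplex, Homotopy.prevD_chainComplex] at hc
  have hc' := LinearMap.congr_fun (congrArg (fun g : op (M.obj (SimplexCategory.mk (n + 1))) ⟶
    op (M.obj (SimplexCategory.mk (n + 1))) => g.unop.hom) hc) x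
  let e : M.obj (SimplexCategory.mk n) := (h.hom n (n + 1)).unop.hom x
  refine ⟨e, ?_⟩
  have key : ((AlgebraicTopology.DoldKan.PInfty (X := X)).f (n + 1)).unop.hom x =
      x + coboundary M n e := by
    have e1 : (((AlgebraicTopology.alternatingFaceMapComplex _).obj X).d (n + 1) n).unop.hom e =
      coboundary M n e := LinearMap.congr_fun (hd n) e
    have e2 : (h.hom (n + 1) (n + 2)).unop.hom
        ((((AlgebraicTopology.alternatingFaceMapComplex _).obj X).d (n + 2) (n + 1)).unop.hom x) =
        0 :=
      (congrArg (h.hom (n + 1) (n + 2)).unop.hom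
        ((LinearMap.congr_fun (hd (n + 1)) x).trans hx)).trans (map_zero _)
    have e3 : ∀ a b : M.obj (SimplexCategory.mk (n + 1)), a + 0 + b = b + a := fun a b => by
      rw [add_zero]
      exact add_comm a b
    exact hc'.trans (Eq.trans (congrArg₂ (fun a b => a + b + x) e1 e2) (e3 _ _))
  rw [← key]
  refine mem_normCochains_succ.2 fun j hj => ?_
  exact LinearMap.congr_fun (congrArg (fun g : op (M.obj (SimplexCategory.mk n)) ⟶
    op (M.obj (SimplexCategory.mk (n + 1))) => g.unop.hom)
    (AlgebraicTopology.DoldKan.σ_comp_PInfty X (⟨j, hj⟩ : Fin (n + 1)))) x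

theorem normCochainComplex_d (n : ℕ) :
    (normCochainComplex M).d n (n + 1) = ModuleCat.ofHom (normD M n) := by
  simp only [normCochainComplex, CochainComplex.of_d]

theorem normCochainComplex_d_apply (n : ℕ) (x : normCochains M n) :
    ((normCochainComplex M).d n (n + 1)).hom x = normD M n x := by
  rw [normCochainComplex_d]
  rfl

/-- The projection of the complex of all cochains onto the normalized cochain complex. -/
noncomputable def normProjection :
    (AlgebraicTopology.alternatingCofaceMapComplex (ModuleCat.{u} k)).obj M ⟶
      normCochainComplex M :=
  CochainComplex.ofHom (fun n => ModuleCat.ofHom (toNormCochains M n)) (fun n => by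
    rw [alternatingCoface_d, normCochainComplex_d]
    exact ModuleCat.hom_ext (LinearMap.ext fun x => Subtype.ext (cosProj_coboundary n x).symm))

theorem normInclusion_normProjection : normInclusion M ≫ normProjection M = 𝟙 _ :=
  HomologicalComplex.hom_ext _ _ fun _ =>
    ModuleCat.hom_ext (LinearMap.ext fun x => toNormCochains_coe x)

/-- Injectivity in cohomology comes from the retraction `normProjection`, surjectivity from moving a
cocycle into the normalized cochains by a coboundary. -/
theorem quasiIso_normInclusion : QuasiIso (normInclusion M) := by
  have hr : ∀ n (x : (normCochainComplex M).X n),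
      ((normProjection M).f n).hom (((normInclusion M).f n).hom x) = x := fun n x =>
    toNormCochains_coe (M := M) x
  refine quasiIso_of_elements _ ?_ ?_ ?_ ?_
  · intro x _ h
    rw [← hr 0 x, h, map_zero]
  · intro p x y _ h
    refine ⟨((normProjection M).f p).hom y, ?_⟩
    rw [← hr _ x, h]
    exact hom_apply_of_comp_eq_comp ((normProjection M).comm p (p + 1)).symm y
  · intro x hx
    rw [alternatingCoface_d] at hx
    exact ⟨⟨x, Submodule.mem_top⟩, (normCochainComplex_d_apply M 0 _).trans
      (Subtype.ext hx), rfl⟩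
  · intro p x hx
    rw [alternatingCoface_d] at hx
    obtain ⟨y, hy⟩ := exists_normalized_cocycle M x hx
    refine ⟨⟨_, hy⟩, (normCochainComplex_d_apply M (p + 1) _).trans
      (Subtype.ext ?_), y, ?_⟩
    · refine (map_add (coboundary M (p + 1)) _ _).trans ?_
      rw [coboundary_coboundary, add_zero]
      exact hx
    · rw [alternatingCoface_d]
      rfl

theorem quasiIso_normProjection : QuasiIso (normProjection M) := by
  have := quasiIso_normInclusion M
  have h : QuasiIso (normInclusion M ≫ normProjection M) := by
    rw [normInclusion_normProjection]
    infer_instance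
  exact quasiIso_of_comp_left (normInclusion M) (normProjection M)

end NormalizedCochains

/-! ### Integration and primitives in a doubly contracted bigraded module -/

section Contraction

variable (k : Type u) [CommRing k]

/-- A bigraded module with commuting differentials `d`, `bd` and contractions of the rows and of the
columns, except for the column of index 0, which is concentrated in degree 0, where it is `k`. -/
structure ContractedForms where
  D : ℕ → ℕ → ModuleCat.{u} k
  d : ∀ p n, D p n ⟶ D (p + 1) n
  bd : ∀ p n, D p (n + 1) ⟶ D p n
  h : ∀ p n, D (p + 1) (n + 1) ⟶ D p (n + 1)
  s : ∀ p n, D p n ⟶ D p (n + 1)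
  ev : D 0 0 ⟶ ModuleCat.of k k
  one : ModuleCat.of k k ⟶ D 0 0
  d_d : ∀ p n, d p n ≫ d (p + 1) n = 0
  bd_bd : ∀ p n, bd p (n + 1) ≫ bd p n = 0
  bd_d : ∀ p n, bd p n ≫ d p n = d p (n + 1) ≫ bd (p + 1) n
  d_h : ∀ n, d 0 (n + 1) ≫ h 0 n = 𝟙 _
  h_d : ∀ p n, h p n ≫ d p (n + 1) + d (p + 1) (n + 1) ≫ h (p + 1) n = 𝟙 _
  s_bd : ∀ p, s p 0 ≫ bd p 0 = 𝟙 _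
  bd_s : ∀ p n, bd p n ≫ s p n + s p (n + 1) ≫ bd p (n + 1) = 𝟙 _
  id_eq_zero : ∀ p n, n < p → 𝟙 (D p n) = 0
  ev_one : ev ≫ one = 𝟙 _
  one_ev : one ≫ ev = 𝟙 _

namespace ContractedForms

variable {k} (C : ContractedForms k)

/-- The integral, a linear form on the forms of top degree. -/
noncomputable def integral : ∀ p, C.D p p ⟶ ModuleCat.of k k
  | 0 => C.ev
  | p + 1 => C.h p p ≫ C.bd p p ≫ integral p

theorem integral_succ (p : ℕ) : C.integral (p + 1) = C.h p p ≫ C.bd p p ≫ C.integral p := rfl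

/-- The formula of Stokes. -/
theorem stokes (p : ℕ) : C.d p (p + 1) ≫ C.integral (p + 1) = C.bd p p ≫ C.integral p := by
  induction p with
  | zero =>
    rw [integral_succ, ← Category.assoc, C.d_h, Category.id_comp]
  | succ p ih =>
    rw [integral_succ (p := p + 1)]
    -- By the homotopy formula the error is an integral of the form `∫ ∂_0 d`, which by induction is
    -- `∫ ∂_0 ∂_0 = 0`.
    have h1 : C.d (p + 1) (p + 2) ≫ C.h (p + 1) (p + 1) = 𝟙 _ - C.h p (p + 1) ≫ C.d p (p + 2) :=
      eq_sub_of_add_eq' (C.h_d p (p + 1))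
    have h2 : C.d p (p + 2) ≫ C.bd (p + 1) (p + 1) ≫ C.integral (p + 1) = 0 := by
      rw [← Category.assoc, ← C.bd_d, Category.assoc, ih, ← Category.assoc, C.bd_bd, Limits.zero_comp]
    rw [← Category.assoc, h1, Preadditive.sub_comp, Category.id_comp, Category.assoc, h2,
      Limits.comp_zero, sub_zero]

end ContractedForms

variable {k}

/-- Coefficients enter only through functors on modules. Additive functors preserve contractions,
although they need not preserve exact sequences. -/
theorem functor_map_map (Φ : ModuleCat.{u} k ⥤ ModuleCat.{u} k) {U V W : ModuleCat.{u} k} (f : U ⟶ V)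
    (g : V ⟶ W) (x : Φ.obj U) : (Φ.map g).hom ((Φ.map f).hom x) = (Φ.map (f ≫ g)).hom x := by
  rw [Φ.map_comp]
  rfl

theorem functor_map_id (Φ : ModuleCat.{u} k ⥤ ModuleCat.{u} k) {U : ModuleCat.{u} k} (x : Φ.obj U) :
    (Φ.map (𝟙 U)).hom x = x := by
  rw [Φ.map_id]
  rfl

theorem functor_map_zero (Φ : ModuleCat.{u} k ⥤ ModuleCat.{u} k) [Φ.Additive] {U V : ModuleCat.{u} k}
    (x : Φ.obj U) : (Φ.map (0 : U ⟶ V)).hom x = 0 := by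
  rw [Φ.map_zero]
  rfl

theorem functor_map_add (Φ : ModuleCat.{u} k ⥤ ModuleCat.{u} k) [Φ.Additive] {U V : ModuleCat.{u} k}
    (f g : U ⟶ V) (x : Φ.obj U) : (Φ.map (f + g)).hom x = (Φ.map f).hom x + (Φ.map g).hom x := by
  rw [Φ.map_add]
  rfl

theorem natTrans_app_map {Φ Φ' : ModuleCat.{u} k ⥤ ModuleCat.{u} k} (δ : Φ ⟶ Φ')
    {U V : ModuleCat.{u} k} (f : U ⟶ V) (x : Φ.obj U) :
    (δ.app V).hom ((Φ.map f).hom x) = (Φ'.map f).hom ((δ.app U).hom x) :=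
  hom_apply_of_comp_eq_comp (δ.naturality f) x

namespace ContractedForms

variable (C : ContractedForms k) {Φ : ℕ → ModuleCat.{u} k ⥤ ModuleCat.{u} k}
  (δ : ∀ n, Φ n ⟶ Φ (n + 1))

/-- The compatibility of a family with the two differentials of simplicial degree. -/
def IsFamily {p : ℕ} (x : ∀ n, (Φ n).obj (C.D p n)) : Prop :=
  ∀ n, ((δ n).app (C.D p n)).hom (x n) = ((Φ (n + 1)).map (C.bd p n)).hom (x (n + 1))

/-- In degree 0 a function on a simplex of positive dimension is `h d` of itself, so a closed one is
zero; on the point a function is determined by its integral. -/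
theorem eq_zero_of_closed [∀ n, (Φ n).Additive] (x : ∀ n, (Φ n).obj (C.D 0 n))
    (hd : ∀ n, ((Φ n).map (C.d 0 n)).hom (x n) = 0)
    (hI : ((Φ 0).map (C.integral 0)).hom (x 0) = 0) (n : ℕ) : x n = 0 := by
  rcases n with _ | n
  · rw [← functor_map_id (Φ 0) (x 0), ← C.ev_one, ← functor_map_map]
    exact (congrArg _ hI).trans (map_zero _)
  · rw [← functor_map_id (Φ (n + 1)) (x (n + 1)), ← C.d_h, ← functor_map_map, hd, map_zero]

theorem eq_zero_of_lt [∀ n, (Φ n).Additive] {p n : ℕ} (h : n < p) (x : (Φ n).obj (C.D p n)) :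
    x = 0 := by
  rw [← functor_map_id (Φ n) x, C.id_eq_zero p n h, functor_map_zero]

/-- Applying `h` in each column gives primitives `c` that need not form a family. The defect `e` is
closed and is a family with coefficients shifted by one; the sign in `-δ` arises because `δ ∂_0` and
`∂_0 δ` enter `e` with opposite signs. Its integral is `∫ ∂_0 h x = ∫ x = 0`, by the definition of
the integral. -/
theorem exists_columnwise_primitive [∀ n, (Φ n).Additive]
    (hδ : ∀ n U (x : (Φ n).obj U), ((δ (n + 1)).app U).hom (((δ n).app U).hom x) = 0) {p : ℕ}
    (x : ∀ n, (Φ n).obj (C.D (p + 1) n)) (hx : C.IsFamily δ x)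
    (hd : ∀ n, ((Φ n).map (C.d (p + 1) n)).hom (x n) = 0)
    (hI : ((Φ (p + 1)).map (C.integral (p + 1))).hom (x (p + 1)) = 0) :
    ∃ (c : ∀ n, (Φ n).obj (C.D p n)) (e : ∀ n, (Φ (n + 1)).obj (C.D p n)),
      (∀ n, ((Φ n).map (C.d p n)).hom (c n) = x n) ∧
      (∀ n, e n = ((Φ (n + 1)).map (C.bd p n)).hom (c (n + 1)) - ((δ n).app (C.D p n)).hom (c n)) ∧
      C.IsFamily (Φ := fun n => Φ (n + 1)) (fun n => -δ (n + 1)) e ∧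
      (∀ n, ((Φ (n + 1)).map (C.d p n)).hom (e n) = 0) ∧
      ((Φ (p + 1)).map (C.integral p)).hom (e p) = 0 ∧
      ∀ N, (∀ n ≥ N, x n = 0) → ∀ n ≥ N, c n = 0 ∧ e n = 0 := by
  obtain ⟨c, hc0, hcs⟩ : ∃ c : ∀ n, (Φ n).obj (C.D p n), c 0 = 0 ∧
      ∀ n, c (n + 1) = ((Φ (n + 1)).map (C.h p n)).hom (x (n + 1)) :=
    ⟨fun n => match n with
      | 0 => 0
      | n + 1 => ((Φ (n + 1)).map (C.h p n)).hom (x (n + 1)), rfl, fun _ => rfl⟩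
  have hc : ∀ n, ((Φ n).map (C.d p n)).hom (c n) = x n := by
    -- There is no contraction in the column of index 0, but forms of degree `p + 1` vanish there,
    -- so 0 is a primitive.
    rintro (_ | n)
    · rw [hc0, map_zero, C.eq_zero_of_lt (Nat.succ_pos p) (x 0)]
    · rw [hcs]
      have h := functor_map_id (Φ (n + 1)) (x (n + 1))
      rw [← C.h_d, functor_map_add, ← functor_map_map, ← functor_map_map (f := C.d _ _), hd,
        map_zero, add_zero] at h
      exact h
  refine ⟨c, fun n => ((Φ (n + 1)).map (C.bd p n)).hom (c (n + 1)) - ((δ n).app (C.D p n)).hom (c n),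
    hc, fun _ => rfl, fun n => ?_, fun n => ?_, ?_, fun N hN n hn => ?_⟩
  · change -((δ (n + 1)).app (C.D p n)).hom
        (((Φ (n + 1)).map (C.bd p n)).hom (c (n + 1)) - ((δ n).app (C.D p n)).hom (c n)) =
      ((Φ (n + 2)).map (C.bd p n)).hom (((Φ (n + 2)).map (C.bd p (n + 1))).hom (c (n + 2)) -
        ((δ (n + 1)).app (C.D p (n + 1))).hom (c (n + 1)))
    rw [map_sub, map_sub, hδ, sub_zero, natTrans_app_map,
      (functor_map_map (Φ (n + 2)) (C.bd p (n + 1)) (C.bd p n) (c (n + 2))).trans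
        (by rw [C.bd_bd, functor_map_zero]), zero_sub]
  · rw [map_sub, functor_map_map, C.bd_d, ← functor_map_map, hc, ← natTrans_app_map, hc, hx n, sub_self]
  · rw [map_sub, functor_map_map]
    -- There are no forms of degree `p + 1` on the `p`-simplex, so the term with `δ` does not
    -- contribute to the integral of `e`.
    have h0 : c p = 0 := by
      rcases p with _ | p
      · exact hc0
      · rw [hcs, C.eq_zero_of_lt (Nat.lt_succ_self (p + 1)) (x (p + 1)), map_zero]
    rw [h0, map_zero, map_zero, sub_zero, hcs, functor_map_map, ← C.integral_succ]
    exact hI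
  · have h : ∀ n ≥ N, c n = 0 := by
      rintro (_ | n) hn
      · exact hc0
      · rw [hcs, hN _ hn, map_zero]
    refine ⟨h n hn, ?_⟩
    change ((Φ (n + 1)).map (C.bd p n)).hom (c (n + 1)) - ((δ n).app (C.D p n)).hom (c n) = 0
    rw [h n hn, h (n + 1) (by omega), map_zero, map_zero, sub_zero]

/-- Staircase induction on the degree. The defect of the columnwise primitives has smaller degree,
hence either vanishes or has a primitive `f` that is a family; `f` is used to correct them. The
functors are quantified inside because each step shifts them. -/
theorem exists_primitive (p : ℕ) : ∀ (Φ : ℕ → ModuleCat.{u} k ⥤ ModuleCat.{u} k)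
    [∀ n, (Φ n).Additive] (δ : ∀ n, Φ n ⟶ Φ (n + 1))
    (_ : ∀ n U (x : (Φ n).obj U), ((δ (n + 1)).app U).hom (((δ n).app U).hom x) = 0)
    (x : ∀ n, (Φ n).obj (C.D (p + 1) n)) (_ : C.IsFamily δ x)
    (_ : ∀ n, ((Φ n).map (C.d (p + 1) n)).hom (x n) = 0)
    (_ : ((Φ (p + 1)).map (C.integral (p + 1))).hom (x (p + 1)) = 0),
    ∃ y : ∀ n, (Φ n).obj (C.D p n), C.IsFamily δ y ∧
      (∀ n, ((Φ n).map (C.d p n)).hom (y n) = x n) ∧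
      ∀ N, (∀ n ≥ N, x n = 0) → ∀ n ≥ N + p, y n = 0 := by
  induction p with
  | zero =>
    intro Φ _ δ hδ x hx hd hI
    obtain ⟨c, e, hc, he, -, h2, h3, h4⟩ := C.exists_columnwise_primitive δ hδ x hx hd hI
    refine ⟨c, fun n => ?_, hc, fun N hN n hn => (h4 N hN n hn).1⟩
    have h := he n
    rw [C.eq_zero_of_closed (Φ := fun n => Φ (n + 1)) e h2 h3 n] at h
    exact (sub_eq_zero.1 h.symm).symm
  | succ p ih =>
    intro Φ _ δ hδ x hx hd hI
    obtain ⟨c, e, hc, he, h1, h2, h3, h4⟩ := C.exists_columnwise_primitive δ hδ x hx hd hI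
    obtain ⟨f, hf, hdf, hN⟩ := ih (fun n => Φ (n + 1)) (fun n => -δ (n + 1)) (fun n U x => by
      rw [NatTrans.app_neg, NatTrans.app_neg, ModuleCat.hom_neg, ModuleCat.hom_neg,
        LinearMap.neg_apply, LinearMap.neg_apply, map_neg, hδ, neg_zero, neg_zero]) e h1 h2 h3
    -- Since `f` is a family for `-δ`, the relation `s ∂_0 + ∂_0 s = 1` gives `∂_0 s f_n - δ s
    -- f_(n-1) = f_n`. Subtracting `d s f` therefore removes the defect `e = d f` and leaves `d c`
    -- unchanged. The map `s` raises the simplicial index by one, which accounts for the growth of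
    -- the support bound.
    let y : ∀ n, (Φ n).obj (C.D (p + 1) n) := fun n => match n with
      | 0 => c 0
      | n + 1 => c (n + 1) - ((Φ (n + 1)).map (C.s p n ≫ C.d p (n + 1))).hom (f n)
    refine ⟨y, ?_, ?_, ?_⟩
    · have hs : ∀ n, C.s p n ≫ C.d p (n + 1) ≫ C.bd (p + 1) n = (C.s p n ≫ C.bd p n) ≫ C.d p n :=
        fun n => by rw [← C.bd_d, Category.assoc]
      rintro (_ | n)
      · change ((δ 0).app _).hom (c 0) = ((Φ 1).map (C.bd (p + 1) 0)).hom
          (c 1 - ((Φ 1).map (C.s p 0 ≫ C.d p 1)).hom (f 0))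
        rw [map_sub, functor_map_map, Category.assoc, hs, C.s_bd, Category.id_comp, hdf, he,
          sub_sub_cancel]
      · have hf' : -((δ (n + 1)).app (C.D p n)).hom (f n) =
            ((Φ (n + 2)).map (C.bd p n)).hom (f (n + 1)) := hf n
        have h0 := functor_map_id (Φ (n + 2)) (f (n + 1))
        rw [← C.bd_s, functor_map_add, ← functor_map_map (f := C.bd p n), ← hf', map_neg,
          ← natTrans_app_map] at h0
        have h' := congrArg ((Φ (n + 2)).map (C.d p (n + 1))).hom h0
        rw [map_add, map_neg, ← natTrans_app_map, functor_map_map, functor_map_map, hdf, he] at h'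
        change ((δ (n + 1)).app _).hom (c (n + 1) - ((Φ (n + 1)).map (C.s p n ≫ C.d p (n + 1))).hom
          (f n)) = ((Φ (n + 2)).map (C.bd (p + 1) (n + 1))).hom
          (c (n + 2) - ((Φ (n + 2)).map (C.s p (n + 1) ≫ C.d p (n + 2))).hom (f (n + 1)))
        rw [map_sub, map_sub, functor_map_map, Category.assoc, hs,
          eq_sub_of_add_eq' h']
        abel
    · rintro (_ | n)
      · exact hc 0
      · change ((Φ (n + 1)).map (C.d (p + 1) (n + 1))).hom (c (n + 1) - _) = _
        rw [map_sub, hc, functor_map_map, Category.assoc, C.d_d, Limits.comp_zero, functor_map_zero,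
          sub_zero]
    · intro N hN' n hn
      obtain ⟨n, rfl⟩ : ∃ m, n = m + 1 := ⟨n - 1, by omega⟩
      change c (n + 1) - _ = 0
      rw [(h4 N hN' (n + 1) (by omega)).1, hN N (fun m hm => (h4 N hN' m hm).2) n (by omega), map_zero,
        sub_zero]

end ContractedForms

end Contraction

/-! ### Contractions, evaluations and products on cubes -/

namespace Cube

variable {k : Type u} [CommRing k]

theorem hom_ext_single {n : ℕ} {V : Type*} [AddCommGroup V] [Module k V] {L L' : Cube k n →ₗ[k] V}
    (h : ∀ (g : Fin (n + 1) → Option ℤ) (A : Finset (Fin (n + 1))),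
      L (Finsupp.single (g, A) 1) = L' (Finsupp.single (g, A) 1)) (f : Cube k n) : L f = L' f := by
  suffices e : L = L' from LinearMap.congr_fun e f
  ext1 b
  ext1
  exact h b.1 b.2

/-- Identities such as the homotopy formula fail on the meaningless pairs with `g i = none` for some
`i ∈ A`; they are tested only on the basis elements that occur in `forms`. -/
theorem eq_of_mem_forms {n p : ℕ} {S : Set ℤ} {V : Type*} [AddCommGroup V] [Module k V]
    (L L' : Cube k n →ₗ[k] V)
    (h : ∀ (g : Fin (n + 1) → Option ℤ) (A : Finset (Fin (n + 1))), A.card = p →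
      (∀ i ∈ A, g i ≠ none) → L (Finsupp.single (g, A) 1) = L' (Finsupp.single (g, A) 1))
    {f : Cube k n} (hf : f ∈ forms k S p n) : L f = L' f := by
  have h' := map_mem_of_single (L - L') ⊥ (fun b h1 h2 _ => by
    rw [LinearMap.sub_apply, h b.1 b.2 h1 h2, sub_self]
    exact Submodule.zero_mem _) hf
  exact sub_eq_zero.1 ((Submodule.mem_bot k).1 h')

theorem mem_forms_single {n p : ℕ} {S : Set ℤ} {g : Fin (n + 1) → Option ℤ}
    {A : Finset (Fin (n + 1))} (h1 : A.card = p) (h2 : ∀ i ∈ A, g i ≠ none)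
    (h3 : ∀ i s, g i = some s → s ∈ S) : Finsupp.single (g, A) 1 ∈ forms k S p n :=
  Finsupp.single_mem_supported k _ ⟨h1, h2, h3⟩

/-- The maximum `x_(u j)` is `+∞` as soon as `y_j` is. -/
theorem top_pull {m n : ℕ} (u : Fin (m + 1) →o Fin (n + 1)) (j : Fin (m + 1)) (f : Cube k n) :
    top k j (pull k u f) = pull k u (top k (u j) f) := by
  refine hom_ext_single (L := top k j ∘ₗ pull k u) (L' := pull k u ∘ₗ top k (u j)) (fun g A => ?_) f
  simp only [LinearMap.comp_apply, pull_single, map_sum, top_single, Function.comp_apply]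
  split_ifs with h
  · rw [pull_single]
  · simp

section Injective

variable {m n : ℕ} {u : Fin (m + 1) →o Fin (n + 1)}

/-- For injective `u` each fibre has at most one element, so the sum that defines `pull` has one
term, or none when `A` meets the complement of the image. The operators on cubes below are compared
only with such maps, since normalization refers to faces. -/
theorem pull_single_image (hu : Function.Injective u) (g : Fin (n + 1) → Option ℤ)
    (B : Finset (Fin (m + 1))) :
    pull k u (Finsupp.single (g, B.image u) 1) = Finsupp.single (g ∘ u, B) 1 := by
  rw [pull_single, Finset.sum_eq_single B]
  · intro C hC h
    exact absurd (Finset.image_injective hu (Finset.mem_filter.1 hC).2.1) h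
  · intro h
    exact absurd (Finset.mem_filter.2
      ⟨Finset.mem_univ _, rfl, (Finset.card_image_of_injective B hu).symm⟩) h

theorem pull_single_eq_zero {g : Fin (n + 1) → Option ℤ} {A : Finset (Fin (n + 1))}
    {i : Fin (n + 1)} (hi : i ∈ A) (h : ∀ j, u j ≠ i) : pull k u (Finsupp.single (g, A) 1) = 0 := by
  rw [pull_single]
  refine Finset.sum_eq_zero fun B hB => ?_
  have hi' : i ∈ B.image u := by rwa [(Finset.mem_filter.1 hB).2.1]
  obtain ⟨j, -, hj⟩ := Finset.mem_image.1 hi'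
  exact absurd hj (h j)

theorem eq_image_or_exists (u : Fin (m + 1) →o Fin (n + 1)) (A : Finset (Fin (n + 1))) :
    (∃ B : Finset (Fin (m + 1)), A = B.image u) ∨ ∃ i ∈ A, ∀ j, u j ≠ i := by
  by_cases h : ∃ i ∈ A, ∀ j, u j ≠ i
  · exact Or.inr h
  · push Not at h
    refine Or.inl ⟨Finset.univ.filter fun j => u j ∈ A, ?_⟩
    ext i
    simp only [Finset.mem_image, Finset.mem_filter, Finset.mem_univ, true_and]
    constructor
    · intro hi
      obtain ⟨j, rfl⟩ := h i hi
      exact ⟨j, hi, rfl⟩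
    · rintro ⟨j, hj, rfl⟩
      exact hj

theorem signBelow_image_of_injective (hu : Function.Injective u) (B : Finset (Fin (m + 1)))
    (j : Fin (m + 1)) : signBelow k (B.image u) (u j) = signBelow k B j := by
  unfold signBelow
  rw [Finset.filter_image, Finset.card_image_of_injective _ hu]
  simp only [(u.monotone.strictMono_of_injective hu).lt_iff_lt]

end Injective

variable (k) in
/-- The contraction in the variable `x_i`: it replaces `ω_s` by `-Y_s` with the sign rule and kills
`1` and `Y_s`. -/
noncomputable def contract {n : ℕ} (i : Fin (n + 1)) : Cube k n →ₗ[k] Cube k n :=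
  Finsupp.linearCombination k fun b : CubeBasis n =>
    if i ∈ b.2 then -(signBelow k b.2 i • Finsupp.single (b.1, b.2.erase i) 1) else 0

theorem contract_single {n : ℕ} (i : Fin (n + 1)) (g : Fin (n + 1) → Option ℤ)
    (A : Finset (Fin (n + 1))) : contract k i (Finsupp.single (g, A) 1) =
    if i ∈ A then -(signBelow k A i • Finsupp.single (g, A.erase i) 1) else 0 := by
  simp [contract]

variable (k) in
/-- The evaluation `x_i = -∞`, as an operator on forms in all variables. -/
noncomputable def bottom {n : ℕ} (i : Fin (n + 1)) : Cube k n →ₗ[k] Cube k n :=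
  Finsupp.linearCombination k fun b : CubeBasis n =>
    if i ∈ b.2 then 0 else Finsupp.single (Function.update b.1 i none, b.2) 1

theorem bottom_single {n : ℕ} (i : Fin (n + 1)) (g : Fin (n + 1) → Option ℤ)
    (A : Finset (Fin (n + 1))) : bottom k i (Finsupp.single (g, A) 1) =
    if i ∈ A then 0 else Finsupp.single (Function.update g i none, A) 1 := by
  simp [bottom]

theorem signBelow_mul_self {n : ℕ} (A : Finset (Fin (n + 1))) (i : Fin (n + 1)) :
    signBelow k A i * signBelow k A i = 1 := by
  rw [signBelow, ← mul_pow, neg_mul_neg, one_mul, one_pow]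

theorem top_contract {n : ℕ} (i j : Fin (n + 1)) (f : Cube k n) :
    top k j (contract k i f) = contract k i (top k j f) := by
  refine hom_ext_single (L := top k j ∘ₗ contract k i) (L' := contract k i ∘ₗ top k j)
    (fun g A => ?_) f
  simp only [LinearMap.comp_apply, contract_single, top_single]
  split_ifs with h h' h'
  · rw [map_neg, map_smul, top_single, contract_single, if_pos h', if_pos h]
  · rw [map_neg, map_smul, top_single, if_neg h', smul_zero, neg_zero, map_zero]
  · rw [map_zero, contract_single, if_neg h]
  · rw [map_zero, map_zero]

theorem bottom_d {n : ℕ} (i : Fin (n + 1)) (f : Cube k n) :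
    bottom k i (d k n f) = d k n (bottom k i f) := by
  refine hom_ext_single (L := bottom k i ∘ₗ d k n) (L' := d k n ∘ₗ bottom k i)
    (fun g A => ?_) f
  simp only [LinearMap.comp_apply, d_single, map_neg, map_sum, map_smul, bottom_single]
  split_ifs with h
  · simp [h]
  · rw [d_single]
    congr 1
    rw [Finset.sum_filter, Finset.sum_filter]
    refine Finset.sum_congr rfl fun j _ => ?_
    by_cases hj : j = i
    · subst hj
      simp
    · simp [h, hj, Ne.symm hj]

theorem bottom_top_of_mem {n p : ℕ} {S : Set ℤ} (i : Fin (n + 1)) {f : Cube k n}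
    (hf : f ∈ forms k S p n) : bottom k i (top k i f) = top k i f := by
  refine eq_of_mem_forms (bottom k i ∘ₗ top k i) (top k i) (fun g A _ h2 => ?_) hf
  simp only [LinearMap.comp_apply, top_single]
  split_ifs with h
  · rw [bottom_single, if_neg (fun hi => h2 i hi h), ← show g i = none from h,
      Function.update_eq_self]
  · simp

/-- In the variable `x_i` this is the homotopy formula for `Y_s ↦ -ω_s` and `ω_s ↦ -Y_s`: only the
constant 1 survives at `+∞`. The terms that differentiate another variable cancel by the Koszul
signs. -/
theorem d_contract_add_of_mem {n p : ℕ} {S : Set ℤ} (i : Fin (n + 1)) {f : Cube k n}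
    (hf : f ∈ forms k S p n) :
    d k n (contract k i f) + contract k i (d k n f) = f - top k i f := by
  refine eq_of_mem_forms (d k n ∘ₗ contract k i + contract k i ∘ₗ d k n) (LinearMap.id - top k i)
    (fun g A _ h2 => ?_) hf
  simp only [LinearMap.add_apply, LinearMap.sub_apply, LinearMap.comp_apply, LinearMap.id_apply,
    d_single, map_neg, map_sum, map_smul, contract_single, top_single]
  by_cases hi : i ∈ A
  · rw [if_pos hi, if_neg (h2 i hi), sub_zero, map_neg, map_smul, d_single]
    simp only [Finset.mem_insert, hi, or_true, if_true]
    -- After the contraction the variable `x_i` can be differentiated again. This extra term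
    -- restores the form; the others cancel against the contraction of the differential.
    have hs : (Finset.univ.filter fun j => j ∉ A.erase i ∧ g j ≠ none) =
        insert i (Finset.univ.filter fun j => j ∉ A ∧ g j ≠ none) := by
      ext j
      by_cases hj : j = i
      · subst hj
        simp [h2 j hi]
      · simp [hj]
    rw [hs, Finset.sum_insert (by simp [hi]), Finset.insert_erase hi]
    have e1 : signBelow k (A.erase i) i = signBelow k A i := by
      have := signBelow_insert (k := k) (A.erase i) i i (by simp)
      rw [Finset.insert_erase hi] at this
      simpa using this.symm
    rw [smul_neg, neg_neg, smul_add, smul_smul, e1, signBelow_mul_self, one_smul, add_assoc,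
      Finset.smul_sum, ← Finset.sum_neg_distrib, ← Finset.sum_add_distrib, Finset.sum_eq_zero,
      add_zero]
    intro j hj
    simp only [Finset.mem_filter, Finset.mem_univ, true_and] at hj
    have hne : j ≠ i := fun h => hj.1 (h ▸ hi)
    have e2 : signBelow k (insert j A) i = (if j < i then -1 else 1) * signBelow k A i :=
      signBelow_insert A j i hj.1
    have e3 : signBelow k A j = (if i < j then -1 else 1) * signBelow k (A.erase i) j := by
      have := signBelow_insert (k := k) (A.erase i) i j (by simp)
      rwa [Finset.insert_erase hi] at this
    rw [e2, e3, Finset.erase_insert_of_ne hne, smul_neg, neg_neg, smul_smul, smul_smul, ← add_smul]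
    rcases lt_or_gt_of_ne hne with h | h
    · simp [h, h.not_gt, mul_comm]
    · simp [h, h.not_gt, mul_comm]
  · rw [if_neg hi, map_zero, zero_add]
    by_cases hg : g i = none
    · rw [if_pos hg, sub_self, Finset.sum_eq_zero, neg_zero]
      intro j hj
      simp only [Finset.mem_filter, Finset.mem_univ, true_and] at hj
      rw [if_neg, smul_zero]
      rw [Finset.mem_insert, not_or]
      exact ⟨fun h => hj.2 (h ▸ hg), hi⟩
    · rw [if_neg hg, sub_zero, Finset.sum_eq_single i]
      · rw [if_pos (Finset.mem_insert_self i A), Finset.erase_insert hi, signBelow_insert _ _ _ hi,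
          smul_neg, neg_neg, smul_smul]
        simp [signBelow_mul_self]
      · intro j _ hj
        rw [if_neg, smul_zero]
        rw [Finset.mem_insert, not_or]
        exact ⟨Ne.symm hj, hi⟩
      · intro h
        exact absurd (Finset.mem_filter.2 ⟨Finset.mem_univ _, hi, hg⟩) h

theorem contract_eq_zero_of_mem {n : ℕ} {S : Set ℤ} (i : Fin (n + 1)) {f : Cube k n}
    (hf : f ∈ forms k S 0 n) : contract k i f = 0 := by
  refine eq_of_mem_forms (contract k i) 0 (fun g A h1 _ => ?_) hf
  rw [Finset.card_eq_zero] at h1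
  rw [contract_single, h1, if_neg (Finset.notMem_empty i), LinearMap.zero_apply]

theorem contract_mem {n p : ℕ} {S : Set ℤ} (i : Fin (n + 1)) {f : Cube k n}
    (hf : f ∈ forms k S (p + 1) n) : contract k i f ∈ forms k S p n := by
  refine map_mem_of_single (contract k i) _ (fun b h1 h2 h3 => ?_) hf
  rw [contract_single]
  split_ifs with h
  · refine Submodule.neg_mem _ (Submodule.smul_mem _ _ (mem_forms_single ?_ ?_ h3))
    · rw [Finset.card_erase_of_mem h, h1, Nat.add_sub_cancel]
    · exact fun j hj => h2 j (Finset.mem_of_mem_erase hj)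
  · exact Submodule.zero_mem _

theorem bottom_mem {n p : ℕ} {S : Set ℤ} (i : Fin (n + 1)) {f : Cube k n}
    (hf : f ∈ forms k S p n) : bottom k i f ∈ forms k S p n := by
  refine map_mem_of_single (bottom k i) _ (fun b h1 h2 h3 => ?_) hf
  rw [bottom_single]
  split_ifs with h
  · exact Submodule.zero_mem _
  · refine mem_forms_single h1 (fun j hj => ?_) (fun j s hj => ?_)
    · have hne : j ≠ i := by
        rintro rfl
        exact h hj
      rw [Function.update_of_ne hne]
      exact h2 j hj
    · by_cases e : j = i
      · subst e
        simp at hj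
      · rw [Function.update_of_ne e] at hj
        exact h3 j s hj

/-- A form in `n + 1` variables that does not involve `x_i` has at most `n` factors of degree one.
-/
theorem top_eq_zero_of_lt {n p : ℕ} {S : Set ℤ} (h : n < p) (i : Fin (n + 1)) {f : Cube k n}
    (hf : f ∈ forms k S p n) : top k i f = 0 := by
  refine eq_of_mem_forms (top k i) 0 (fun g A h1 h2 => ?_) hf
  rw [top_single, LinearMap.zero_apply, if_neg]
  intro hg
  have hA : A ⊆ Finset.univ.erase i := fun j hj =>
    Finset.mem_erase.2 ⟨fun e => h2 j hj (e ▸ hg), Finset.mem_univ _⟩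
  have := Finset.card_le_card hA
  rw [Finset.card_erase_of_mem (Finset.mem_univ _), Finset.card_univ, Fintype.card_fin] at this
  omega

theorem top_eq_smul_of_mem {S : Set ℤ} {f : Cube k 0} (hf : f ∈ forms k S 0 0) :
    top k 0 f = f (fun _ => none, ∅) • Finsupp.single (fun _ => none, ∅) 1 := by
  refine eq_of_mem_forms (top k 0)
    ((Finsupp.lapply (fun _ => none, ∅)).smulRight (Finsupp.single (fun _ => none, ∅) 1))
    (fun g A h1 _ => ?_) hf
  obtain rfl := Finset.card_eq_zero.1 h1
  rw [top_single, LinearMap.smulRight_apply, Finsupp.lapply_apply]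
  split_ifs with h
  · have : g = fun _ => none := funext fun i => by
      rw [show i = 0 from Fin.fin_one_eq_zero i]
      exact h
    rw [this, Finsupp.single_eq_same, one_smul]
  · rw [Finsupp.single_eq_of_ne, zero_smul]
    intro e
    exact h (congrFun (congrArg Prod.fst e).symm 0)

section Injective

variable {m n : ℕ} {u : Fin (m + 1) →o Fin (n + 1)}

theorem pull_contract (hu : Function.Injective u) (j : Fin (m + 1)) (f : Cube k n) :
    pull k u (contract k (u j) f) = contract k j (pull k u f) := by
  refine hom_ext_single (L := pull k u ∘ₗ contract k (u j)) (L' := contract k j ∘ₗ pull k u)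
    (fun g A => ?_) f
  simp only [LinearMap.comp_apply, contract_single]
  rcases eq_image_or_exists u A with ⟨B, rfl⟩ | ⟨i, hi, h⟩
  · rw [pull_single_image hu, contract_single]
    simp only [hu.mem_finset_image]
    split_ifs with hj
    · rw [map_neg, map_smul, signBelow_image_of_injective hu, ← Finset.image_erase hu,
        pull_single_image hu]
    · rw [map_zero]
  · rw [pull_single_eq_zero hi h, map_zero]
    split_ifs with hj
    · rw [map_neg, map_smul, pull_single_eq_zero (Finset.mem_erase.2 ⟨(h j).symm, hi⟩) h, smul_zero,
        neg_zero]
    · rw [map_zero]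

theorem pull_bottom (hu : Function.Injective u) (j : Fin (m + 1)) (f : Cube k n) :
    pull k u (bottom k (u j) f) = bottom k j (pull k u f) := by
  refine hom_ext_single (L := pull k u ∘ₗ bottom k (u j)) (L' := bottom k j ∘ₗ pull k u)
    (fun g A => ?_) f
  simp only [LinearMap.comp_apply, bottom_single]
  rcases eq_image_or_exists u A with ⟨B, rfl⟩ | ⟨i, hi, h⟩
  · rw [pull_single_image hu, bottom_single]
    simp only [hu.mem_finset_image]
    split_ifs with hj
    · rw [map_zero]
    · rw [pull_single_image hu, Function.update_comp_eq_of_injective _ hu]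
  · rw [pull_single_eq_zero hi h, map_zero]
    split_ifs with hj
    · rw [map_zero]
    · rw [pull_single_eq_zero hi h]

theorem pull_bottom_of_forall_ne (hu : Function.Injective u) {i : Fin (n + 1)}
    (hi : ∀ j, u j ≠ i) (f : Cube k n) : pull k u (bottom k i f) = pull k u f := by
  refine hom_ext_single (L := pull k u ∘ₗ bottom k i) (L' := pull k u) (fun g A => ?_) f
  simp only [LinearMap.comp_apply, bottom_single]
  split_ifs with h
  · rw [map_zero, pull_single_eq_zero h hi]
  · rcases eq_image_or_exists u A with ⟨B, rfl⟩ | ⟨j, hj, h'⟩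
    · rw [pull_single_image hu, pull_single_image hu, Function.update_comp_eq_of_forall_ne _ _ hi]
    · rw [pull_single_eq_zero hj h', pull_single_eq_zero hj h']

/-- Pulling back along the map that misses `i` sets `x_i = -∞` and forgets the variable. Inserting
the factor 1 in its place is linear, so `bottom k i` factors through this pullback. -/
theorem bottom_eq_zero_of_pull {i : Fin (n + 1)} (hu : Function.Injective u) (hi : ∀ j, u j ≠ i)
    (hi' : ∀ l, l ≠ i → ∃ j, u j = l) {f : Cube k n} (hf : pull k u f = 0) : bottom k i f = 0 := by
  have e : bottom k i f = Finsupp.linearCombination k (fun b : CubeBasis m =>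
      (Finsupp.single (Function.extend u b.1 fun _ => none, b.2.image u) 1 : Cube k n)) (pull k u f) := by
    refine hom_ext_single (L := bottom k i) (L' := Finsupp.linearCombination k (fun b : CubeBasis m =>
      (Finsupp.single (Function.extend u b.1 fun _ => none, b.2.image u) 1 : Cube k n)) ∘ₗ pull k u) (fun g A => ?_) f
    simp only [LinearMap.comp_apply, bottom_single]
    rcases eq_image_or_exists u A with ⟨B, rfl⟩ | ⟨l, hl, h⟩
    · rw [if_neg, pull_single_image hu, Finsupp.linearCombination_single, one_smul]
      · congr 2
        funext l
        by_cases hl : l = i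
        · subst hl
          rw [Function.update_self]
          exact (Function.extend_apply' (g ∘ u) (fun _ => none) l fun ⟨j, hj⟩ => hi j hj).symm
        · obtain ⟨j, rfl⟩ := hi' l hl
          rw [Function.update_of_ne hl]
          exact (hu.extend_apply (g ∘ u) (fun _ => none) j).symm
      · rw [Finset.mem_image]
        rintro ⟨j, -, hj⟩
        exact hi j hj
    · obtain rfl : l = i := by
        by_contra hne
        obtain ⟨j, hj⟩ := hi' l hne
        exact h j hj
      rw [if_pos hl, pull_single_eq_zero hl h, map_zero]
  rw [e, hf, map_zero]

end Injective

variable (k) in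
/-- The product with `Y_t` in a new variable, which comes first. -/
noncomputable def prepend (t : ℤ) (n : ℕ) : Cube k n →ₗ[k] Cube k (n + 1) :=
  Finsupp.linearCombination k fun b : CubeBasis n =>
    Finsupp.single (Fin.cons (some t) b.1, b.2.image Fin.succ) 1

theorem prepend_single (t : ℤ) {n : ℕ} (g : Fin (n + 1) → Option ℤ) (A : Finset (Fin (n + 1))) :
    prepend k t n (Finsupp.single (g, A) 1) =
      Finsupp.single (Fin.cons (some t) g, A.image Fin.succ) 1 := by
  simp [prepend]

theorem prepend_mem {n p : ℕ} {S : Set ℤ} {t : ℤ} (ht : t ∈ S) {f : Cube k n}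
    (hf : f ∈ forms k S p n) : prepend k t n f ∈ forms k S p (n + 1) := by
  refine map_mem_of_single (prepend k t n) _ (fun b h1 h2 h3 => ?_) hf
  rw [prepend_single]
  refine mem_forms_single ?_ (fun i hi => ?_) (fun i s hs => ?_)
  · rw [Finset.card_image_of_injective _ (Fin.succ_injective _), h1]
  · obtain ⟨j, hj, rfl⟩ := Finset.mem_image.1 hi
    rw [Fin.cons_succ]
    exact h2 j hj
  · refine Fin.cases (fun h => ?_) (fun j h => ?_) i hs
    · rw [Fin.cons_zero] at h
      exact Option.some.inj h ▸ ht
    · rw [Fin.cons_succ] at h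
      exact h3 j s h

theorem top_zero_prepend (t : ℤ) {n : ℕ} (f : Cube k n) : top k 0 (prepend k t n f) = 0 := by
  refine hom_ext_single (L := top k 0 ∘ₗ prepend k t n) (L' := 0) (fun g A => ?_) f
  simp [prepend_single, top_single]

theorem top_succ_prepend (t : ℤ) {n : ℕ} (i : Fin (n + 1)) (f : Cube k n) :
    top k i.succ (prepend k t n f) = prepend k t n (top k i f) := by
  refine hom_ext_single (L := top k i.succ ∘ₗ prepend k t n) (L' := prepend k t n ∘ₗ top k i)
    (fun g A => ?_) f
  simp only [LinearMap.comp_apply, prepend_single, top_single, Fin.cons_succ]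
  split_ifs
  · rw [prepend_single]
  · rw [map_zero]

/-- `Y_t` equals 1 at `-∞`, whereas its value 0 at `+∞` gives `top_zero_prepend`. These two values
make the product with `Y_t` an additional degeneracy. -/
theorem pull_prepend_zero (t : ℤ) {n : ℕ} {u : Fin (n + 1) →o Fin (n + 2)} (hu : ∀ j, u j = j.succ)
    (f : Cube k n) : pull k u (prepend k t n f) = f := by
  refine hom_ext_single (L := pull k u ∘ₗ prepend k t n) (L' := LinearMap.id) (fun g A => ?_) f
  have hu' : (u : Fin (n + 1) → Fin (n + 2)) = Fin.succ := funext hu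
  have hi : Function.Injective u := hu' ▸ Fin.succ_injective _
  rw [LinearMap.comp_apply, prepend_single, ← hu', pull_single_image hi, LinearMap.id_apply]
  congr 2
  funext j
  rw [Function.comp_apply, hu, Fin.cons_succ]

theorem pull_prepend_succ (t : ℤ) {m n : ℕ} {u : Fin (m + 1) →o Fin (n + 1)}
    {v : Fin (m + 2) →o Fin (n + 2)} (hu : Function.Injective u) (hv0 : v 0 = 0)
    (hv : ∀ j, v j.succ = (u j).succ) (f : Cube k n) :
    pull k v (prepend k t n f) = prepend k t m (pull k u f) := by
  refine hom_ext_single (L := pull k v ∘ₗ prepend k t n) (L' := prepend k t m ∘ₗ pull k u)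
    (fun g A => ?_) f
  have hv' : Function.Injective v := by
    intro a b
    refine Fin.cases (Fin.cases (fun _ => rfl) (fun b h => ?_) b)
      (fun a => Fin.cases (fun h => ?_) (fun b h => ?_) b) a
    · rw [hv0, hv] at h
      exact absurd h.symm (Fin.succ_ne_zero _)
    · rw [hv0, hv] at h
      exact absurd h (Fin.succ_ne_zero _)
    · rw [hv, hv] at h
      rw [hu (Fin.succ_injective _ h)]
  simp only [LinearMap.comp_apply, prepend_single]
  rcases eq_image_or_exists u A with ⟨B, rfl⟩ | ⟨i, hi, h⟩
  · have e : (B.image u).image Fin.succ = (B.image Fin.succ).image v := by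
      rw [Finset.image_image, Finset.image_image]
      exact Finset.image_congr fun j _ => (hv j).symm
    rw [e, pull_single_image hv', pull_single_image hu, prepend_single]
    congr 2
    funext j
    refine Fin.cases ?_ (fun j => ?_) j
    · rw [Function.comp_apply, hv0, Fin.cons_zero, Fin.cons_zero]
    · rw [Function.comp_apply, hv, Fin.cons_succ, Fin.cons_succ, Function.comp_apply]
  · rw [pull_single_eq_zero hi h, map_zero,
      pull_single_eq_zero (Finset.mem_image_of_mem _ hi)]
    refine Fin.cases ?_ fun j => ?_
    · rw [hv0]
      exact (Fin.succ_ne_zero _).symm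
    · rw [hv]
      exact fun e => h j (Fin.succ_injective _ e)

end Cube

/-! ### Contraction of normalized chains by an additional degeneracy -/

section ExtraDegeneracy

variable {k : Type u} [CommRing k]

/-- An additional degeneracy of a simplicial module which contracts it to zero. -/
structure ExtraDegeneracy (A : SimplicialObject (ModuleCat.{u} k)) where
  map : ∀ n, A.obj (op (SimplexCategory.mk n)) →ₗ[k] A.obj (op (SimplexCategory.mk (n + 1)))
  face_zero : ∀ n x, (A.δ (n := n) ⟨0, by omega⟩).hom (map n x) = x
  face_one : ∀ x, (A.δ (n := 0) ⟨1, by omega⟩).hom (map 0 x) = 0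
  face_succ : ∀ n i (hi : i < n + 2) x, (A.δ (n := n + 1) ⟨i + 1, by omega⟩).hom (map (n + 1) x) =
    map n ((A.δ ⟨i, hi⟩).hom x)

namespace ExtraDegeneracy

variable {A : SimplicialObject (ModuleCat.{u} k)} (E : ExtraDegeneracy A)

theorem map_mem {n : ℕ} {x : A.obj (op (SimplexCategory.mk (n + 1)))}
    (hx : x ∈ normChains A (n + 1)) (h0 : (A.δ (n := n) ⟨0, by omega⟩).hom x = 0) :
    E.map (n + 1) x ∈ normChains A (n + 2) := by
  rw [mem_normChains_succ] at hx ⊢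
  rintro (_ | j) hj
  · rw [E.face_succ n 0 (by omega), h0, map_zero]
  · rw [E.face_succ n (j + 1) (by omega), hx j (by omega), map_zero]

theorem map_zero_mem (x : A.obj (op (SimplexCategory.mk 0))) : E.map 0 x ∈ normChains A 1 := by
  rw [mem_normChains_succ]
  intro j hj
  obtain rfl : j = 0 := by omega
  exact E.face_one x

theorem map_face_mem {n : ℕ} {x : A.obj (op (SimplexCategory.mk (n + 1)))}
    (hx : x ∈ normChains A (n + 1)) :
    E.map n ((A.δ (n := n) ⟨0, by omega⟩).hom x) ∈ normChains A (n + 1) := by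
  rcases n with _ | n
  · exact E.map_zero_mem _
  · refine E.map_mem (normBoundary A (n + 1) ⟨x, hx⟩).2 ?_
    rw [mem_normChains_succ] at hx
    exact (face_face (a := 0) (b := 0) le_rfl (by omega) x).symm.trans
      ((congrArg _ (hx 0 (by omega))).trans (map_zero _))

/-- The contraction before restriction to the normalized chains. -/
noncomputable def contractFun :
    ∀ n, A.obj (op (SimplexCategory.mk n)) →ₗ[k] A.obj (op (SimplexCategory.mk (n + 1)))
  | 0 => E.map 0
  | n + 1 => E.map (n + 1) - (A.σ ⟨0, by omega⟩).hom ∘ₗ E.map n ∘ₗ (A.δ ⟨0, by omega⟩).hom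

theorem contractFun_succ (n : ℕ) (x : A.obj (op (SimplexCategory.mk (n + 1)))) :
    E.contractFun (n + 1) x = E.map (n + 1) x -
      (A.σ ⟨0, by omega⟩).hom (E.map n ((A.δ ⟨0, by omega⟩).hom x)) := rfl

/-- Write `E` for the additional degeneracy. On a normalized chain `∂_1 E x = E ∂_0 x` need not
vanish; subtracting `σ_0 E ∂_0 x` removes this face and adds no higher one. -/
theorem contractFun_mem (n : ℕ) (x : A.obj (op (SimplexCategory.mk n))) (hx : x ∈ normChains A n) :
    E.contractFun n x ∈ normChains A (n + 1) := by
  rcases n with _ | n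
  · exact E.map_zero_mem x
  · have h := mem_normChains_succ.1 (E.map_face_mem hx)
    rw [mem_normChains_succ] at hx ⊢
    rintro (_ | j) hj
    · rw [contractFun_succ, map_sub, E.face_succ n 0 (by omega),
        face_degeneracy_succ (a := 0) (by omega), sub_self]
    · rw [contractFun_succ, map_sub, E.face_succ n (j + 1) (by omega), hx j (by omega), map_zero,
        face_degeneracy_of_gt (a := j + 1) (b := 0) (by omega) (by omega), h j (by omega), map_zero,
        sub_zero]

/-- The contraction of the normalized chains. -/
noncomputable def contract (n : ℕ) : normChains A n →ₗ[k] normChains A (n + 1) :=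
  LinearMap.restrict (E.contractFun n) (E.contractFun_mem n)

theorem normBoundary_contract_zero (x : normChains A 0) : normBoundary A 0 (E.contract 0 x) = x :=
  Subtype.ext (E.face_zero 0 x.1)

/-- The correction term turns `∂_0` of the contraction of `x` into `x - E ∂_0 x`. On `∂_0 x` it is
absent because `∂_0 ∂_0 x = ∂_0 ∂_1 x = 0`. -/
theorem contract_normBoundary_add (n : ℕ) (x : normChains A (n + 1)) :
    E.contract n (normBoundary A n x) + normBoundary A (n + 1) (E.contract (n + 1) x) = x := by
  refine Subtype.ext ?_
  change E.contractFun n ((A.δ (n := n) ⟨0, by omega⟩).hom x.1) +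
    (A.δ (n := n + 1) ⟨0, by omega⟩).hom (E.contractFun (n + 1) x.1) = x.1
  rw [contractFun_succ, map_sub, E.face_zero, face_degeneracy_self (a := 0) (by omega)]
  have h : E.contractFun n ((A.δ (n := n) ⟨0, by omega⟩).hom x.1) =
      E.map n ((A.δ ⟨0, by omega⟩).hom x.1) := by
    rcases n with _ | n
    · rfl
    · have hx := mem_normChains_succ.1 x.2
      have e : (A.δ (n := n) ⟨0, by omega⟩).hom ((A.δ (n := n + 1) ⟨0, by omega⟩).hom x.1) = 0 :=
        (face_face (a := 0) (b := 0) le_rfl (by omega) x.1).symm.trans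
          ((congrArg _ (hx 0 (by omega))).trans (map_zero _))
      rw [contractFun_succ, e, map_zero, map_zero, sub_zero]
  rw [h]
  abel

end ExtraDegeneracy

end ExtraDegeneracy

/-! ### The two contractions of normalized forms on simplices -/

section FormContractions

variable {k : Type u} [CommRing k] {S : Set ℤ}

theorem simplexPull_apply' {p m n : ℕ} (u : Fin (m + 1) →o Fin (n + 1))
    (f : simplexForms k S p n) (j : Fin (m + 1)) :
    (simplexPull k S p u f).1 j = Cube.pull k u (f.1 (u j)) := by
  rw [simplexPull_apply, Cube.top_pull, f.2.2.1]

/-- The coface map as a monotone map. -/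
abbrev cofaceHom {n : ℕ} (i : Fin (n + 2)) : Fin (n + 1) →o Fin (n + 2) :=
  (SimplexCategory.δ i).toOrderHom

theorem cofaceHom_apply {n : ℕ} (i : Fin (n + 2)) (j : Fin (n + 1)) :
    cofaceHom i j = i.succAbove j := rfl

theorem cofaceHom_injective {n : ℕ} (i : Fin (n + 2)) : Function.Injective (cofaceHom i) :=
  Fin.succAbove_right_injective

theorem mem_normChains_forms {p n : ℕ} {f : simplexForms k S p (n + 1)} :
    f ∈ normChains (simplicialForms k S p) (n + 1) ↔
      ∀ (i : Fin (n + 1)) (j : Fin (n + 1)),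
        Cube.pull k (cofaceHom i.succ) (f.1 (i.succ.succAbove j)) = 0 := by
  change _ ∈ (⨅ i : Fin (n + 1), LinearMap.ker ((simplicialForms k S p).δ i.succ).hom) ↔ _
  refine (Submodule.mem_iInf _).trans (forall_congr' fun i => ⟨fun h j => ?_, fun h => simplexForms_ext fun j => ?_⟩)
  · rw [← cofaceHom_apply, ← simplexPull_apply']
    exact congrArg (fun g : simplexForms k S p n => g.1 j) h
  · exact (simplexPull_apply' _ f j).trans (h j)

/-- The product with `Y_t` in a new first variable. -/
noncomputable def simplexPrepend {t : ℤ} (ht : t ∈ S) (p n : ℕ) :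
    simplexForms k S p n →ₗ[k] simplexForms k S p (n + 1) :=
  LinearMap.restrict (LinearMap.pi (Fin.cons (0 : (Fin (n + 1) → Cube k n) →ₗ[k] Cube k (n + 1))
    fun i => Cube.prepend k t n ∘ₗ LinearMap.proj i)) (by
    rintro f ⟨h1, h2, h3⟩
    refine ⟨Fin.cases ?_ fun i => ?_, Fin.cases ?_ fun i => ?_, Fin.cases (Fin.cases ?_ fun j => ?_)
      fun i => Fin.cases ?_ fun j => ?_⟩ <;>
    simp only [LinearMap.pi_apply, LinearMap.comp_apply, LinearMap.proj_apply, Fin.cons_zero,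
      Fin.cons_succ, LinearMap.zero_apply, map_zero, Cube.top_zero_prepend, Cube.top_succ_prepend]
    · exact Submodule.zero_mem _
    · exact Cube.prepend_mem ht (h1 i)
    · rw [h2]
    · rw [h3])

theorem simplexPrepend_zero {t : ℤ} (ht : t ∈ S) {p n : ℕ} (f : simplexForms k S p n) :
    (simplexPrepend ht p n f).1 0 = 0 := rfl

theorem simplexPrepend_succ {t : ℤ} (ht : t ∈ S) {p n : ℕ} (f : simplexForms k S p n)
    (i : Fin (n + 1)) : (simplexPrepend ht p n f).1 i.succ = Cube.prepend k t n (f.1 i) := rfl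

theorem simplexPull_prepend_zero {t : ℤ} (ht : t ∈ S) {p n : ℕ} (f : simplexForms k S p n) :
    simplexPull k S p (cofaceHom 0) (simplexPrepend ht p n f) = f := by
  refine simplexForms_ext fun j => ?_
  rw [simplexPull_apply', cofaceHom_apply, Fin.zero_succAbove, simplexPrepend_succ]
  exact Cube.pull_prepend_zero t (fun j => Fin.zero_succAbove j) (f.1 j)

/-- On the edge the face of index 1 keeps only the component `x_0 = +∞`, and there `Y_t` vanishes.
-/
theorem simplexPull_prepend_one {t : ℤ} (ht : t ∈ S) {p : ℕ} (f : simplexForms k S p 0) :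
    simplexPull k S p (cofaceHom 1) (simplexPrepend ht p 0 f) = 0 := by
  refine simplexForms_ext fun j => ?_
  obtain rfl : j = 0 := Fin.fin_one_eq_zero j
  rw [simplexPull_apply', cofaceHom_apply, Fin.one_succAbove_zero, simplexPrepend_zero, map_zero]
  rfl

theorem simplexPull_prepend_succ {t : ℤ} (ht : t ∈ S) {p n : ℕ} (i : Fin (n + 2))
    (f : simplexForms k S p (n + 1)) :
    simplexPull k S p (cofaceHom i.succ) (simplexPrepend ht p (n + 1) f) =
      simplexPrepend ht p n (simplexPull k S p (cofaceHom i) f) := by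
  refine simplexForms_ext fun j => ?_
  rw [simplexPull_apply', cofaceHom_apply]
  refine Fin.cases ?_ (fun j => ?_) j
  · rw [Fin.succ_succAbove_zero, simplexPrepend_zero, simplexPrepend_zero, map_zero]
  · rw [Fin.succ_succAbove_succ, simplexPrepend_succ, simplexPrepend_succ, simplexPull_apply',
      Cube.pull_prepend_succ t (cofaceHom_injective i) (Fin.succ_succAbove_zero i)
        (fun j => Fin.succ_succAbove_succ i j)]
    rfl

/-- The additional degeneracy of the simplicial module of forms. -/
noncomputable def formsExtraDegeneracy {t : ℤ} (ht : t ∈ S) (p : ℕ) :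
    ExtraDegeneracy (simplicialForms k S p) where
  map n := simplexPrepend ht p n
  face_zero _ f := simplexPull_prepend_zero ht f
  face_one f := simplexPull_prepend_one ht f
  face_succ _ i hi f := simplexPull_prepend_succ ht ⟨i, hi⟩ f

/-- The contraction of the de Rham complex of the simplex on a component of the family. -/
noncomputable def simplexContractFun (n : ℕ) (j : Fin (n + 2)) :
    (Fin (n + 2) → Cube k (n + 1)) →ₗ[k] Cube k (n + 1) :=
  Cube.contract k 0 ∘ₗ LinearMap.proj (φ := fun _ => Cube k (n + 1)) j +
    Cube.top k j ∘ₗ (LinearMap.id - Cube.bottom k 1) ∘ₗ Cube.contract k 1 ∘ₗ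
      LinearMap.proj (φ := fun _ => Cube k (n + 1)) 0

theorem simplexContractFun_apply (n : ℕ) (j : Fin (n + 2)) (f : Fin (n + 2) → Cube k (n + 1)) :
    simplexContractFun n j f = Cube.contract k 0 (f j) +
      Cube.top k j (Cube.contract k 1 (f 0) - Cube.bottom k 1 (Cube.contract k 1 (f 0))) := rfl

/-- The contraction of the de Rham complex of the simplex. -/
noncomputable def simplexContract (S : Set ℤ) (p n : ℕ) :
    simplexForms k S (p + 1) (n + 1) →ₗ[k] simplexForms k S p (n + 1) :=
  LinearMap.restrict (LinearMap.pi fun j => simplexContractFun n j) (by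
    rintro f ⟨h1, h2, h3⟩
    refine ⟨fun i => ?_, fun i => ?_, fun i j => ?_⟩ <;>
    simp only [LinearMap.pi_apply, simplexContractFun_apply]
    · exact Submodule.add_mem _ (Cube.contract_mem _ (h1 _)) (Cube.top_mem _ (Submodule.sub_mem _
        (Cube.contract_mem _ (h1 _)) (Cube.bottom_mem _ (Cube.contract_mem _ (h1 _)))))
    · rw [map_add, Cube.top_contract, h2, Cube.top_top]
    · rw [map_add, map_add, Cube.top_contract, Cube.top_contract, h3, Cube.top_comm])

theorem simplexContract_apply {p n : ℕ} (f : simplexForms k S (p + 1) (n + 1)) (j : Fin (n + 2)) :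
    (simplexContract S p n f).1 j = Cube.contract k 0 (f.1 j) +
      Cube.top k j (Cube.contract k 1 (f.1 0) - Cube.bottom k 1 (Cube.contract k 1 (f.1 0))) := rfl

/-- This is the vanishing of the face of index 1, read on the component `x_0 = +∞`; it lets the
second term of `simplexContractFun` cancel the boundary value of the first. -/
theorem bottom_one_eq_zero {p n : ℕ} {f : simplexForms k S p (n + 1)}
    (hf : f ∈ normChains (simplicialForms k S p) (n + 1)) : Cube.bottom k 1 (f.1 0) = 0 := by
  refine Cube.bottom_eq_zero_of_pull (u := cofaceHom 1) (cofaceHom_injective 1)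
    (fun j => Fin.succAbove_ne 1 j) (fun l hl => Fin.exists_succAbove_eq hl) ?_
  have h := mem_normChains_forms.1 hf 0 0
  rwa [Fin.succ_zero_eq_one, Fin.one_succAbove_zero] at h

/-- Positive faces fix the variable `x_0`, so they commute with its contraction. On the second term
the face of index 1 makes `1 - bottom k 1` vanish, and the higher faces also fix `x_1`, so the
vanishing of the corresponding face of `f` suffices. -/
theorem simplexContract_mem {p n : ℕ} {f : simplexForms k S (p + 1) (n + 1)}
    (hf : f ∈ normChains (simplicialForms k S (p + 1)) (n + 1)) :
    simplexContract S p n f ∈ normChains (simplicialForms k S p) (n + 1) := by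
  rw [mem_normChains_forms] at hf ⊢
  intro i j
  have hi0 : cofaceHom i.succ 0 = 0 := Fin.succ_succAbove_zero i
  have h1 : ∀ g : Cube k (n + 1), Cube.pull k (cofaceHom i.succ) (Cube.contract k 0 g) =
      Cube.contract k 0 (Cube.pull k (cofaceHom i.succ) g) := fun g => by
    conv_lhs => rw [← hi0]
    exact Cube.pull_contract (cofaceHom_injective _) 0 g
  rw [simplexContract_apply, map_add, h1, hf, map_zero, zero_add, ← cofaceHom_apply, ← Cube.top_pull]
  refine (congrArg _ ?_).trans (map_zero _)
  rw [map_sub, sub_eq_zero]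
  rcases n with _ | n
  · obtain rfl : i = 0 := Fin.fin_one_eq_zero i
    exact (Cube.pull_bottom_of_forall_ne (cofaceHom_injective _)
      (fun j => Fin.succAbove_ne 1 j) _).symm
  · by_cases hi : i = 0
    · subst hi
      exact (Cube.pull_bottom_of_forall_ne (cofaceHom_injective _)
        (fun j => Fin.succAbove_ne 1 j) _).symm
    · obtain ⟨i, rfl⟩ := Fin.exists_succ_eq.2 hi
      have hi1 : cofaceHom i.succ.succ 1 = 1 := by
        rw [cofaceHom_apply, ← Fin.succ_zero_eq_one, Fin.succ_succAbove_succ,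
          Fin.succ_succAbove_zero]
        rfl
      have h2 : ∀ g : Cube k (n + 2), Cube.pull k (cofaceHom i.succ.succ) (Cube.contract k 1 g) =
          Cube.contract k 1 (Cube.pull k (cofaceHom i.succ.succ) g) := fun g => by
        conv_lhs => rw [← hi1]
        exact Cube.pull_contract (cofaceHom_injective _) 1 g
      have h3 : ∀ g : Cube k (n + 2), Cube.pull k (cofaceHom i.succ.succ) (Cube.bottom k 1 g) =
          Cube.bottom k 1 (Cube.pull k (cofaceHom i.succ.succ) g) := fun g => by
        conv_lhs => rw [← hi1]
        exact Cube.pull_bottom (cofaceHom_injective _) 1 g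
      have h4 := hf i.succ 0
      rw [Fin.succ_succAbove_zero] at h4
      rw [h3, h2, h4, map_zero, map_zero]

/-- Contracting `x_0` leaves the error `top k 0 (f_j) = top k j (f_0)`. Contracting `x_1` recovers
`f_0 - top k 1 (f_0)`, and the factor `1 - bottom k 1` turns this into `f_0`: it removes the value
at `x_1 = +∞`, which is constant in `x_1`, and fixes `f_0`, whose value at `x_1 = -∞` is zero. The
simplex must have positive dimension, so that `x_1` exists. -/
theorem simplexContract_d {p n : ℕ} {f : simplexForms k S p (n + 1)}
    (hf : f ∈ normChains (simplicialForms k S p) (n + 1)) (j : Fin (n + 2)) :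
    Cube.d k (n + 1) (simplexContractFun n j f.1) +
      (simplexContract S p n (simplexD k S p (n + 1) f)).1 j = f.1 j := by
  have h0 := Cube.d_contract_add_of_mem 0 (f.2.1 j)
  have h1 := Cube.d_contract_add_of_mem 1 (f.2.1 0)
  have hb : Cube.bottom k 1 (Cube.d k (n + 1) (Cube.contract k 1 (f.1 0))) +
      Cube.bottom k 1 (Cube.contract k 1 (Cube.d k (n + 1) (f.1 0))) = -Cube.top k 1 (f.1 0) := by
    rw [← map_add, h1, map_sub, bottom_one_eq_zero hf, Cube.bottom_top_of_mem 1 (f.2.1 0), zero_sub]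
  rw [simplexContractFun_apply, simplexContract_apply, simplexD_apply, simplexD_apply, map_add,
    ← Cube.top_d, map_sub, ← Cube.bottom_d, add_add_add_comm, h0, ← map_add, sub_add_sub_comm, h1, hb,
    sub_neg_eq_add, sub_add_cancel, f.2.2.2 0 j, sub_add_cancel]

theorem simplexContractFun_eq_zero {n : ℕ} (f : simplexForms k S 0 (n + 1)) (j : Fin (n + 2)) :
    simplexContractFun n j f.1 = 0 := by
  rw [simplexContractFun_apply, Cube.contract_eq_zero_of_mem 0 (f.2.1 j),
    Cube.contract_eq_zero_of_mem 1 (f.2.1 0), map_zero, sub_zero, map_zero, add_zero]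

theorem simplexContract_d_zero {n : ℕ} {f : simplexForms k S 0 (n + 1)}
    (hf : f ∈ normChains (simplicialForms k S 0) (n + 1)) :
    simplexContract S 0 n (simplexD k S 0 (n + 1) f) = f := by
  refine simplexForms_ext fun j => ?_
  have h := simplexContract_d hf j
  rwa [simplexContractFun_eq_zero, map_zero, zero_add] at h

end FormContractions

/-! ### Normalized forms as a contracted bigraded module; existence of fundamental forms -/

section FormsInstance

variable (k : Type u) [CommRing k] {S : Set ℤ}

/-- The value of a function on the point. -/
noncomputable def pointValue (S : Set ℤ) : normChains (simplicialForms k S 0) 0 →ₗ[k] k :=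
  Finsupp.lapply (fun _ => none, ∅) ∘ₗ LinearMap.proj (φ := fun _ : Fin 1 => Cube k 0) 0 ∘ₗ
    (simplexForms k S 0 0).subtype ∘ₗ (normChains (simplicialForms k S 0) 0).subtype

variable {k}

theorem pointValue_smul (f : normChains (simplicialForms k S 0) 0) :
    pointValue k S f • (⟨oneForm k S, Submodule.mem_top⟩ : normChains (simplicialForms k S 0) 0) =
      f := by
  refine Subtype.ext (simplexForms_ext fun j => ?_)
  obtain rfl : j = 0 := Fin.fin_one_eq_zero j
  obtain ⟨⟨f, h1, h2, h3⟩, hf⟩ := f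
  exact (Cube.top_eq_smul_of_mem (h1 0)).symm.trans (h2 0)

theorem pointValue_one :
    pointValue k S (⟨oneForm k S, Submodule.mem_top⟩ : normChains (simplicialForms k S 0) 0) = 1 :=
  Finsupp.single_eq_same

variable (k)

/-- The normalized forms with support in a set that has an element. -/
noncomputable def contractedForms {t : ℤ} (ht : t ∈ S) : ContractedForms k where
  D p n := ModuleCat.of k (normChains (simplicialForms k S p) n)
  d p n := ModuleCat.ofHom (normChainsMap (formsD k S p) n)
  bd p n := ModuleCat.ofHom (normBoundary (simplicialForms k S p) n)
  h p n := ModuleCat.ofHom (LinearMap.restrict (simplexContract S p n)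
    fun _ hf => simplexContract_mem hf)
  s p n := ModuleCat.ofHom ((formsExtraDegeneracy ht p).contract n)
  ev := ModuleCat.ofHom (pointValue k S)
  one := ModuleCat.ofHom (LinearMap.toSpanSingleton k _ ⟨oneForm k S, Submodule.mem_top⟩)
  d_d p n := ModuleCat.hom_ext (LinearMap.ext fun f => Subtype.ext (simplexForms_ext fun j =>
    Cube.d_d _))
  bd_bd p n := ModuleCat.hom_ext (LinearMap.ext fun f => Subtype.ext
    ((face_face (a := 0) (b := 0) le_rfl (by omega) f.1).symm.trans
      ((congrArg _ (mem_normChains_succ.1 f.2 0 (by omega))).trans (map_zero _))))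
  bd_d p n := ModuleCat.hom_ext (normBoundary_map (formsD k S p) n).symm
  d_h n := ModuleCat.hom_ext (LinearMap.ext fun f => Subtype.ext (simplexContract_d_zero f.2))
  h_d p n := ModuleCat.hom_ext (LinearMap.ext fun f => Subtype.ext (simplexForms_ext fun j =>
    simplexContract_d f.2 j))
  s_bd p := ModuleCat.hom_ext (LinearMap.ext fun f =>
    (formsExtraDegeneracy ht p).normBoundary_contract_zero f)
  bd_s p n := ModuleCat.hom_ext (LinearMap.ext fun f =>
    (formsExtraDegeneracy ht p).contract_normBoundary_add n f)
  id_eq_zero p n h := ModuleCat.hom_ext (LinearMap.ext fun f => Subtype.ext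
    (simplexForms_ext fun j => by
      obtain ⟨⟨f, h1, h2, h3⟩, hf⟩ := f
      exact (h2 j).symm.trans (Cube.top_eq_zero_of_lt h j (h1 j))))
  ev_one := ModuleCat.hom_ext (LinearMap.ext fun f => pointValue_smul f)
  one_ev := ModuleCat.hom_ext (LinearMap.ext_ring
    ((congrArg _ (one_smul k _)).trans pointValue_one))

variable {k}

/-- Fundamental forms, obtained by contracting the differential of the preceding one. -/
noncomputable def contractedOmega {t : ℤ} (ht : t ∈ S) :
    ∀ p, normChains (simplicialForms k S p) (p + 1)
  | 0 => (formsExtraDegeneracy ht 0).contract 0 ⟨oneForm k S, Submodule.mem_top⟩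
  | p + 1 => (formsExtraDegeneracy ht (p + 1)).contract (p + 1)
      (normChainsMap (formsD k S p) (p + 1) (contractedOmega ht p))

theorem normBoundary_normChainsMap (p n : ℕ) (x : normChains (simplicialForms k S p) (n + 1)) :
    normBoundary (simplicialForms k S (p + 1)) n (normChainsMap (formsD k S p) (n + 1) x) =
      normChainsMap (formsD k S p) n (normBoundary (simplicialForms k S p) n x) :=
  LinearMap.congr_fun (normBoundary_map (formsD k S p) n) x

theorem normChainsMap_normChainsMap (p n : ℕ) (x : normChains (simplicialForms k S p) n) :
    normChainsMap (formsD k S (p + 1)) n (normChainsMap (formsD k S p) n x) = 0 :=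
  Subtype.ext (simplexForms_ext fun _ => Cube.d_d _)

/-- The contraction of a `∂_0`-cycle is a preimage of it. The form to be contracted is such a cycle
because its `∂_0` is the differential of a constant or of an exact form. -/
theorem normBoundary_contractedOmega {t : ℤ} (ht : t ∈ S) (p : ℕ) :
    normBoundary (simplicialForms k S (p + 1)) (p + 1) (contractedOmega ht (p + 1)) =
      normChainsMap (formsD k S p) (p + 1) (contractedOmega ht p) := by
  have h : normBoundary (simplicialForms k S (p + 1)) p
      (normChainsMap (formsD k S p) (p + 1) (contractedOmega ht p)) = 0 := by
    rw [normBoundary_normChainsMap]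
    induction p with
    | zero =>
      refine (congrArg _ ((formsExtraDegeneracy ht 0).normBoundary_contract_zero _)).trans
        (Subtype.ext (simplexForms_ext fun i => ?_))
      change Cube.d k 0 (Finsupp.single (fun _ => none, ∅) 1) = 0
      simp [Cube.d_single]
    | succ p ih =>
      have h := (formsExtraDegeneracy (k := k) ht (p + 1)).contract_normBoundary_add p
        (normChainsMap (formsD k S p) (p + 1) (contractedOmega ht p))
      rw [normBoundary_normChainsMap, ih, map_zero, zero_add] at h
      exact (congrArg _ h).trans (normChainsMap_normChainsMap _ _ _)
  have h' := (formsExtraDegeneracy (k := k) ht (p + 1)).contract_normBoundary_add p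
    (normChainsMap (formsD k S p) (p + 1) (contractedOmega ht p))
  rwa [h, map_zero, zero_add] at h'

/-- Fundamental forms exist. -/
theorem nonempty_fundamentalForms (hS : S.Nonempty) : Nonempty (FundamentalForms k S) := by
  obtain ⟨t, ht⟩ := hS
  exact ⟨{
    omega := fun p => (contractedOmega ht p).1
    face_succ := fun p i => mem_normChains_succ.1 (contractedOmega ht p).2 i.1 i.2
    face_zero_zero := (formsExtraDegeneracy ht 0).face_zero 0 _
    face_zero_succ := fun p => congrArg Subtype.val (normBoundary_contractedOmega ht p) }⟩

end FormsInstance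

/-! ### Leading terms and the criterion for a quasi-isomorphism -/

section Leading

variable {k : Type u} [CommRing k]

/-- Fundamental forms, as morphisms from `k`. -/
structure ContractedForms.Fundamental (C : ContractedForms k) where
  chi : ∀ p, ModuleCat.of k k ⟶ C.D p p
  omega : ∀ p, ModuleCat.of k k ⟶ C.D p (p + 1)
  chi_zero : chi 0 = C.one
  chi_succ : ∀ p, chi (p + 1) = omega p ≫ C.d p (p + 1)
  omega_bd : ∀ p, omega p ≫ C.bd p p = chi p

namespace ContractedForms.Fundamental

variable {C : ContractedForms k} (F : C.Fundamental)

theorem chi_d (p : ℕ) : F.chi p ≫ C.d p p = 0 := by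
  cases p with
  | zero => rw [← Category.comp_id (C.d 0 0), C.id_eq_zero 1 0 Nat.one_pos, Limits.comp_zero,
      Limits.comp_zero]
  | succ p => rw [F.chi_succ, Category.assoc, C.d_d, Limits.comp_zero]

theorem chi_bd (p : ℕ) : F.chi (p + 1) ≫ C.bd (p + 1) p = 0 := by
  rw [F.chi_succ, Category.assoc, ← C.bd_d, ← Category.assoc, F.omega_bd, F.chi_d]

/-- By Stokes `∫ χ_(p+1) = ∫ dω_(p+1) = ∫ ∂_0 ω_(p+1) = ∫ χ_p`, which reduces to the value of the
constant 1 at the point. -/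
theorem chi_integral (p : ℕ) : F.chi p ≫ C.integral p = 𝟙 _ := by
  induction p with
  | zero => rw [F.chi_zero]; exact C.one_ev
  | succ p ih => rw [F.chi_succ, Category.assoc, C.stokes, ← Category.assoc, F.omega_bd, ih]

variable {Φ : ℕ → ModuleCat.{u} k ⥤ ModuleCat.{u} k} (δ : ∀ n, Φ n ⟶ Φ (n + 1))

/-- Integration is a morphism of complexes from families of forms to the complex `Φ_n(k)`, by the
formula of Stokes and compatibility with the boundaries. -/
theorem delta_integral {p : ℕ} (x : ∀ n, (Φ n).obj (C.D p n)) (hx : C.IsFamily δ x) :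
    ((δ p).app _).hom (((Φ p).map (C.integral p)).hom (x p)) =
      ((Φ (p + 1)).map (C.integral (p + 1))).hom
        (((Φ (p + 1)).map (C.d p (p + 1))).hom (x (p + 1))) := by
  rw [natTrans_app_map, hx p, functor_map_map, functor_map_map, C.stokes]

/-- The family of `m ⊗ χ_p`. -/
noncomputable def leading (Φ : ℕ → ModuleCat.{u} k ⥤ ModuleCat.{u} k) (p : ℕ)
    (m : (Φ p).obj (ModuleCat.of k k)) : ∀ n, (Φ n).obj (C.D p n) :=
  Pi.single p (((Φ p).map (F.chi p)).hom m)

theorem leading_self (p : ℕ) (m : (Φ p).obj (ModuleCat.of k k)) :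
    F.leading Φ p m p = ((Φ p).map (F.chi p)).hom m := Pi.single_eq_same _ _

theorem leading_of_ne {p n : ℕ} (h : n ≠ p) (m : (Φ p).obj (ModuleCat.of k k)) :
    F.leading Φ p m n = 0 := Pi.single_eq_of_ne h _

theorem integral_leading {p : ℕ} (m : (Φ p).obj (ModuleCat.of k k)) :
    ((Φ p).map (C.integral p)).hom (F.leading Φ p m p) = m := by
  rw [F.leading_self, functor_map_map, F.chi_integral, functor_map_id]

/-- This is injectivity in cohomology: a primitive of the leading family integrates to a primitive
of `m`. -/
theorem eq_delta_of_leading {p : ℕ} (m : (Φ (p + 1)).obj (ModuleCat.of k k))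
    (y : ∀ n, (Φ n).obj (C.D p n)) (hy : C.IsFamily δ y)
    (h : F.leading Φ (p + 1) m (p + 1) = ((Φ (p + 1)).map (C.d p (p + 1))).hom (y (p + 1))) :
    m = ((δ p).app _).hom (((Φ p).map (C.integral p)).hom (y p)) := by
  rw [delta_integral δ y hy, ← h, F.integral_leading]

variable [∀ n, (Φ n).Additive]

theorem isFamily_leading {p : ℕ} (m : (Φ p).obj (ModuleCat.of k k))
    (hm : ((δ p).app _).hom m = 0) : C.IsFamily δ (F.leading Φ p m) := by
  intro n
  by_cases h : n = p
  · subst h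
    rw [F.leading_self, F.leading_of_ne (Nat.succ_ne_self n), natTrans_app_map, hm, map_zero, map_zero]
  · rw [F.leading_of_ne h, map_zero]
    by_cases h' : n + 1 = p
    · subst h'
      rw [F.leading_self, functor_map_map, F.chi_bd, functor_map_zero]
    · rw [F.leading_of_ne h', map_zero]

theorem d_leading {p : ℕ} (m : (Φ p).obj (ModuleCat.of k k)) (n : ℕ) :
    ((Φ n).map (C.d p n)).hom (F.leading Φ p m n) = 0 := by
  by_cases h : n = p
  · subst h
    rw [F.leading_self, functor_map_map, F.chi_d, functor_map_zero]
  · rw [F.leading_of_ne h, map_zero]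

/-- The coefficient is `∫ x_p`, a cocycle by Stokes; the remainder has integral zero because `∫ χ_p
= 1`. -/
theorem exists_leading {p : ℕ} (x : ∀ n, (Φ n).obj (C.D p n)) (hx : C.IsFamily δ x)
    (hd : ∀ n, ((Φ n).map (C.d p n)).hom (x n) = 0) :
    ∃ m : (Φ p).obj (ModuleCat.of k k), ((δ p).app _).hom m = 0 ∧
      C.IsFamily δ (fun n => x n - F.leading Φ p m n) ∧
      (∀ n, ((Φ n).map (C.d p n)).hom (x n - F.leading Φ p m n) = 0) ∧
      ((Φ p).map (C.integral p)).hom (x p - F.leading Φ p m p) = 0 := by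
  have hm : ((δ p).app _).hom (((Φ p).map (C.integral p)).hom (x p)) = 0 := by
    rw [delta_integral δ x hx, hd, map_zero]
  refine ⟨_, hm, fun n => ?_, fun n => ?_, ?_⟩
  · rw [map_sub, map_sub, hx, F.isFamily_leading δ _ hm]
  · rw [map_sub, hd, F.d_leading, sub_zero]
  · rw [map_sub, F.integral_leading, sub_self]

theorem exists_eq_leading (x : ∀ n, (Φ n).obj (C.D 0 n)) (hx : C.IsFamily δ x)
    (hd : ∀ n, ((Φ n).map (C.d 0 n)).hom (x n) = 0) :
    ∃ m : (Φ 0).obj (ModuleCat.of k k), ((δ 0).app _).hom m = 0 ∧ ∀ n, x n = F.leading Φ 0 m n := by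
  obtain ⟨m, hm, -, h2, h3⟩ := F.exists_leading δ x hx hd
  exact ⟨m, hm, fun n => sub_eq_zero.1
    (C.eq_zero_of_closed (fun n => x n - F.leading Φ 0 m n) h2 h3 n)⟩

theorem exists_eq_leading_add {p : ℕ}
    (hδ : ∀ n U (x : (Φ n).obj U), ((δ (n + 1)).app U).hom (((δ n).app U).hom x) = 0)
    (x : ∀ n, (Φ n).obj (C.D (p + 1) n)) (hx : C.IsFamily δ x)
    (hd : ∀ n, ((Φ n).map (C.d (p + 1) n)).hom (x n) = 0) :
    ∃ (m : (Φ (p + 1)).obj (ModuleCat.of k k)) (y : ∀ n, (Φ n).obj (C.D p n)),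
      ((δ (p + 1)).app _).hom m = 0 ∧ C.IsFamily δ y ∧
      (∀ n, x n = F.leading Φ (p + 1) m n + ((Φ n).map (C.d p n)).hom (y n)) ∧
      ((∃ N, ∀ n ≥ N, x n = 0) → ∃ N, ∀ n ≥ N, y n = 0) := by
  obtain ⟨m, hm, h1, h2, h3⟩ := F.exists_leading δ x hx hd
  obtain ⟨y, hy, hdy, hN⟩ := C.exists_primitive p Φ δ hδ _ h1 h2 h3
  -- The leading family is zero from `p + 2` on, and passing to the primitive extends the support
  -- bound by `p`.
  refine ⟨m, y, hm, hy, fun n => ?_, fun ⟨N, h⟩ => ⟨max N (p + 2) + p, hN _ fun n hn => ?_⟩⟩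
  · rw [hdy, add_sub_cancel]
  · rw [h n ((le_max_left _ _).trans hn), F.leading_of_ne (by
      have := (le_max_right _ _).trans hn
      omega), sub_zero]

/-- A morphism of complexes is a quasi-isomorphism if its target is a complex of families and if it
sends a cocycle `z` to the family of `z ⊗ χ_p`. -/
theorem quasiIso_of_leading
    (hδ : ∀ n U (x : (Φ n).obj U), ((δ (n + 1)).app U).hom (((δ n).app U).hom x) = 0)
    {K L : CochainComplex (ModuleCat.{u} k) ℕ} (f : K ⟶ L)
    (e : ∀ p, K.X p ≃ₗ[k] (Φ p).obj (ModuleCat.of k k))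
    (he : ∀ p z, e (p + 1) ((K.d p (p + 1)).hom z) = ((δ p).app _).hom (e p z))
    (i : ∀ p n, L.X p →ₗ[k] (Φ n).obj (C.D p n))
    (hinj : ∀ p (x y : L.X p), (∀ n, i p n x = i p n y) → x = y)
    (hi : ∀ p x, C.IsFamily δ (fun n => i p n x))
    (hd : ∀ p x n, i (p + 1) n ((L.d p (p + 1)).hom x) = ((Φ n).map (C.d p n)).hom (i p n x))
    (hlift : ∀ p (x : L.X (p + 1)) (y : ∀ n, (Φ n).obj (C.D p n)), C.IsFamily δ y →
      ((∃ N, ∀ n ≥ N, i (p + 1) n x = 0) → ∃ N, ∀ n ≥ N, y n = 0) → ∃ y' : L.X p, ∀ n, i p n y' = y n)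
    (hf : ∀ p (z : K.X p), (K.d p (p + 1)).hom z = 0 → ∀ n,
      i p n ((f.f p).hom z) = F.leading Φ p (e p z) n) :
    QuasiIso f := by
  have he' : ∀ p (m : (Φ p).obj (ModuleCat.of k k)), ((δ p).app _).hom m = 0 →
      ∃ z : K.X p, (K.d p (p + 1)).hom z = 0 ∧ e p z = m := by
    intro p m hm
    refine ⟨(e p).symm m, (e (p + 1)).injective ?_, (e p).apply_symm_apply m⟩
    rw [he, LinearEquiv.apply_symm_apply, hm, map_zero]
  have hd' : ∀ p (x : L.X p), (L.d p (p + 1)).hom x = 0 →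
      ∀ n, ((Φ n).map (C.d p n)).hom (i p n x) = 0 := fun p x hx n => by rw [← hd, hx, map_zero]
  refine quasiIso_of_elements f (fun z hz h => ?_) (fun p z y hz h => ?_) (fun x hx => ?_)
    (fun p x hx => ?_)
  · have h0 := hf 0 z hz 0
    rw [h, map_zero] at h0
    have h1 := F.integral_leading (Φ := Φ) (e 0 z)
    rw [← h0, map_zero] at h1
    exact (e 0).map_eq_zero_iff.1 h1.symm
  · have h0 := hf (p + 1) z hz (p + 1)
    rw [h, hd] at h0
    refine ⟨(e p).symm (((Φ p).map (C.integral p)).hom (i p p y)), (e (p + 1)).injective ?_⟩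
    rw [he, LinearEquiv.apply_symm_apply]
    exact F.eq_delta_of_leading δ (e (p + 1) z) (fun n => i p n y) (hi p y) h0.symm
  · obtain ⟨m, hm, h⟩ := F.exists_eq_leading δ _ (hi 0 x) (hd' 0 x hx)
    obtain ⟨z, hz, rfl⟩ := he' 0 m hm
    exact ⟨z, hz, hinj 0 _ _ fun n => (hf 0 z hz n).trans (h n).symm⟩
  · obtain ⟨m, y, hm, hy, h, hN⟩ := F.exists_eq_leading_add δ hδ _ (hi (p + 1) x) (hd' (p + 1) x hx)
    obtain ⟨z, hz, rfl⟩ := he' (p + 1) m hm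
    -- Finite support of the primitive is promised only relative to that of the cocycle. The
    -- criterion thus applies both to tensor coproducts and to simplicial maps, where no support
    -- condition is imposed.
    obtain ⟨y', hy'⟩ := hlift p x y hy hN
    refine ⟨z, hz, -y', hinj (p + 1) _ _ fun n => ?_⟩
    rw [hf (p + 1) z hz, map_neg, map_add, map_neg, hd, hy', h n, add_neg_cancel_right]

end ContractedForms.Fundamental

variable {S : Set ℤ} {t : ℤ}

/-- A choice of fundamental forms, as morphisms from `k`. -/
noncomputable def FundamentalForms.toFundamental (F : FundamentalForms k S) (ht : t ∈ S) :
    (contractedForms k ht).Fundamental where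
  chi p := ModuleCat.ofHom (LinearMap.toSpanSingleton k _ (F.chiNorm p))
  omega p := ModuleCat.ofHom (LinearMap.toSpanSingleton k _ (F.omegaNorm p))
  chi_zero := rfl
  chi_succ p := ModuleCat.hom_ext (LinearMap.ext_ring (by
    refine (one_smul k _).trans ?_
    exact (congrArg (normChainsMap (formsD k S p) (p + 1)) (one_smul k (F.omegaNorm p))).symm))
  omega_bd p := ModuleCat.hom_ext (LinearMap.ext_ring (by
    refine ((congrArg (normBoundary (simplicialForms k S p) p)
      (one_smul k (F.omegaNorm p))).trans ?_).trans (one_smul k _).symm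
    exact Subtype.ext ((F.face_zero p).trans (F.chiNorm_val p).symm)))

end Leading

/-! ### The morphism `θ` is a quasi-isomorphism -/

section ThetaQuasiIso

variable {k : Type u} [CommRing k] {S : Set ℤ} {t : ℤ} (M : CosimplicialObject (ModuleCat.{u} k))

instance tensorFunctor_additive (V : Type u) [AddCommGroup V] [Module k V] :
    (tensorFunctor k V).Additive where
  map_add := ModuleCat.hom_ext (LinearMap.lTensor_add _ _ _)

variable (k) in
/-- The functors `V ↦ N^n ⊗ V`, for the normalized cochains `N^n`. -/
noncomputable abbrev normFunctor (M : CosimplicialObject (ModuleCat.{u} k)) (n : ℕ) :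
    ModuleCat.{u} k ⥤ ModuleCat.{u} k :=
  tensorFunctor k (normCochains M n)

/-- Their coboundary. -/
noncomputable abbrev normFunctorD (M : CosimplicialObject (ModuleCat.{u} k)) (n : ℕ) :
    normFunctor k M n ⟶ normFunctor k M (n + 1) :=
  tensorFunctorMap (normD M n)

theorem normFunctorD_comp (n : ℕ) (U : ModuleCat.{u} k) (x : (normFunctor k M n).obj U) :
    ((normFunctorD M (n + 1)).app U).hom (((normFunctorD M n).app U).hom x) = 0 := by
  have e : normD M (n + 1) ∘ₗ normD M n = 0 := LinearMap.ext (normD_normD M n)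
  refine (LinearMap.rTensor_comp_apply (M := U) (g := normD M (n + 1)) (f := normD M n) x).symm.trans ?_
  rw [e, LinearMap.rTensor_zero]
  rfl

/-- On a cocycle the term with `ω_(p+1)` disappears; the criterion needs nothing about other
cochains beyond the fact that `θ` is a morphism. -/
theorem thetaFun_of_closed (F : FundamentalForms k S) (ht : t ∈ S) {p : ℕ} {z : normCochains M p}
    (hz : normD M p z = 0) (n : ℕ) :
    F.thetaFun M p z n = (F.toFundamental ht).leading (normFunctor k M) p (z ⊗ₜ[k] (1 : k)) n := by
  rw [F.thetaFun_apply, hz, TensorProduct.zero_tmul, Pi.single_zero, add_zero]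
  by_cases h : n = p
  · subst h
    rw [Pi.single_eq_same]
    refine Eq.trans ?_ ((F.toFundamental ht).leading_self (Φ := normFunctor k M) n
      (z ⊗ₜ[k] (1 : k))).symm
    exact congrArg (fun y => z ⊗ₜ[k] y) (one_smul k (F.chiNorm n)).symm
  · rw [Pi.single_eq_of_ne h]
    exact ((F.toFundamental ht).leading_of_ne (Φ := normFunctor k M) h (z ⊗ₜ[k] (1 : k))).symm

/-- The component of index `n` of an element of the normalized tensor coproduct. -/
noncomputable def normTensorEval (A : SimplicialObject (ModuleCat.{u} k)) (n : ℕ) :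
    normTensorCoproduct M A →ₗ[k] normCochains M n ⊗[k] normChains A n :=
  LinearMap.proj (φ := fun n => normCochains M n ⊗[k] normChains A n) n ∘ₗ
    (normTensorCoproduct M A).subtype

theorem quasiIso_theta (F : FundamentalForms k S) (hS : S.Nonempty) : QuasiIso (F.theta M) := by
  obtain ⟨t, ht⟩ := hS
  refine (F.toFundamental ht).quasiIso_of_leading (Φ := normFunctor k M) (normFunctorD M)
    (normFunctorD_comp M) (F.theta M) (fun p => (TensorProduct.rid k (normCochains M p)).symm)
    (fun p z => ?_)
    (fun p n => normTensorEval M (simplicialForms k S p) n)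
    (fun p x y h => Subtype.ext (funext h)) (fun p x => x.2.1) (fun p x n => ?_)
    (fun p x y hy hN => ⟨⟨y, hy, hN x.2.2⟩, fun n => rfl⟩) (fun p z hz n => ?_)
  · exact congrArg (fun y => y ⊗ₜ[k] (1 : k)) (normCochainComplex_d_apply M p z)
  · simp only [normTensorComplex, CochainComplex.of_d]
    rfl
  · exact thetaFun_of_closed M F ht ((normCochainComplex_d_apply M p z).symm.trans hz) n

end ThetaQuasiIso

/-! ### Lifting `θ` to the tensor coproduct -/

section Comparison

variable {k : Type u} [CommRing k] {S T : Set ℤ}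

/-- Injectivity of normalization in the form of an extensionality principle; it reduces naturality
of the lift to a computation with leading tensors. -/
theorem tensorCoproduct_ext {M : CosimplicialObject (ModuleCat.{u} k)}
    {A : SimplicialObject (ModuleCat.{u} k)} {w w' : tensorCoproduct M A}
    (h : ∀ n, TensorProduct.map (cosProj M n) (simpProj A n) (w.1 n) =
      TensorProduct.map (cosProj M n) (simpProj A n) (w'.1 n)) : w = w' :=
  normalize_injective (Subtype.ext (funext fun n => normTensorIncl_injective _ _
    ((normTensorIncl_normalize w n).trans ((h n).trans (normTensorIncl_normalize w' n).symm))))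

theorem normTensorIncl_normalizeIso_hom {M : CosimplicialObject (ModuleCat.{u} k)} {p : ℕ}
    (w : tensorCoproduct M (simplicialForms k S p)) (n : ℕ) :
    normTensorCoeff (((normalizeIso k S M).hom.f p).hom w) n =
      TensorProduct.map (cosProj M n) (simpProj (simplicialForms k S p) n) (w.1 n) :=
  normTensorIncl_normalize w n

namespace FundamentalForms

variable (F : FundamentalForms k S)

theorem simpProj_chi (p : ℕ) : simpProj (simplicialForms k S p) p (F.chi p) = F.chi p := by
  rw [← F.chiNorm_val]
  exact simpProj_of_mem (F.chiNorm p).2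

theorem simpProj_omega (p : ℕ) :
    simpProj (simplicialForms k S p) (p + 1) (F.omega p) = F.omega p :=
  simpProj_of_mem (F.omegaNorm p).2

variable {M : CosimplicialObject (ModuleCat.{u} k)}

/-- The projection commutes with the coboundary, and the fundamental forms are already normalized;
it makes no difference whether `m` or its leading tensor is projected. -/
theorem normTensorIncl_thetaFun (p : ℕ) (m : M.obj (SimplexCategory.mk p)) (n : ℕ) :
    normTensorIncl M (simplicialForms k S p) n n (F.thetaFun M p (toNormCochains M p m) n) =
      TensorProduct.map (cosProj M n) (simpProj (simplicialForms k S p) n)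
        (F.leadingTensor M p m n) := by
  rw [F.thetaFun_apply, leadingTensor, Pi.add_apply, Pi.add_apply, map_add, map_add]
  congr 1
  · by_cases h : n = p
    · subst h
      rw [Pi.single_eq_same, Pi.single_eq_same, TensorProduct.map_tmul, F.simpProj_chi]
      exact congrArg (fun y => cosProj M n m ⊗ₜ[k] y) (F.chiNorm_val n)
    · rw [Pi.single_eq_of_ne h, Pi.single_eq_of_ne h, map_zero, map_zero]
  · by_cases h : n = p + 1
    · subst h
      rw [Pi.single_eq_same, Pi.single_eq_same, TensorProduct.map_tmul, F.simpProj_omega,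
        cosProj_coboundary]
      rfl
    · rw [Pi.single_eq_of_ne h, Pi.single_eq_of_ne h, map_zero, map_zero]

theorem leadingTensor_of_mem {p : ℕ} {m : M.obj (SimplexCategory.mk p)} (hm : m ∈ normCochains M p)
    (n : ℕ) : TensorProduct.map (cosProj M n) (simpProj (simplicialForms k S p) n)
        (F.leadingTensor M p m n) = F.leadingTensor M p m n := by
  rw [leadingTensor, Pi.add_apply, map_add]
  congr 1
  · by_cases h : n = p
    · subst h
      rw [Pi.single_eq_same, TensorProduct.map_tmul, F.simpProj_chi, cosProj_of_mem hm]
    · rw [Pi.single_eq_of_ne h, map_zero]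
  · by_cases h : n = p + 1
    · subst h
      rw [Pi.single_eq_same, TensorProduct.map_tmul, F.simpProj_omega,
        cosProj_of_mem (coboundary_mem M p m hm)]
    · rw [Pi.single_eq_of_ne h, map_zero]

variable (M) in
/-- The morphism `θ` extended to all cochains, with values in the tensor coproduct. -/
noncomputable def thetaLift :
    (AlgebraicTopology.alternatingCofaceMapComplex (ModuleCat.{u} k)).obj M ⟶ tensorComplex k S M :=
  normProjection M ≫ F.theta M ≫ (normalizeIso k S M).inv

/-- The values of `thetaLift`. -/
noncomputable def thetaLiftFun {p : ℕ} (m : M.obj (SimplexCategory.mk p)) :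
    tensorCoproduct M (simplicialForms k S p) :=
  (normalizeEquiv M (simplicialForms k S p)).symm
    ⟨F.thetaFun M p (toNormCochains M p m), F.thetaFun_mem M p (toNormCochains M p m)⟩

theorem map_proj_thetaLiftFun {p : ℕ} (m : M.obj (SimplexCategory.mk p)) (n : ℕ) :
    TensorProduct.map (cosProj M n) (simpProj (simplicialForms k S p) n) ((F.thetaLiftFun m).1 n) =
      TensorProduct.map (cosProj M n) (simpProj (simplicialForms k S p) n)
        (F.leadingTensor M p m n) := by
  rw [← normTensorIncl_normalize, ← normTensorIncl_thetaFun]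
  exact congrArg (fun y : normTensorCoproduct M (simplicialForms k S p) =>
    normTensorIncl M (simplicialForms k S p) n n (y.1 n))
    ((normalizeEquiv M (simplicialForms k S p)).apply_symm_apply _)

theorem toNormQuotient_thetaLiftFun {p : ℕ} (m : M.obj (SimplexCategory.mk p)) (n : ℕ) :
    toNormQuotient M (simplicialForms k S p) n ((F.thetaLiftFun m).1 n) =
      toNormQuotient M (simplicialForms k S p) n (F.leadingTensor M p m n) := by
  rw [← toNormQuotient_proj, F.map_proj_thetaLiftFun, toNormQuotient_proj]

/-- For normalized `m` a projection in the simplicial variable alone suffices, because it agrees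
with the double projection on compatible families. This one-sided form is what survives evaluation
of cochains at a simplex. -/
theorem lTensor_simpProj_thetaLiftFun {p : ℕ} {m : M.obj (SimplexCategory.mk p)}
    (hm : m ∈ normCochains M p) (n : ℕ) :
    LinearMap.lTensor (M.obj (SimplexCategory.mk n)) (simpProj (simplicialForms k S p) n)
      ((F.thetaLiftFun m).1 n) = F.leadingTensor M p m n := by
  have hc := compatible_of_mem (F.thetaLiftFun m).2
  rw [← F.leadingTensor_of_mem hm, ← F.map_proj_thetaLiftFun, proj_eq_cosProj hc,
    cosProj_eq_simpProj hc]
  exact (LinearMap.congr_fun (simpProj_tensorBi M (simplicialForms k S p) n n) _).symm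

/-- This serves two purposes: morphisms of cosimplicial modules with unchanged forms, and
enlargement of the set of supports with unchanged module. -/
theorem map_leadingTensor {M' : CosimplicialObject (ModuleCat.{u} k)} (f : M ⟶ M')
    (F' : FundamentalForms k T) (h : S ⊆ T)
    (hω : ∀ p, ((formsIncl k h p).app (op (SimplexCategory.mk (p + 1)))).hom (F.omega p) = F'.omega p)
    (hχ : ∀ p, ((formsIncl k h p).app (op (SimplexCategory.mk p))).hom (F.chi p) = F'.chi p)
    {p : ℕ} (m : M.obj (SimplexCategory.mk p)) (n : ℕ) :
    TensorProduct.map (f.app (SimplexCategory.mk n)).hom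
      ((formsIncl k h p).app (op (SimplexCategory.mk n))).hom (F.leadingTensor M p m n) =
    F'.leadingTensor M' p ((f.app (SimplexCategory.mk p)).hom m) n := by
  rw [leadingTensor, leadingTensor, Pi.add_apply, Pi.add_apply, map_add]
  congr 1
  · by_cases h : n = p
    · subst h
      rw [Pi.single_eq_same, Pi.single_eq_same, TensorProduct.map_tmul, hχ]
    · rw [Pi.single_eq_of_ne h, Pi.single_eq_of_ne h, map_zero]
  · by_cases h : n = p + 1
    · subst h
      rw [Pi.single_eq_same, Pi.single_eq_same, TensorProduct.map_tmul, hω, coboundary_naturality]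
    · rw [Pi.single_eq_of_ne h, Pi.single_eq_of_ne h, map_zero]

theorem tensorCoproductMap_thetaLiftFun {M' : CosimplicialObject (ModuleCat.{u} k)} (f : M ⟶ M')
    (F' : FundamentalForms k T) (h : S ⊆ T)
    (hω : ∀ p, ((formsIncl k h p).app (op (SimplexCategory.mk (p + 1)))).hom (F.omega p) = F'.omega p)
    (hχ : ∀ p, ((formsIncl k h p).app (op (SimplexCategory.mk p))).hom (F.chi p) = F'.chi p)
    {p : ℕ} (m : M.obj (SimplexCategory.mk p)) :
    tensorCoproductMap f (formsIncl k h p) (F.thetaLiftFun m) =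
      F'.thetaLiftFun ((f.app (SimplexCategory.mk p)).hom m) := by
  refine tensorCoproduct_ext fun n => ?_
  rw [tensorCoproductMap_apply, map_proj_naturality, F.map_proj_thetaLiftFun, ← map_proj_naturality,
    F.map_leadingTensor f F' h hω hχ, F'.map_proj_thetaLiftFun]

/-- The same fundamental forms with a larger set of supports. -/
noncomputable def extend (h : S ⊆ T) : FundamentalForms k T where
  omega p := ((formsIncl k h p).app (op (SimplexCategory.mk (p + 1)))).hom (F.omega p)
  face_succ p i := (congrArg ((formsIncl k h p).app (op (SimplexCategory.mk p))).hom
    (F.face_succ p i)).trans (map_zero _)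
  face_zero_zero := congrArg ((formsIncl k h 0).app (op (SimplexCategory.mk 0))).hom F.face_zero_zero
  face_zero_succ p := congrArg ((formsIncl k h (p + 1)).app (op (SimplexCategory.mk (p + 1)))).hom
    (F.face_zero_succ p)

theorem extend_chi (h : S ⊆ T) (p : ℕ) :
    ((formsIncl k h p).app (op (SimplexCategory.mk p))).hom (F.chi p) = (F.extend h).chi p := by
  cases p <;> rfl

variable (k S) in
/-- The morphisms `thetaLift` as a natural transformation. -/
noncomputable def thetaNat (F : FundamentalForms k S) :
    AlgebraicTopology.alternatingCofaceMapComplex (ModuleCat.{u} k) ⟶ tensorComplexFunctor k S where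
  app M := F.thetaLift M
  naturality _ _ f := HomologicalComplex.hom_ext _ _ fun _ =>
    ModuleCat.hom_ext (LinearMap.ext fun m =>
      (F.tensorCoproductMap_thetaLiftFun f F (subset_refl S) (fun _ => rfl) (fun _ => rfl) m).symm)

theorem thetaLift_comp_tensorComplexMap (h : S ⊆ T) :
    F.thetaLift M ≫ tensorComplexMap h (𝟙 M) = (F.extend h).thetaLift M :=
  HomologicalComplex.hom_ext _ _ fun _ => ModuleCat.hom_ext (LinearMap.ext fun m =>
    F.tensorCoproductMap_thetaLiftFun (𝟙 M) (F.extend h) h (fun _ => rfl) (F.extend_chi h) m)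

theorem normInclusion_thetaLift :
    normInclusion M ≫ F.thetaLift M = F.theta M ≫ (normalizeIso k S M).inv := by
  rw [thetaLift, ← Category.assoc, normInclusion_normProjection, Category.id_comp]

theorem quasiIso_thetaLift (hS : S.Nonempty) : QuasiIso (F.thetaLift M) := by
  have := quasiIso_theta M F hS
  have := quasiIso_normProjection M
  rw [thetaLift]
  infer_instance

/-- The inclusion carries `Θ` for `S` to `Θ` for `T` with the same fundamental forms, so the
two-out-of-three property applies. -/
theorem quasiIso_tensorComplexMap (hS : S.Nonempty) (h : S ⊆ T) :
    QuasiIso (tensorComplexMap h (𝟙 M)) := by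
  obtain ⟨F⟩ := nonempty_fundamentalForms (k := k) hS
  have := F.quasiIso_thetaLift hS (M := M)
  have h' : QuasiIso (F.thetaLift M ≫ tensorComplexMap h (𝟙 M)) := by
    rw [F.thetaLift_comp_tensorComplexMap]
    exact (F.extend h).quasiIso_thetaLift (hS.mono h)
  exact quasiIso_of_comp_left (F.thetaLift M) _

theorem simpProj_evalTensor (X : SSet.{u}) (A : SimplicialObject (ModuleCat.{u} k)) (n : ℕ)
    (x : X.obj (op (SimplexCategory.mk n))) (w : ((cochains k).obj (op X)).obj (SimplexCategory.mk n)
      ⊗[k] A.obj (op (SimplexCategory.mk n))) :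
    simpProj A n (evalTensor X n x (A.obj (op (SimplexCategory.mk n))) w) =
      evalTensor X n x (A.obj (op (SimplexCategory.mk n))) (LinearMap.lTensor _ (simpProj A n) w) := by
  have e : simpProj A n ∘ₗ evalTensor X n x (A.obj (op (SimplexCategory.mk n))) =
      evalTensor X n x (A.obj (op (SimplexCategory.mk n))) ∘ₗ LinearMap.lTensor _ (simpProj A n) :=
    TensorProduct.ext' fun c a => map_smul (simpProj A n) _ a
  exact LinearMap.congr_fun e w

theorem evalTensor_single (X : SSet.{u}) (A : SimplicialObject (ModuleCat.{u} k)) (q : ℕ)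
    (c : ((cochains k).obj (op X)).obj (SimplexCategory.mk q))
    (a : A.obj (op (SimplexCategory.mk q))) (n : ℕ) (x : X.obj (op (SimplexCategory.mk n))) :
    evalTensor X n x (A.obj (op (SimplexCategory.mk n))) (Pi.single (M := fun n =>
      ((cochains k).obj (op X)).obj (SimplexCategory.mk n) ⊗[k] A.obj (op (SimplexCategory.mk n)))
      q (c ⊗ₜ[k] a) n) =
    Pi.single (M := fun n => X.obj (op (SimplexCategory.mk n)) → A.obj (op (SimplexCategory.mk n)))
      q (fun x => (show X.obj (op (SimplexCategory.mk q)) → k from c) x • a) n x := by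
  by_cases h : n = q
  · subst h
    rw [Pi.single_eq_same, Pi.single_eq_same]
    rfl
  · rw [Pi.single_eq_of_ne h, Pi.single_eq_of_ne h, map_zero]
    rfl

theorem evalTensor_leadingTensor (X : SSet.{u}) (p : ℕ)
    (c : X.obj (op (SimplexCategory.mk p)) → k) (n : ℕ) (x : X.obj (op (SimplexCategory.mk n))) :
    evalTensor X n x ((simplicialForms k S p).obj (op (SimplexCategory.mk n)))
      (F.leadingTensor ((cochains k).obj (op X)) p c n) = F.leadingForm X p c n x := by
  exact (map_add (evalTensor X n x _) (Pi.single (M := fun n =>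
    ((cochains k).obj (op X)).obj (SimplexCategory.mk n) ⊗[k]
      (simplicialForms k S p).obj (op (SimplexCategory.mk n))) p _ n) _).trans
    (congrArg₂ (· + ·) (evalTensor_single X _ p c (F.chi p) n x)
      (evalTensor_single X _ (p + 1) _ (F.omega p) n x))

theorem simpProj_coproductToMaps_thetaLiftFun (X : SSet.{u}) {p : ℕ}
    {c : X.obj (op (SimplexCategory.mk p)) → k} (hc : c ∈ normCochains ((cochains k).obj (op X)) p)
    (n : ℕ) (x : X.obj (op (SimplexCategory.mk n))) :
    simpProj (simplicialForms k S p) n ((coproductToMaps X (simplicialForms k S p)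
      (F.thetaLiftFun (M := (cochains k).obj (op X)) c)).1 n x) = F.leadingForm X p c n x := by
  rw [← F.evalTensor_leadingTensor,
    ← F.lTensor_simpProj_thetaLiftFun (M := (cochains k).obj (op X)) hc]
  exact simpProj_evalTensor X _ n x _

end FundamentalForms

end Comparison

/-! ### Simplicial maps to the forms -/

section SimplicialMaps

variable {k : Type u} [CommRing k]

/-- Functoriality of the normalized cochains. -/
noncomputable def normCochainsMap {M M' : CosimplicialObject (ModuleCat.{u} k)} (f : M ⟶ M') (n : ℕ) :
    normCochains M n →ₗ[k] normCochains M' n :=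
  LinearMap.restrict (f.app (SimplexCategory.mk n)).hom fun x hx => by
    rw [← cosProj_of_mem hx, ← cosProj_naturality]
    exact cosProj_mem n _

variable (k) in
/-- The normalized cochains of degree `n` as a functor. -/
noncomputable def normCochainsFunctor (n : ℕ) :
    CosimplicialObject (ModuleCat.{u} k) ⥤ ModuleCat.{u} k where
  obj M := ModuleCat.of k (normCochains M n)
  map f := ModuleCat.ofHom (normCochainsMap f n)

variable (k) in
/-- The coboundary as a natural transformation. -/
noncomputable def normCochainsD (n : ℕ) : normCochainsFunctor k n ⟶ normCochainsFunctor k (n + 1) where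
  app M := ModuleCat.ofHom (normD M n)
  naturality _ _ f := ModuleCat.hom_ext (LinearMap.ext fun x =>
    Subtype.ext (coboundary_naturality f n x.1))

variable (k) in
/-- The cosimplicial module `[n] ↦ V^(X_n)`, as a functor of `V`. -/
noncomputable def cochainsWith (X : SSet.{u}) :
    ModuleCat.{u} k ⥤ CosimplicialObject (ModuleCat.{u} k) where
  obj V :=
    { obj := fun Δ => ModuleCat.of k (X.obj (op Δ) → V)
      map := fun u => ModuleCat.ofHom (LinearMap.funLeft k V (X.map u.op))
      map_id := fun Δ => ModuleCat.hom_ext (LinearMap.ext fun c => funext fun x => by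
        simp [LinearMap.funLeft_apply])
      map_comp := fun u v => ModuleCat.hom_ext (LinearMap.ext fun c => funext fun x => by
        simp [LinearMap.funLeft_apply]) }
  map f := { app := fun Δ => ModuleCat.ofHom (f.hom.compLeft (X.obj (op Δ))) }

variable (k) in
/-- The functors sending `V` to the normalized cochains with values in `V`. -/
noncomputable abbrev normCochainsWith (X : SSet.{u}) (n : ℕ) : ModuleCat.{u} k ⥤ ModuleCat.{u} k :=
  cochainsWith k X ⋙ normCochainsFunctor k n

variable (k) in
/-- Their coboundary. -/
noncomputable abbrev normCochainsWithD (X : SSet.{u}) (n : ℕ) :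
    normCochainsWith k X n ⟶ normCochainsWith k X (n + 1) :=
  Functor.whiskerLeft (cochainsWith k X) (normCochainsD k n)

instance normCochainsWith_additive (X : SSet.{u}) (n : ℕ) : (normCochainsWith k X n).Additive where
  map_add := rfl

/-- The bifunctor `([n], [m]) ↦ A_m^(X_n)`. -/
noncomputable abbrev mapsBi (X : SSet.{u}) (A : SimplicialObject (ModuleCat.{u} k)) :
    SimplexCategory ⥤ SimplicialObject (ModuleCat.{u} k) :=
  (A ⋙ cochainsWith k X).flip

variable {X : SSet.{u}} {A : SimplicialObject (ModuleCat.{u} k)}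

/-- Evaluation at a fixed simplex of `X` is a morphism of simplicial modules, so the projection is
computed on values. -/
theorem simpProj_mapsBi (n m : ℕ) (φ : biObj (mapsBi X A) n m) (x : X.obj (op (SimplexCategory.mk n))) :
    (simpProj ((mapsBi X A).obj (SimplexCategory.mk n)) m φ :
      X.obj (op (SimplexCategory.mk n)) → A.obj (op (SimplexCategory.mk m))) x =
    simpProj A m ((φ : X.obj (op (SimplexCategory.mk n)) → A.obj (op (SimplexCategory.mk m))) x) :=
  (simpProj_naturality (A := (mapsBi X A).obj (SimplexCategory.mk n)) (A' := A)
    { app := fun Δ => ModuleCat.ofHom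
        (LinearMap.proj (φ := fun _ : X.obj (op (SimplexCategory.mk n)) => A.obj Δ) x) } m φ).symm

/-- Simplicial maps are the compatible families of the bifunctor `A_m^(X_n)`. The reconstruction
from the normalization thus applies to them directly, without passing through tensor products. -/
theorem compatible_simplicialMaps (φ : simplicialMaps X A) : Compatible (W := mapsBi X A) φ.1 :=
  fun m n u => funext fun x => φ.2 m n u x

theorem normChains_mapsBi {n m : ℕ} {φ : biObj (mapsBi X A) n m}
    (h : ∀ x, (φ : X.obj (op (SimplexCategory.mk n)) → A.obj (op (SimplexCategory.mk m))) x ∈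
      normChains A m) : φ ∈ normChains ((mapsBi X A).obj (SimplexCategory.mk n)) m := by
  have e : simpProj ((mapsBi X A).obj (SimplexCategory.mk n)) m φ = φ :=
    funext fun x => (simpProj_mapsBi n m φ x).trans (simpProj_of_mem (h x))
  rw [← e]
  exact simpProj_mem m φ

variable (X A) in
/-- The inclusion of the cochains with values in the normalized chains. -/
noncomputable def normChainsInclWith (m : ℕ) :
    (cochainsWith k X).obj (ModuleCat.of k (normChains A m)) ⟶ biRow (mapsBi X A) m :=
  (cochainsWith k X).map (ModuleCat.ofHom (normChains A m).subtype)

theorem normCochainsWith_ext {V : ModuleCat.{u} k} {n : ℕ} {f g : (normCochainsWith k X n).obj V}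
    (h : ∀ x : X.obj (op (SimplexCategory.mk n)),
      (f.1 : X.obj (op (SimplexCategory.mk n)) → V) x = (g.1 : _ → V) x) : f = g :=
  Subtype.ext (funext h)

/-- Projecting the values in `A` also normalizes the cochain in `X`, because the two projections
agree on a compatible family. -/
theorem mem_normCochains_simplicialMaps (φ : simplicialMaps X A) (n : ℕ) :
    (fun x => toNormChains A n (φ.1 n x) : X.obj (op (SimplexCategory.mk n)) → normChains A n) ∈
      normCochains ((cochainsWith k X).obj (ModuleCat.of k (normChains A n))) n := by
  rcases n with _ | n
  · exact Submodule.mem_top (R := k)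
      (M := ((cochainsWith k X).obj (ModuleCat.of k (normChains A 0))).obj (SimplexCategory.mk 0))
  · have h := cosProj_mem (M := biRow (mapsBi X A) (n + 1)) (n + 1) (φ.1 (n + 1))
    rw [cosProj_eq_simpProj (compatible_simplicialMaps φ)] at h
    refine mem_normCochains_succ.2 fun j hj => funext fun x => Subtype.ext ?_
    exact (simpProj_mapsBi (A := A) (n + 1) (n + 1) (φ.1 (n + 1)) _).symm.trans
      (congrFun (mem_normCochains_succ.1 h j hj) x)

variable (X A) in
/-- The passage from a simplicial map to its component of degree `n` modulo degenerate elements. -/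
noncomputable def normalizeMap (n : ℕ) : simplicialMaps X A →ₗ[k]
    (normCochainsWith k X n).obj (ModuleCat.of k (normChains A n)) where
  toFun φ := ⟨fun x => toNormChains A n (φ.1 n x), mem_normCochains_simplicialMaps φ n⟩
  map_add' _ _ := Subtype.ext (funext fun _ => map_add (toNormChains A n) _ _)
  map_smul' _ _ := Subtype.ext (funext fun _ => map_smul (toNormChains A n) _ _)

theorem normalizeMap_injective {φ ψ : simplicialMaps X A}
    (h : ∀ n, normalizeMap X A n φ = normalizeMap X A n ψ) : φ = ψ := by
  rw [← sub_eq_zero]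
  have hc := compatible_simplicialMaps (φ - ψ)
  refine Subtype.ext (funext fun n => eq_zero_of_cosProj_eq_zero hc (fun n => ?_) n)
  rw [cosProj_eq_simpProj hc]
  refine funext fun x => (simpProj_mapsBi n n _ x).trans ?_
  have h' : normalizeMap X A n (φ - ψ) = 0 := by rw [map_sub, h, sub_self]
  exact congrArg Subtype.val (congrFun (congrArg Subtype.val h') x)

theorem normalizeMap_boundary (φ : simplicialMaps X A) (n : ℕ) :
    ((normCochainsWithD k X n).app (ModuleCat.of k (normChains A n))).hom (normalizeMap X A n φ) =
      ((normCochainsWith k X (n + 1)).map (ModuleCat.ofHom (normBoundary A n))).hom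
        (normalizeMap X A (n + 1) φ) := by
  have hc := compatible_simplicialMaps φ
  have h := hc.biNormalized.boundary n
  rw [cosProj_eq_simpProj hc, cosProj_eq_simpProj hc] at h
  refine normCochainsWith_ext fun x => Subtype.ext ?_
  have e : ∀ m, ((normChainsInclWith X A m).app (SimplexCategory.mk m)).hom
      (normalizeMap X A m φ).1 = simpProj ((mapsBi X A).obj (SimplexCategory.mk m)) m (φ.1 m) :=
    fun m => funext fun x => (simpProj_mapsBi m m _ x).symm
  refine (congrFun (coboundary_naturality (normChainsInclWith X A n) n
    (normalizeMap X A n φ).1) x).symm.trans ?_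
  rw [e n]
  refine (congrFun h x).trans ?_
  exact congrArg (A.δ 0).hom (simpProj_mapsBi (n + 1) (n + 1) _ x)

/-- The recursive lift works degree by degree, so families of infinite support occur here, in
contrast to the tensor coproduct. -/
theorem exists_normalizeMap_eq
    (y : ∀ n, (normCochainsWith k X n).obj (ModuleCat.of k (normChains A n)))
    (hy : ∀ n, ((normCochainsWithD k X n).app (ModuleCat.of k (normChains A n))).hom (y n) =
      ((normCochainsWith k X (n + 1)).map (ModuleCat.ofHom (normBoundary A n))).hom (y (n + 1))) :
    ∃ φ : simplicialMaps X A, ∀ n, normalizeMap X A n φ = y n := by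
  let y' : ∀ n, biObj (mapsBi X A) n n := fun n => fun x =>
    ((y n).1 : X.obj (op (SimplexCategory.mk n)) → normChains A n) x
  have hy' : BiNormalized (mapsBi X A) y' := by
    refine ⟨fun n => (normCochainsMap (normChainsInclWith X A n) n (y n)).2,
      fun n => normChains_mapsBi fun x => (((y n).1 :
        X.obj (op (SimplexCategory.mk n)) → normChains A n) x).2, fun n => ?_⟩
    refine (coboundary_naturality (normChainsInclWith X A n) n (y n).1).trans ?_
    exact congrArg (fun z : (normCochainsWith k X (n + 1)).obj (ModuleCat.of k (normChains A n)) =>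
      ((normChainsInclWith X A n).app (SimplexCategory.mk (n + 1))).hom z.1) (hy n)
  have hc := liftFamily_compatible hy'
  refine ⟨⟨liftFamily y', fun m n u x => congrFun (hc m n u) x⟩, fun n =>
    normCochainsWith_ext fun x => Subtype.ext ?_⟩
  exact (simpProj_mapsBi n n _ x).symm.trans (congrFun (simpProj_liftFamily hy' n) x)

variable {S : Set ℤ}

/-- The morphism of `thetaLift` followed by the comparison with simplicial maps. -/
noncomputable def FundamentalForms.thetaMaps (F : FundamentalForms k S) (X : SSet.{u}) :
    (AlgebraicTopology.alternatingCofaceMapComplex (ModuleCat.{u} k)).obj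
      ((cochains k).obj (op X)) ⟶ mapComplex k S X :=
  F.thetaLift ((cochains k).obj (op X)) ≫ (coproductComparison k S).app (op X)

theorem mapComplex_d_apply (p : ℕ) (φ : simplicialMaps X (simplicialForms k S p)) :
    ((mapComplex k S X).d p (p + 1)).hom φ = simplicialMapsMap (𝟙 X) (formsD k S p) φ := by
  simp only [mapComplex, CochainComplex.of_d]
  rfl

theorem FundamentalForms.leadingForm_of_closed (F : FundamentalForms k S) {p : ℕ}
    {c : X.obj (op (SimplexCategory.mk p)) → k}
    (hc : coboundary ((cochains k).obj (op X)) p c = 0) (n : ℕ)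
    (x : X.obj (op (SimplexCategory.mk n))) :
    F.leadingForm X p c n x = Pi.single (M := fun n => X.obj (op (SimplexCategory.mk n)) →
      (simplicialForms k S p).obj (op (SimplexCategory.mk n))) p (fun x => c x • F.chi p) n x := by
  rw [leadingForm, hc, Pi.add_apply, Pi.add_apply]
  refine (congrArg₂ (· + ·) rfl ?_).trans (add_zero _)
  by_cases h : n = p + 1
  · subst h
    rw [Pi.single_eq_same]
    exact zero_smul k (F.omega p)
  · rw [Pi.single_eq_of_ne h]
    rfl

/-- The criterion is applied with normalized cochains valued in `V` in place of `N^n ⊗ V`. For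
infinite `X` these differ, but on cocycles the leading terms are the same. -/
theorem quasiIso_normInclusion_thetaMaps (F : FundamentalForms k S) (hS : S.Nonempty) :
    QuasiIso (normInclusion _ ≫ F.thetaMaps X) := by
  obtain ⟨t, ht⟩ := hS
  refine (F.toFundamental ht).quasiIso_of_leading (Φ := normCochainsWith k X) (normCochainsWithD k X)
    (fun n U x => Subtype.ext (coboundary_coboundary _ n x.1)) _
    (fun p => LinearEquiv.refl k (normCochains ((cochains k).obj (op X)) p))
    (fun p z => normCochainComplex_d_apply _ p z)
    (fun p n => normalizeMap X (simplicialForms k S p) n)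
    (fun p x y h => normalizeMap_injective h) (fun p x n => normalizeMap_boundary x n)
    (fun p x n => ?_) (fun p x y hy _ => exists_normalizeMap_eq y hy) (fun p z hz n => ?_)
  · refine (congrArg (normalizeMap X (simplicialForms k S (p + 1)) n)
      (mapComplex_d_apply p x)).trans (normCochainsWith_ext fun x' => Subtype.ext ?_)
    exact simpProj_naturality (formsD k S p) n _
  · have h0 : coboundary ((cochains k).obj (op X)) p z.1 = 0 :=
      congrArg Subtype.val ((normCochainComplex_d_apply _ p z).symm.trans hz)
    refine normCochainsWith_ext fun x => Subtype.ext ?_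
    refine (F.simpProj_coproductToMaps_thetaLiftFun X z.2 n x).trans
      ((F.leadingForm_of_closed h0 n x).trans ?_)
    by_cases h : n = p
    · subst h
      rw [Pi.single_eq_same]
      refine Eq.trans ?_ (congrArg (fun y : (normCochainsWith k X n).obj ((contractedForms k ht).D n n) =>
        ((y.1 : X.obj (op (SimplexCategory.mk n)) → normChains (simplicialForms k S n) n) x).1)
        ((F.toFundamental ht).leading_self (Φ := normCochainsWith k X) n z).symm)
      exact congrArg (fun y => (_ : k) • y) (F.chiNorm_val n).symm
    · rw [Pi.single_eq_of_ne h]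
      exact (congrArg (fun y : (normCochainsWith k X n).obj ((contractedForms k ht).D p n) =>
        ((y.1 : X.obj (op (SimplexCategory.mk n)) → normChains (simplicialForms k S p) n) x).1)
        ((F.toFundamental ht).leading_of_ne (Φ := normCochainsWith k X) h z).symm)

theorem quasiIso_thetaMaps (F : FundamentalForms k S) (hS : S.Nonempty) :
    QuasiIso (F.thetaMaps X) := by
  have := quasiIso_normInclusion ((cochains k).obj (op X))
  have := quasiIso_normInclusion_thetaMaps (X := X) F hS
  exact quasiIso_of_comp_left (normInclusion _) (F.thetaMaps X)

/-- The comparison map is not analysed by itself: it lies between two quasi-isomorphisms that start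
from the cochains. -/
theorem quasiIso_coproductComparison (F : FundamentalForms k S) (hS : S.Nonempty) :
    QuasiIso ((coproductComparison k S).app (op X)) := by
  have := F.quasiIso_thetaLift hS (M := (cochains k).obj (op X))
  have h : QuasiIso (F.thetaLift _ ≫ (coproductComparison k S).app (op X)) :=
    quasiIso_thetaMaps F hS
  exact quasiIso_of_comp_left (F.thetaLift ((cochains k).obj (op X))) _

end SimplicialMaps

end QuasiComm

/-! ### The main theorem -/

theorem mainTheorem3 (k : Type u) [CommRing k] (S : Set ℤ) (hS : S.Nonempty) :
    Nonempty (FundamentalForms k S) ∧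
    (∀ F : FundamentalForms k S,
      (∀ M : CosimplicialObject (ModuleCat.{u} k), QuasiIso (F.theta M)) ∧
      ∃ (ν : ∀ M : CosimplicialObject (ModuleCat.{u} k),
            tensorComplex k S M ≅ normTensorComplex k S M)
        (Θ : AlgebraicTopology.alternatingCofaceMapComplex (ModuleCat.{u} k) ⟶
            tensorComplexFunctor k S)
        (Ψ : cochains k ⋙ AlgebraicTopology.alternatingCofaceMapComplex (ModuleCat.{u} k) ⟶
            mapComplexFunctor k S),
        (∀ (M : CosimplicialObject (ModuleCat.{u} k)) (p : ℕ) (w : (tensorComplex k S M).X p)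
            (n : ℕ),
          toNormQuotient M (simplicialForms k S p) n (tensorCoeff w n) =
            toNormQuotient M (simplicialForms k S p) n
              (normTensorCoeff (((ν M).hom.f p).hom w) n)) ∧
        (∀ M : CosimplicialObject (ModuleCat.{u} k),
          normInclusion M ≫ Θ.app M = F.theta M ≫ (ν M).inv) ∧
        (∀ (M : CosimplicialObject (ModuleCat.{u} k)) (p : ℕ) (m : M.obj (SimplexCategory.mk p))
            (n : ℕ),
          toNormQuotient M (simplicialForms k S p) n (tensorCoeff (((Θ.app M).f p).hom m) n) =
            toNormQuotient M (simplicialForms k S p) n (F.leadingTensor M p m n)) ∧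
        (∀ (X : SSet.{u}) (p : ℕ) (c : X.obj (op (SimplexCategory.mk p)) → k),
          c ∈ normCochains ((cochains k).obj (op X)) p →
          ∀ (n : ℕ) (x : X.obj (op (SimplexCategory.mk n))),
            mapValue (((Ψ.app (op X)).f p).hom c) n x - F.leadingForm X p c n x ∈
              degenerate (simplicialForms k S p) n) ∧
        Functor.whiskerLeft (cochains k) Θ ≫ coproductComparison k S = Ψ ∧
        ∀ X : SSet.{u}, QuasiIso (Θ.app ((cochains k).obj (op X))) ∧
          QuasiIso ((coproductComparison k S).app (op X)) ∧ QuasiIso (Ψ.app (op X))) ∧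
    ∀ (T : Set ℤ) (hST : S ⊆ T) (X : SSet.{u}),
      QuasiIso (tensorComplexMap hST (𝟙 ((cochains k).obj (op X)))) := by
  obtain ⟨F₀⟩ := nonempty_fundamentalForms (k := k) hS
  refine ⟨⟨F₀⟩, fun F => ⟨fun M => quasiIso_theta M F hS, normalizeIso k S, F.thetaNat k S,
    Functor.whiskerLeft (cochains k) (F.thetaNat k S) ≫ coproductComparison k S,
    fun M p w n => ?_, fun M => F.normInclusion_thetaLift,
    fun M p m n => F.toNormQuotient_thetaLiftFun m n, fun X p c hc n x => ?_, rfl,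
    fun X => ⟨F.quasiIso_thetaLift hS, quasiIso_coproductComparison F hS, quasiIso_thetaMaps F hS⟩⟩,
    fun T hST X => FundamentalForms.quasiIso_tensorComplexMap hS hST⟩
  · exact (toNormQuotient_proj n _).symm.trans
      (congrArg _ (normTensorIncl_normalizeIso_hom w n).symm)
  -- An element differs from its projection by a degenerate one, and here the projection is exactly
  -- the leading form.
  · have h := sub_simpProj_mem n ((coproductToMaps X (simplicialForms k S p)
      (F.thetaLiftFun (M := (cochains k).obj (op X)) c)).1 n x)
    rw [F.simpProj_coproductToMaps_thetaLiftFun X hc] at h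
    exact h
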